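/- A root system in a Euclidean space $V$ is a finite set $\Phi$ of non-zero vectors, stable under the reflections $s_\alpha(\beta)=\beta-\langle\beta,\alpha\rangle\alpha$ ($\alpha,\beta\in\Phi$), with all $\langle\beta,\alpha\rangle=\frac{2(\beta,\alpha)}{(\alpha,\alpha)}$ integers; it is reduced if the only multiples of $\alpha\in\Phi$ in $\Phi$ are $\pm\alpha$. Two root systems are isomorphic if there is a bijection between them preserving $\langle\cdot,\cdot\rangle$. A sub-root system of $\Psi$ is a subset of $\Psi$ that is a root system. For $\Psi$ spanning $V$, $\operatorname{Aut}(\Psi)$ is the finite group of permutations of $\Psi$ preserving $\langle\cdot,\cdot\rangle$, acting linearly on $V$; sub-root systems $\Phi_1,\Phi_2$ of $\Psi$ are conjugate if $\gamma\Phi_1=\Phi_2$ for some $\gamma\in\operatorname{Aut}(\Psi)$. Fix a positive system $\Psi^+$. For a reduced sub-root system $\Phi$ of $\Psi$ with Weyl group $W_\Phi=\langle s_\alpha\mid\alpha\in\Phi\rangle$ put $\delta_\Phi=\frac12\sum_{\alpha\in\Phi\cap\Psi^+}\alpha$ and, in the group ring $\mathbb{Q}[V]$ with basis $[v]$, $v\in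 V$, \[A_\Phi=\sum_{w\in W_\Phi}\operatorname{sign}(w)[\delta_\Phi-w\delta_\Phi],\qquad F_{\Phi,\operatorname{Aut}(\Psi)}=\frac{1}{|\operatorname{Aut}(\Psi)|}\sum_{\gamma\in\operatorname{Aut}(\Psi)}\gamma(A_\Phi).\] Theorem. (1) Let $\Psi$ be a classical irreducible root system spanning $V$ (that is, isomorphic to one of $A_n$, $B_n$, $C_n$, $BC_n$ with $n\ge1$ or $D_n$ with $n\ge3$). If there exist non-conjugate reduced sub-root systems $\Phi_1,\Phi_2$ of $\Psi$ with $F_{\Phi_1,\operatorname{Aut}(\Psi)}=F_{\Phi_2,\operatorname{Aut}(\Psi)}$, then $\Psi\cong C_n$ or $\Psi\cong BC_n$ for some $n\ge1$. (2) Let $n\ge1$ and let $\Psi\subset\mathbb{R}^n$ be the standard root system $C_n=\{\pm e_i\pm e_j\ (i\ne j),\ \pm2e_i\}$ or $BC_n=\{\pm e_i\pm e_j\ (i\neq j),\ \pm e_i,\ \pm2e_i\}$. For reduced sub-root systems $\Phi_1,\Phi_2$ of $\Psi$ one has $F_{\Phi_1,\operatorname{Aut}(\Psi)}=F_{\Phi_2,\operatorname{Aut}(\Psi)}$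 if and only if for every $1\le m\le n$ \[b_m(\Phi_1)-b_m(\Phi_2)=a_{2m}(\Phi_1)-a_{2m}(\Phi_2)=0\] and \[a_{2m+1}(\Phi_1)-a_{2m+1}(\Phi_2)=c_m(\Phi_2)-c_m(\Phi_1)=d_{m+1}(\Phi_2)-d_{m+1}(\Phi_1).\] Here $a_k(\Phi)$, $b_k(\Phi)$, $c_k(\Phi)$, $d_k(\Phi)$ are the numbers of factors of $\Phi$ of type $A_{k-1}$, $B_k$, $C_k$, $D_k$ in standard position: the numbers of sets $I\subset\{1,\dots,n\}$ with $|I|=k$ such that the roots of $\Phi$ involving some coordinate in $I$ are exactly, respectively, $\{\varepsilon_ie_i-\varepsilon_je_j : i\ne j\in I\}$ for some signs $\varepsilon_i=\pm1$; $\{\pm e_i\pm e_j : i\ne j\in I\}\cup\{\pm e_i : i\in I\}$; $\{\pm e_i\pm e_j : i\ne j\in I\}\cup\{\pm2e_i : i\in I\}$; $\{\pm e_i\pm e_j : i\ne j\in I\}$. (So $A_1,B_1,C_1$ are distinguished, as are $B_2$ and $C_2$, $D_2$ and $2A_1$, $A_3$ and $D_3$.) -/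

import Mathlib

noncomputable section

namespace RootChar

section General

variable {V W : Type*} [NormedAddCommGroup V] [InnerProductSpace ℝ V]
  [NormedAddCommGroup W] [InnerProductSpace ℝ W]

/-- The cusp product `⟨y, x⟩ = 2 (x, y) / (x, x)`. -/
def cusp (y x : V) : ℝ := 2 * inner ℝ x y / inner ℝ x x

/-- Root systems in a Euclidean vector space, neither assumed reduced nor assumed to span. -/
structure IsRootSystem (Φ : Set V) : Prop where
  finite : Φ.Finite
  zero_notMem : (0 : V) ∉ Φ
  reflect_mem : ∀ α ∈ Φ, ∀ β ∈ Φ, β - cusp β α • α ∈ Φ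
  integral : ∀ α ∈ Φ, ∀ β ∈ Φ, ∃ k : ℤ, cusp β α = k

/-- The only multiples of a root that are roots are the root and its negative. -/
def IsReduced (Φ : Set V) : Prop :=
  ∀ α ∈ Φ, ∀ c : ℝ, c • α ∈ Φ → c = 1 ∨ c = -1

/-- An irreducible root system spans the ambient space and is not a disjoint union of two
non-empty mutually orthogonal parts. -/
structure IsIrreducible (Ψ : Set V) : Prop where
  isRootSystem : IsRootSystem Ψ
  span_eq_top : Submodule.span ℝ Ψ = ⊤
  nonempty : Ψ.Nonempty
  indecomposable : ∀ Ψ₁ Ψ₂ : Set V, Ψ = Ψ₁ ∪ Ψ₂ → Disjoint Ψ₁ Ψ₂ →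
    (∀ α ∈ Ψ₁, ∀ β ∈ Ψ₂, cusp α β = 0) → Ψ₁ = ∅ ∨ Ψ₂ = ∅

/-- `Φ` is a reduced sub-root system of `Ψ`. -/
structure IsReducedSub (Φ Ψ : Set V) : Prop where
  isRootSystem : IsRootSystem Φ
  isReduced : IsReduced Φ
  subset : Φ ⊆ Ψ

/-- Isomorphism of abstract root systems: a bijection between the roots that preserves the cusp
product. -/
def Iso (Ψ : Set V) (Ψ' : Set W) : Prop :=
  ∃ g : Ψ ≃ Ψ', ∀ α β : Ψ, cusp (g α : W) (g β : W) = cusp (α : V) (β : V)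

/-- The automorphism group of a root system that spans `V`. A permutation of the roots that
preserves the cusp product extends uniquely to a linear automorphism of `V`, and the group is
realised by these extensions. -/
def autGroup (Ψ : Set V) : Subgroup (V ≃ₗ[ℝ] V) where
  carrier := {g | g '' Ψ = Ψ ∧ ∀ α ∈ Ψ, ∀ β ∈ Ψ, cusp (g α) (g β) = cusp α β}
  one_mem' := by
    refine ⟨?_, fun α _ β _ => rfl⟩
    ext x
    simp
  mul_mem' := by
    rintro g h ⟨hg, hg'⟩ ⟨hh, hh'⟩
    have key : ∀ α ∈ Ψ, h α ∈ Ψ := fun α hα => hh ▸ Set.mem_image_of_mem h hα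
    refine ⟨?_, fun α hα β hβ => ?_⟩
    · have : ((g * h : V ≃ₗ[ℝ] V) : V → V) = g ∘ h := rfl
      rw [this, Set.image_comp, hh, hg]
    · exact (hg' _ (key α hα) _ (key β hβ)).trans (hh' α hα β hβ)
  inv_mem' := by
    rintro g ⟨hg, hg'⟩
    have hl : ∀ x, g⁻¹ (g x) = x := fun x => g.symm_apply_apply x
    have hr : ∀ x, g (g⁻¹ x) = x := fun x => g.apply_symm_apply x
    have key : ∀ α ∈ Ψ, g⁻¹ α ∈ Ψ := by
      intro α hα
      rw [← hg] at hα
      obtain ⟨β, hβ, rfl⟩ := hα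
      rwa [hl]
    refine ⟨?_, fun α hα β hβ => ?_⟩
    · ext x
      constructor
      · rintro ⟨y, hy, rfl⟩
        exact key y hy
      · intro hx
        exact ⟨g x, hg ▸ Set.mem_image_of_mem g hx, hl x⟩
    · have := hg' _ (key α hα) _ (key β hβ)
      rw [hr, hr] at this
      exact this.symm

/-- Conjugacy of sub-root systems under the automorphism group of `Ψ`. -/
def Conj (Ψ Φ₁ Φ₂ : Set V) : Prop := ∃ g ∈ autGroup Ψ, g '' Φ₁ = Φ₂

/-- The reflection in the hyperplane orthogonal to `α`. -/
def refl (α : V) : V ≃ₗ[ℝ] V := ((ℝ ∙ α)ᗮ).reflection.toLinearEquiv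

theorem refl_apply (α v : V) : refl α v = v - cusp v α • α := by
  have h : refl α v = (ℝ ∙ α)ᗮ.reflection v := rfl
  rw [h, Submodule.reflection_orthogonal_apply, Submodule.reflection_singleton_apply, cusp,
    real_inner_self_eq_norm_sq]
  simp only [RCLike.ofReal_real_eq_id, id]
  module

/-- The Weyl group of `Φ`, acting on the ambient space. -/
def weylGroup (Φ : Set V) : Subgroup (V ≃ₗ[ℝ] V) := Subgroup.closure (refl '' Φ)

/-- The half sum of the roots of `Φ` that are positive for the order given by the functional
`f`. -/
def delta (f : V →ₗ[ℝ] ℝ) (Φ : Set V) : V :=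
  (1 / 2 : ℝ) • ∑ᶠ α ∈ {α ∈ Φ | 0 < f α}, α

/-- The sign of a Weyl group element, that is the sign of its determinant. -/
def sgn (w : V ≃ₗ[ℝ] V) : ℚ := (SignType.sign (LinearMap.det (w : V →ₗ[ℝ] V)) : ℚ)

/-- `A_Φ = ∑ sign(w) [δ_Φ - w δ_Φ]`, the sum over the Weyl group of `Φ`, in the group ring. -/
def charA (f : V →ₗ[ℝ] ℝ) (Φ : Set V) : AddMonoidAlgebra ℚ V :=
  ∑ᶠ w : weylGroup Φ,
    AddMonoidAlgebra.single (delta f Φ - (w : V ≃ₗ[ℝ] V) (delta f Φ)) (sgn (w : V ≃ₗ[ℝ] V))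

/-- `F_{Φ,G} = |G|⁻¹ ∑_{γ ∈ G} γ(A_Φ)` for a finite group `G` of linear automorphisms. -/
def charF (G : Subgroup (V ≃ₗ[ℝ] V)) (f : V →ₗ[ℝ] ℝ) (Φ : Set V) : AddMonoidAlgebra ℚ V :=
  (1 / (Nat.card G : ℚ)) •
    ∑ᶠ γ : G, AddMonoidAlgebra.mapDomain (γ : V ≃ₗ[ℝ] V) (charA f Φ)

/-- The group over which `charF` averages is finite. -/
theorem finite_autGroup {Ψ : Set V} (hfin : Ψ.Finite) (hspan : Submodule.span ℝ Ψ = ⊤) :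
    Finite (autGroup Ψ) := by
  have := hfin.to_subtype
  let F : autGroup Ψ → (Ψ → Ψ) := fun g α =>
    ⟨g.1 α, g.2.1.subset (Set.mem_image_of_mem g.1 α.2)⟩
  refine Finite.of_injective F fun g h hgh => Subtype.ext ?_
  apply LinearEquiv.toLinearMap_injective
  apply LinearMap.ext_on hspan
  intro α hα
  exact congrArg Subtype.val (congrFun hgh ⟨α, hα⟩)

/-- The group over which `charA` sums is finite. -/
theorem finite_weylGroup [FiniteDimensional ℝ V] {Φ : Set V} (h : IsRootSystem Φ) :
    Finite (weylGroup Φ) := by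
  have := h.finite.to_subtype
  have key : ∀ w ∈ weylGroup Φ, (∀ α ∈ Φ, w α ∈ Φ) ∧
      ∀ v ∈ (Submodule.span ℝ Φ)ᗮ, w v = v := by
    intro w hw
    refine Subgroup.closure_induction'' (p := fun w _ => (∀ α ∈ Φ, w α ∈ Φ) ∧
      ∀ v ∈ (Submodule.span ℝ Φ)ᗮ, w v = v) ?_ ?_ ?_ ?_ hw
    · rintro _ ⟨α, hα, rfl⟩
      refine ⟨fun β hβ => by rw [refl_apply]; exact h.reflect_mem α hα β hβ, fun v hv => ?_⟩
      have h0 : inner ℝ α v = 0 := hv α (Submodule.subset_span hα)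
      simp [refl_apply, cusp, h0]
    · rintro _ ⟨α, hα, rfl⟩
      have hi : (refl α)⁻¹ = refl α := by
        rw [inv_eq_iff_mul_eq_one]
        ext v
        exact Submodule.reflection_reflection _ v
      rw [hi]
      refine ⟨fun β hβ => by rw [refl_apply]; exact h.reflect_mem α hα β hβ, fun v hv => ?_⟩
      have h0 : inner ℝ α v = 0 := hv α (Submodule.subset_span hα)
      simp [refl_apply, cusp, h0]
    · exact ⟨fun α hα => hα, fun v _ => rfl⟩
    · rintro x y _ _ ⟨hx, hx'⟩ ⟨hy, hy'⟩
      refine ⟨fun α hα => hx _ (hy _ hα), fun v hv => ?_⟩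
      change x (y v) = v
      rw [hy' v hv, hx' v hv]
  let F : weylGroup Φ → (Φ → Φ) := fun g α => ⟨g.1 α, (key g.1 g.2).1 α α.2⟩
  refine Finite.of_injective F fun g h hgh => Subtype.ext ?_
  apply LinearEquiv.toLinearMap_injective
  have h1 : Set.EqOn (g.1 : V →ₗ[ℝ] V) (h.1 : V →ₗ[ℝ] V) (Submodule.span ℝ Φ) :=
    LinearMap.eqOn_span fun α hα => congrArg Subtype.val (congrFun hgh ⟨α, hα⟩)
  ext v
  obtain ⟨a, ha, b, hb, rfl⟩ := (Submodule.span ℝ Φ).exists_add_mem_mem_orthogonal v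
  rw [map_add, map_add, h1 ha]
  congr 1
  exact ((key g.1 g.2).2 b hb).trans ((key h.1 h.2).2 b hb).symm

end General

section Standard

variable {n : ℕ}

/-- The standard basis vector `e_i` of `ℝⁿ`. -/
def e (i : Fin n) : EuclideanSpace ℝ (Fin n) := EuclideanSpace.single i 1

/-- The roots `±(ε_i e_i - ε_j e_j)`, `i ≠ j` in `I`: a copy of `A_{m-1}`, `m = |I|`. -/
def setA (I : Finset (Fin n)) (ε : Fin n → ℤˣ) : Set (EuclideanSpace ℝ (Fin n)) :=
  {α | ∃ i ∈ I, ∃ j ∈ I, i ≠ j ∧ α = ε i • e i - ε j • e j}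

/-- The roots `±e_i ± e_j`, `i ≠ j` in `I`: a copy of `D_m`, `m = |I|`. -/
def setD (I : Finset (Fin n)) : Set (EuclideanSpace ℝ (Fin n)) :=
  {α | ∃ i ∈ I, ∃ j ∈ I, i ≠ j ∧ ∃ s t : ℤˣ, α = s • e i + t • e j}

/-- The roots `±e_i ± e_j` and `±e_i` with indices in `I`: a copy of `B_m`, `m = |I|`. -/
def setB (I : Finset (Fin n)) : Set (EuclideanSpace ℝ (Fin n)) :=
  setD I ∪ {α | ∃ i ∈ I, ∃ s : ℤˣ, α = s • e i}

/-- The roots `±e_i ± e_j` and `±2e_i` with indices in `I`: a copy of `C_m`, `m = |I|`. -/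
def setC (I : Finset (Fin n)) : Set (EuclideanSpace ℝ (Fin n)) :=
  setD I ∪ {α | ∃ i ∈ I, ∃ s : ℤˣ, α = s • ((2 : ℝ) • e i)}

/-- The root system `A_{n-1}` in `ℝⁿ`; it spans a hyperplane. -/
def typeA (n : ℕ) : Set (EuclideanSpace ℝ (Fin n)) := setA Finset.univ 1

/-- The root system `B_n`. -/
def typeB (n : ℕ) : Set (EuclideanSpace ℝ (Fin n)) := setB Finset.univ

/-- The root system `C_n`. -/
def typeC (n : ℕ) : Set (EuclideanSpace ℝ (Fin n)) := setC Finset.univ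

/-- The root system `D_n`. -/
def typeD (n : ℕ) : Set (EuclideanSpace ℝ (Fin n)) := setD Finset.univ

/-- The root system `BC_n`. -/
def typeBC (n : ℕ) : Set (EuclideanSpace ℝ (Fin n)) := typeB n ∪ typeC n

/-- `Ψ` is of one of the classical types `A_{n-1}` (`n ≥ 2`), `B_n`, `C_n`, `BC_n` (`n ≥ 1`),
`D_n` (`n ≥ 3`, where `D_3` is `A_3`). -/
def IsClassical {V : Type*} [NormedAddCommGroup V] [InnerProductSpace ℝ V] (Ψ : Set V) : Prop :=
  ∃ n : ℕ, (2 ≤ n ∧ Iso Ψ (typeA n)) ∨ (1 ≤ n ∧ Iso Ψ (typeB n)) ∨ (1 ≤ n ∧ Iso Ψ (typeC n)) ∨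
    (1 ≤ n ∧ Iso Ψ (typeBC n)) ∨ (3 ≤ n ∧ Iso Ψ (typeD n))

/-- The roots of `Φ` that involve a coordinate from `I`. A block `I` of `Φ` is of type `X` when
these roots form the standard system of type `X` on `I`; no other root then involves `I`. -/
def meet (Φ : Set (EuclideanSpace ℝ (Fin n))) (I : Finset (Fin n)) :
    Set (EuclideanSpace ℝ (Fin n)) :=
  {α ∈ Φ | ∃ i ∈ I, α i ≠ 0}

/-- `a_m(Φ)`: the number of factors `A_{m-1}` of `Φ`, that is of blocks on which `Φ` is the standard
`A_{m-1}` after a change of signs of the coordinates. -/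
def countA (m : ℕ) (Φ : Set (EuclideanSpace ℝ (Fin n))) : ℕ :=
  Set.ncard {I : Finset (Fin n) | I.card = m ∧ ∃ ε : Fin n → ℤˣ, meet Φ I = setA I ε}

/-- `b_m(Φ)`: the number of factors `B_m` of `Φ`, for `m ≥ 1`. -/
def countB (m : ℕ) (Φ : Set (EuclideanSpace ℝ (Fin n))) : ℕ :=
  Set.ncard {I : Finset (Fin n) | I.card = m ∧ meet Φ I = setB I}

/-- `c_m(Φ)`: the number of factors `C_m` of `Φ`, for `m ≥ 1`. -/
def countC (m : ℕ) (Φ : Set (EuclideanSpace ℝ (Fin n))) : ℕ :=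
  Set.ncard {I : Finset (Fin n) | I.card = m ∧ meet Φ I = setC I}

/-- `d_m(Φ)`: the number of factors `D_m` of `Φ`, for `m ≥ 2`. -/
def countD (m : ℕ) (Φ : Set (EuclideanSpace ℝ (Fin n))) : ℕ :=
  Set.ncard {I : Finset (Fin n) | I.card = m ∧ meet Φ I = setD I}

end Standard

end RootChar

end

/-! Attach to a vector v of ℝⁿ the monomial ∏ X_{|v_i|} (`mono`), with variables indexed by real
numbers. Two vectors have the same monomial exactly when a signed permutation carries one to the
other. If Aut(Ψ) is the group of all signed permutations, as for B_n, C_n, BC_n and for D_n with n ≥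
3, n ≠ 4, then averaging over Aut(Ψ) forgets exactly what passing to monomials forgets: the averaged
characters agree if and only if the orbit polynomials `evMap (mono univ) (charA f Φ)` agree
(`charF_eq_iff`).

The coordinates fall into blocks, on each of which Φ is a standard system of type A, B, C or D up to
signs. Weyl group, half sum and monomial all split along blocks, so the orbit polynomial is a
product over blocks (`evMap_charA_eq_prod_blocks`). On one block the alternating sum is the Leibniz
expansion of a determinant. For A_{k-1}, B_k, C_k, D_k this gives det(x_{|i-j|}), det(x_{|i-j|} -
x_{i+j+1}), det(x_{|i-j|} - x_{i+j+2}) and half of det(x_{|i-j|} + x_{i+j}).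

A symmetric Toeplitz matrix of odd size commutes with reversal of the indices and splits into its
odd and even parts. Hence the polynomial of A_{2m} is that of C_m times that of D_{m+1}
(`factorPoly_odd`). All multiplicative relations come from this one (`prod_factorPoly_eq_iff`):
after splitting the odd A factors, points with x_0 = 1 and a single further variable ±1 isolate the
remaining factors one at a time, from the largest down. The trivial blocks A_0 are then counted by
the total size n. This is (2).

For (1), a subsystem of B_n or D_n has no block of type C, so the relation has no room to act and
the orbit polynomial determines the numbers of blocks. Equal numbers give a conjugating signed
permutation (`exists_sp_image_eq`). For A_n and D_4 a coarser invariant suffices: X_r ↦ exp(c r²)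
turns the monomial of v into exp(c |v|²), which every isometry preserves. In type A the determinants
become Vandermonde determinants in q = exp(c), and a suitable root of unity kills the one of size k
but none of smaller size, so the block sizes can be read off. In D_4 triality, the source of the
additional automorphisms, moves every subsystem to one with one of eight lists of factors, and the
values at q = 1/2 distinguish these. -/

noncomputable section

namespace RootChar

open Matrix MvPolynomial

/-! ### Four families of Toeplitz-type determinants -/

section Determinants

variable {R S : Type*} [CommRing R] [CommRing S]

/-- The symmetric Toeplitz determinant `det (x_{|i-j|})`. -/
def toepA (x : ℕ → R) (k : ℕ) : R :=
  det (of fun i j : Fin k => x ((i : ℤ) - j).natAbs)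

/-- The determinant `det (x_{|i-j|} - x_{i+j+1})`. -/
def toepB (x : ℕ → R) (k : ℕ) : R :=
  det (of fun i j : Fin k => x ((i : ℤ) - j).natAbs - x (i + j + 1))

/-- The determinant `det (x_{|i-j|} - x_{i+j+2})`. -/
def toepC (x : ℕ → R) (k : ℕ) : R :=
  det (of fun i j : Fin k => x ((i : ℤ) - j).natAbs - x (i + j + 2))

/-- The determinant `det (x_{|i-j|} + x_{i+j})`. -/
def toepD (x : ℕ → R) (k : ℕ) : R :=
  det (of fun i j : Fin k => x ((i : ℤ) - j).natAbs + x (i + j))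

theorem map_toepA (φ : R →+* S) (x : ℕ → R) (k : ℕ) :
    φ (toepA x k) = toepA (φ ∘ x) k := by
  rw [toepA, RingHom.map_det]; rfl

theorem map_toepB (φ : R →+* S) (x : ℕ → R) (k : ℕ) :
    φ (toepB x k) = toepB (φ ∘ x) k := by
  rw [toepB, RingHom.map_det, toepB]; congr 1; ext; simp

theorem map_toepC (φ : R →+* S) (x : ℕ → R) (k : ℕ) :
    φ (toepC x k) = toepC (φ ∘ x) k := by
  rw [toepC, RingHom.map_det, toepC]; congr 1; ext; simp

theorem map_toepD (φ : R →+* S) (x : ℕ → R) (k : ℕ) :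
    φ (toepD x k) = toepD (φ ∘ x) k := by
  rw [toepD, RingHom.map_det, toepD]; congr 1; ext; simp

/-- A symmetric Toeplitz determinant of odd size factors into its antisymmetric and its symmetric
part. -/
theorem two_mul_toepA_odd (x : ℕ → R) (m : ℕ) :
    2 * toepA x (2 * m + 1) = toepC x m * toepD x (m + 1) := by
  have hm : 2 * m + 1 = m + 1 + m := by ring
  rw [hm]
  let A : Matrix (Fin m) (Fin m) R := of fun i j => x ((i : ℤ) - j).natAbs
  let B : Matrix (Fin m) (Fin (m + 1)) R := of fun i j => x (i + 1 + j)
  let D : Matrix (Fin (m + 1)) (Fin (m + 1)) R := of fun i j => x ((i : ℤ) - j).natAbs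
  let U : Matrix (Fin m) (Fin (m + 1)) R := (1 : Matrix _ _ R).submatrix Fin.succ id
  -- Positions are counted from the middle index: `Fin m` lists 1, …, m and `Fin (m + 1)` lists 0,
  -- -1, …, -m. `U` matches the position i + 1 with its mirror image -(i + 1).
  let e : Fin m ⊕ Fin (m + 1) ≃ Fin (m + 1 + m) :=
    (Equiv.sumComm _ _).trans ((Equiv.sumCongr Fin.revPerm (Equiv.refl _)).trans finSumFinEquiv)
  have h1 : toepA x (m + 1 + m) = (fromBlocks A B Bᵀ D).det := by
    rw [toepA, ← det_submatrix_equiv_self e]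
    congr 1
    ext (i | i) (j | j) <;> simp [e, A, B, D, Fin.val_rev] <;> congr 1 <;> omega
  have hU : ∀ (Y : Matrix (Fin (m + 1)) (Fin (m + 1)) R) i j, (U * Y) i j = Y i.succ j := by
    intro Y i j
    simp [U, mul_apply, one_apply]
  have hU' : ∀ (Y : Matrix (Fin (m + 1)) (Fin m) R) i j, (U * Y) i j = Y i.succ j := by
    intro Y i j
    simp [U, mul_apply, one_apply]
  have hUs : ∀ {p : Type} (Y : Matrix p (Fin m) R) i j, (Y * U) i (Fin.succ j) = Y i j := by
    intro p Y i j
    simp [U, mul_apply, one_apply, Fin.succ_inj]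
  have hU0 : ∀ {p : Type} (Y : Matrix p (Fin m) R) i, (Y * U) i 0 = 0 := by
    intro p Y i
    simp [U, mul_apply, one_apply, Fin.succ_ne_zero]
  let K : Matrix (Fin m) (Fin m) R :=
    of fun i j : Fin m => x ((i : ℤ) - j).natAbs - x (i + j + 2)
  have hK : A - U * Bᵀ = K := by
    ext i j
    rw [Matrix.sub_apply, hU']
    simp only [A, B, K, of_apply, transpose_apply, Fin.val_succ]
    congr 2
    omega
  -- A difference of two mirror rows is odd under the mirror, so adding the column of j + 1 to that
  -- of -(j + 1) clears the upper right block.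
  have hz : K * U + (B - U * D) = 0 := by
    ext i j
    rw [Matrix.add_apply, Matrix.sub_apply, hU]
    refine Fin.cases ?_ (fun j => ?_) j
    · rw [hU0]
      simp only [B, D, of_apply, Fin.val_succ, Fin.val_zero, Matrix.zero_apply]
      rw [zero_add, sub_eq_zero]
      congr 1
    · rw [hUs]
      simp only [B, D, K, of_apply, Fin.val_succ, Matrix.zero_apply]
      have e1 : ((i : ℕ) + 1 + (j + 1)) = i + j + 2 := by ring
      have e2 : (((i + 1 : ℕ) : ℤ) - ((j + 1 : ℕ) : ℤ)) = (i : ℤ) - j := by push_cast; ring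
      rw [e1, e2]
      ring
  have h2 : (fromBlocks A B Bᵀ D).det = K.det * (Bᵀ * U + D).det := by
    have h := congrArg det (show fromBlocks 1 (-U) 0 1 * fromBlocks A B Bᵀ D * fromBlocks 1 U 0 1 =
      fromBlocks K 0 Bᵀ (Bᵀ * U + D) by
        rw [fromBlocks_multiply, fromBlocks_multiply]
        congr 1
        · simp [← hK, sub_eq_add_neg]
        · rw [← hz, ← hK]; simp [sub_eq_add_neg]
        · simp
        · simp)
    rw [det_mul, det_mul, det_fromBlocks_zero₂₁, det_fromBlocks_zero₂₁,
      det_fromBlocks_zero₁₂] at h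
    simpa using h
  -- The middle position is its own mirror image, so its column is doubled in `toepD`: this is the
  -- factor 2.
  have h3 : toepD x (m + 1) = (Bᵀ * U + D).det * 2 := by
    have : (2 : R) = (diagonal (Fin.cons 2 fun _ : Fin m => (1 : R))).det := by
      rw [det_diagonal, Fin.prod_univ_succ]; simp
    rw [this, ← det_mul, toepD]
    congr 1
    ext i j
    rw [mul_diagonal, Matrix.add_apply]
    refine Fin.cases ?_ (fun j => ?_) j
    · rw [hU0]
      simp [D, mul_two]
    · rw [hUs]
      simp only [B, D, of_apply, transpose_apply, Fin.val_succ, Fin.cons_succ, mul_one]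
      rw [add_comm]
      congr 2
      ring
  rw [h1, h2, h3]
  change _ = K.det * _
  ring

end Determinants

/-! ### Values of the determinants at x_0 = 1, x_N = t -/

section Evaluation

/-- The point at which the zeroth variable is `1`, the `N`-th variable is `t` and all others
vanish. -/
def spike (N : ℕ) (t : ℚ) (k : ℕ) : ℚ := if k = 0 then 1 else if k = N then t else 0

variable {N k : ℕ} {t : ℚ}

theorem toepA_spike (h : k ≤ N) : toepA (spike N t) k = 1 := by
  rw [toepA, ← det_one (n := Fin k)]
  congr 1
  ext i j
  rw [of_apply, one_apply]
  by_cases hij : i = j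
  · simp [hij, spike]
  · rw [if_neg hij, spike, if_neg, if_neg] <;> omega

/-- At size N + 1 the variable of index N sits only in the two corners, and t² = 1 makes the last
row t times the first. -/
theorem toepA_spike_eq_zero (hN : 1 ≤ N) (ht : t = 1 ∨ t = -1) :
    toepA (spike N t) (N + 1) = 0 := by
  have h0 : (0 : Fin (N + 1)) ≠ Fin.last N := by
    intro h; have := congrArg Fin.val h; simp at this; omega
  have hrow : ∀ j : Fin (N + 1), spike N t ((N : ℤ) - j).natAbs = t * spike N t j := by
    intro j
    have hj := j.isLt
    have htt : t * t = 1 := by rcases ht with rfl | rfl <;> norm_num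
    simp only [spike]
    by_cases h1 : (j : ℕ) = 0
    · rw [h1, if_neg (by omega), if_pos (by omega), if_pos rfl, mul_one]
    · by_cases h2 : (j : ℕ) = N
      · rw [if_pos (by omega), if_neg h1, if_pos h2, htt]
      · rw [if_neg (by omega), if_neg (by omega), if_neg h1, if_neg h2, mul_zero]
  rw [toepA, ← det_updateRow_add_smul_self _ h0.symm (-t)]
  apply det_eq_zero_of_row_eq_zero (Fin.last N)
  intro j
  simp [hrow]

/-- The bound on k lets the variable of index N reach at most the last diagonal entry, so the matrix
is diagonal. The bounds 2k ≤ N for type C and 2k ≤ N + 2 for type D have the same purpose. -/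
theorem toepB_spike (h : 2 * k ≤ N + 1) :
    toepB (spike N t) k = ∏ i : Fin k, (1 - spike N t (2 * i + 1)) := by
  rw [toepB, ← det_diagonal]
  congr 1
  ext i j
  rw [of_apply]
  by_cases hij : i = j
  · subst hij
    rw [diagonal_apply_eq]
    simp [spike, two_mul]
  · rw [diagonal_apply_ne _ hij, spike, spike, if_neg, if_neg, if_neg, if_neg] <;>
      first | omega | simp

theorem toepC_spike (h : 2 * k ≤ N) :
    toepC (spike N t) k = ∏ i : Fin k, (1 - spike N t (2 * i + 2)) := by
  rw [toepC, ← det_diagonal]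
  congr 1
  ext i j
  rw [of_apply]
  by_cases hij : i = j
  · subst hij
    rw [diagonal_apply_eq]
    simp [spike, two_mul]
  · rw [diagonal_apply_ne _ hij, spike, spike, if_neg, if_neg, if_neg, if_neg] <;>
      first | omega | simp

theorem toepD_spike (hN : 1 ≤ N) (h : 2 * k ≤ N + 2) :
    toepD (spike N t) k = ∏ i : Fin k, (1 + spike N t (2 * i)) := by
  rw [toepD, ← det_diagonal]
  congr 1
  ext i j
  rw [of_apply]
  by_cases hij : i = j
  · subst hij
    rw [diagonal_apply_eq]
    simp [spike, two_mul]
  · rw [diagonal_apply_ne _ hij, spike, spike, if_neg, if_neg, if_neg, if_neg] <;>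
      first | omega | simp

theorem toepB_spike_ne_zero (h : 2 * k ≤ N + 1) (ht : t ≠ 1 ∨ 2 * k ≤ N) :
    toepB (spike N t) k ≠ 0 := by
  rw [toepB_spike h, Finset.prod_ne_zero_iff]
  intro i _
  rw [spike, if_neg (by omega), sub_ne_zero]
  split_ifs with h1
  · rcases ht with ht | ht
    · exact ht.symm
    · omega
  · norm_num

theorem toepB_spike_eq_zero (hk : 1 ≤ k) (h : 2 * k = N + 1) : toepB (spike N 1) k = 0 := by
  rw [toepB_spike h.le, Finset.prod_eq_zero (Finset.mem_univ ⟨k - 1, by omega⟩)]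
  rw [spike, if_neg (by simp), if_pos (by simp; omega), sub_self]

theorem toepC_spike_ne_zero (h : 2 * k ≤ N) (ht : t ≠ 1 ∨ 2 * k < N) :
    toepC (spike N t) k ≠ 0 := by
  rw [toepC_spike h, Finset.prod_ne_zero_iff]
  intro i _
  rw [spike, if_neg (by omega), sub_ne_zero]
  split_ifs with h1
  · rcases ht with ht | ht
    · exact ht.symm
    · omega
  · norm_num

theorem toepC_spike_eq_zero (hk : 1 ≤ k) (h : 2 * k = N) : toepC (spike N 1) k = 0 := by
  rw [toepC_spike h.le, Finset.prod_eq_zero (Finset.mem_univ ⟨k - 1, by omega⟩)]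
  rw [spike, if_neg (by simp), if_pos (by simp; omega), sub_self]

theorem toepD_spike_ne_zero (hN : 1 ≤ N) (h : 2 * k ≤ N + 2) (ht : t ≠ -1 ∨ 2 * k ≤ N + 1) :
    toepD (spike N t) k ≠ 0 := by
  rw [toepD_spike hN h, Finset.prod_ne_zero_iff]
  intro i _
  rw [spike]
  split_ifs with h1 h2
  · norm_num
  · rcases ht with ht | ht
    · intro h3; exact ht (by linarith)
    · omega
  · norm_num

theorem toepD_spike_eq_zero (hN : 1 ≤ N) (h : 2 * k = N + 2) : toepD (spike N (-1)) k = 0 := by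
  rw [toepD_spike hN h.le, Finset.prod_eq_zero (Finset.mem_univ ⟨k - 1, by omega⟩)]
  rw [spike, if_neg (by simp; omega), if_pos (by simp; omega)]
  norm_num

end Evaluation

/-! ### Multiplicative relations between the factor polynomials -/

section Independence

/-- The polynomial ring in which the Weyl group orbit sums are encoded. -/
abbrev Poly := MvPolynomial ℝ ℚ

/-- The variable of integral index `k`. -/
def var (k : ℕ) : Poly := X (k : ℝ)

/-- The polynomials attached to the factors of type `A_{k-1}`, `B_k`, `C_k` and `D_k`. -/
def factorPoly : Fin 4 → ℕ → Poly
  | 0, k => toepA var k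
  | 1, k => toepB var k
  | 2, k => toepC var k
  -- `toepD` sums over all sign changes, the Weyl group of D_k only over the even ones. Both
  -- parities contribute equally because the half sum has a zero coordinate.
  | 3, k => (1 / 2 : ℚ) • toepD var k

/-- The factor 1/2 of type D absorbs the 2 of `two_mul_toepA_odd`. All coincidences between
characters in types C and BC stem from this relation. -/
theorem factorPoly_odd (m : ℕ) :
    factorPoly 0 (2 * m + 1) = factorPoly 2 m * factorPoly 3 (m + 1) := by
  have h := two_mul_toepA_odd var m
  simp only [factorPoly]
  have h2 : ∀ y : Poly, (2 : Poly) * y = (2 : ℚ) • y := fun y => by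
    rw [ofNat_smul_eq_nsmul, nsmul_eq_mul]; rfl
  rw [mul_smul_comm, ← h, h2, smul_smul]
  norm_num

/-- Evaluation at `spike N t`. -/
def evSpike (N : ℕ) (t : ℚ) : Poly →ₐ[ℚ] ℚ :=
  aeval fun r : ℝ => if r = 0 then 1 else if r = N then t else 0

theorem evSpike_var (N : ℕ) (t : ℚ) : (evSpike N t : Poly →+* ℚ) ∘ var = spike N t := by
  ext k
  simp [evSpike, var, spike]

theorem evSpike_factorPoly (N : ℕ) (t : ℚ) (k : ℕ) :
    evSpike N t (factorPoly 0 k) = toepA (spike N t) k ∧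
    evSpike N t (factorPoly 1 k) = toepB (spike N t) k ∧
    evSpike N t (factorPoly 2 k) = toepC (spike N t) k ∧
    evSpike N t (factorPoly 3 k) = 1 / 2 * toepD (spike N t) k := by
  rw [← evSpike_var, ← map_toepA, ← map_toepB, ← map_toepC, ← map_toepD]
  simp [factorPoly]

/-- With the zeroth variable 1 and all others 0, no factor vanishes. -/
theorem factorPoly_ne_zero (τ : Fin 4) (k : ℕ) : factorPoly τ k ≠ 0 := by
  intro h
  have h' := congrArg (evSpike (2 * k + 1) 0) h
  obtain ⟨h0, h1, h2, h3⟩ := evSpike_factorPoly (2 * k + 1) 0 k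
  rw [map_zero] at h'
  fin_cases τ
  · have := toepA_spike (N := 2 * k + 1) (k := k) (t := 0) (by omega)
    exact one_ne_zero (this.symm.trans (h0.symm.trans h'))
  · exact toepB_spike_ne_zero (by omega) (Or.inr (by omega)) (h1.symm.trans h')
  · exact toepC_spike_ne_zero (by omega) (Or.inr (by omega)) (h2.symm.trans h')
  · have := h3.symm.trans h'
    have h4 := toepD_spike_ne_zero (N := 2 * k + 1) (k := k) (t := 0) (by omega) (by omega)
      (Or.inr (by omega))
    exact h4 (by linarith)

/-- A homomorphism that kills p but neither cofactor reads off the exponent of p after cancellation;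
p need not be prime. -/
theorem eq_of_pow_mul_eq {R S : Type*} [CommRing R] [IsDomain R] [CommRing S] [IsDomain S]
    (φ : R →+* S) {p u u' : R} {m m' : ℕ} (hp : p ≠ 0) (hφ : φ p = 0) (hu : φ u ≠ 0)
    (hu' : φ u' ≠ 0) (h : p ^ m * u = p ^ m' * u') : m = m' := by
  wlog hlt : m < m' generalizing m m' u u'
  · rcases (not_lt.1 hlt).eq_or_lt with h1 | h1
    · exact h1.symm
    · exact (this hu' hu h.symm h1).symm
  obtain ⟨d, rfl⟩ := Nat.exists_eq_add_of_lt hlt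
  rw [pow_succ, pow_add, mul_assoc, mul_assoc] at h
  have h1 := mul_left_cancel₀ (pow_ne_zero m hp) h
  exact absurd (by rw [h1]; simp [hφ]) hu

/-- The product of the polynomials of the factors, ordered by their top variable. -/
def stageProd {R : Type*} [CommMonoid R] (p : Fin 4 → ℕ → R) (c : Fin 4 → ℕ → ℕ) (M : ℕ) : R :=
  -- Stage m has top variables of index 2m + 1 (types A and B) and 2m + 2 (types C and D). Each A of
  -- odd size 2m + 3 is already split into a C and a D, hence the sums of exponents.
  ∏ m ∈ Finset.range M, (p 0 (2 * m + 2) ^ c 0 (2 * m + 2) * p 1 (m + 1) ^ c 1 (m + 1) *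
    (p 2 (m + 1) ^ (c 0 (2 * m + 3) + c 2 (m + 1)) *
      p 3 (m + 2) ^ (c 0 (2 * m + 3) + c 3 (m + 2))))

theorem stageProd_succ {R : Type*} [CommMonoid R] (p : Fin 4 → ℕ → R) (c : Fin 4 → ℕ → ℕ)
    (M : ℕ) : stageProd p c (M + 1) = stageProd p c M *
    (p 0 (2 * M + 2) ^ c 0 (2 * M + 2) * p 1 (M + 1) ^ c 1 (M + 1) *
    (p 2 (M + 1) ^ (c 0 (2 * M + 3) + c 2 (M + 1)) *
      p 3 (M + 2) ^ (c 0 (2 * M + 3) + c 3 (M + 2)))) :=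
  Finset.prod_range_succ _ _

/-- Stages below M only involve variables of index at most 2M, so none of their factors sees the
value t at N. -/
theorem evSpike_stageProd_ne_zero {N M : ℕ} (h : 2 * M + 1 ≤ N) (t : ℚ) (c : Fin 4 → ℕ → ℕ) :
    evSpike N t (stageProd factorPoly c M) ≠ 0 := by
  rw [stageProd, map_prod, Finset.prod_ne_zero_iff]
  intro m hm
  have hm := Finset.mem_range.1 hm
  simp only [map_mul, map_pow]
  refine mul_ne_zero (mul_ne_zero ?_ ?_) (mul_ne_zero ?_ ?_) <;> apply pow_ne_zero
  · rw [(evSpike_factorPoly N t _).1, toepA_spike (by omega)]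
    norm_num
  · rw [(evSpike_factorPoly N t _).2.1]
    exact toepB_spike_ne_zero (by omega) (Or.inr (by omega))
  · rw [(evSpike_factorPoly N t _).2.2.1]
    exact toepC_spike_ne_zero (by omega) (Or.inr (by omega))
  · rw [(evSpike_factorPoly N t _).2.2.2]
    exact mul_ne_zero (by norm_num)
      (toepD_spike_ne_zero (by omega) (by omega) (Or.inr (by omega)))

/-- The top stage is peeled off. The value 1 at the index 2M + 2 kills C alone and -1 kills D alone.
At the index 2M + 1 the value -1 kills A but not B; the value 1 kills both, so A has to be cancelled
before B is read off. The exponents a and a' stay free, since x_0 = 1 at all these points. -/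
theorem stageProd_injective {M : ℕ} {c c' : Fin 4 → ℕ → ℕ} {a a' : ℕ}
    (h : factorPoly 0 1 ^ a * stageProd factorPoly c M =
      factorPoly 0 1 ^ a' * stageProd factorPoly c' M) :
    ∀ m < M, c 0 (2 * m + 2) = c' 0 (2 * m + 2) ∧ c 1 (m + 1) = c' 1 (m + 1) ∧
      c 0 (2 * m + 3) + c 2 (m + 1) = c' 0 (2 * m + 3) + c' 2 (m + 1) ∧
      c 0 (2 * m + 3) + c 3 (m + 2) = c' 0 (2 * m + 3) + c' 3 (m + 2) := by
  induction M with
  | zero => intro m hm; omega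
  | succ M ih =>
    rw [stageProd_succ, stageProd_succ] at h
    have ha : ∀ (N : ℕ) (t : ℚ), 1 ≤ N → evSpike N t (factorPoly 0 1) ≠ 0 := by
      intro N t hN
      rw [(evSpike_factorPoly N t _).1, toepA_spike hN]
      norm_num
    have hs := fun (N : ℕ) (t : ℚ) (hN : 2 * M + 1 ≤ N) (d : Fin 4 → ℕ → ℕ) =>
      evSpike_stageProd_ne_zero hN t d
    have e := fun (N : ℕ) (t : ℚ) (k : ℕ) => evSpike_factorPoly N t k
    have hA : ∀ N t, 2 * M + 2 ≤ N → evSpike N t (factorPoly 0 (2 * M + 2)) ≠ 0 := by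
      intro N t hN
      rw [(e N t _).1, toepA_spike hN]
      norm_num
    have hB : ∀ N t, 2 * M + 2 ≤ N → evSpike N t (factorPoly 1 (M + 1)) ≠ 0 := by
      intro N t hN
      rw [(e N t _).2.1]
      exact toepB_spike_ne_zero (by omega) (Or.inr (by omega))
    set P0 := factorPoly 0 1 with hP0
    set PA := factorPoly 0 (2 * M + 2) with hPA
    set PB := factorPoly 1 (M + 1) with hPB
    set PC := factorPoly 2 (M + 1) with hPC
    set PD := factorPoly 3 (M + 2) with hPD
    set S := stageProd factorPoly c M with hS
    set S' := stageProd factorPoly c' M with hS'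
    have hC0 : evSpike (2 * M + 2) 1 PC = 0 := by
      rw [hPC, (e _ _ _).2.2.1]
      exact toepC_spike_eq_zero (by omega) (by omega)
    have hC1 : evSpike (2 * M + 2) (-1) PC ≠ 0 := by
      rw [hPC, (e _ _ _).2.2.1]
      exact toepC_spike_ne_zero (by omega) (Or.inl (by norm_num))
    have hD0 : evSpike (2 * M + 2) (-1) PD = 0 := by
      rw [hPD, (e _ _ _).2.2.2, toepD_spike_eq_zero (by omega) (by omega), mul_zero]
    have hD1 : evSpike (2 * M + 2) 1 PD ≠ 0 := by
      rw [hPD, (e _ _ _).2.2.2]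
      exact mul_ne_zero (by norm_num)
        (toepD_spike_ne_zero (by omega) (by omega) (Or.inl (by norm_num)))
    have hA0 : evSpike (2 * M + 1) (-1) PA = 0 := by
      rw [hPA, (e _ _ _).1]
      exact toepA_spike_eq_zero (by omega) (Or.inr rfl)
    have hB1 : evSpike (2 * M + 1) (-1) PB ≠ 0 := by
      rw [hPB, (e _ _ _).2.1]
      exact toepB_spike_ne_zero (by omega) (Or.inl (by norm_num))
    have hB0 : evSpike (2 * M + 1) 1 PB = 0 := by
      rw [hPB, (e _ _ _).2.1]
      exact toepB_spike_eq_zero (by omega) (by omega)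
    have nz : ∀ τ k, factorPoly τ k ≠ 0 := factorPoly_ne_zero
    have r1 : c 0 (2 * M + 3) + c 2 (M + 1) = c' 0 (2 * M + 3) + c' 2 (M + 1) := by
      refine eq_of_pow_mul_eq (evSpike (2 * M + 2) 1 : Poly →+* ℚ) (nz 2 (M + 1)) hC0
        (u := P0 ^ a * (S * (PA ^ c 0 (2 * M + 2) * PB ^ c 1 (M + 1) *
          PD ^ (c 0 (2 * M + 3) + c 3 (M + 2)))))
        (u' := P0 ^ a' * (S' * (PA ^ c' 0 (2 * M + 2) * PB ^ c' 1 (M + 1) *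
          PD ^ (c' 0 (2 * M + 3) + c' 3 (M + 2))))) ?_ ?_ ?_
      · simp [ha, hs, hA, hB, hD1, hS]
      · simp [ha, hs, hA, hB, hD1, hS']
      · linear_combination h
    rw [r1] at h
    have r2 : c 0 (2 * M + 3) + c 3 (M + 2) = c' 0 (2 * M + 3) + c' 3 (M + 2) := by
      refine eq_of_pow_mul_eq (evSpike (2 * M + 2) (-1) : Poly →+* ℚ) (nz 3 (M + 2)) hD0
        (u := P0 ^ a * (S * (PA ^ c 0 (2 * M + 2) * PB ^ c 1 (M + 1) *
          PC ^ (c' 0 (2 * M + 3) + c' 2 (M + 1)))))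
        (u' := P0 ^ a' * (S' * (PA ^ c' 0 (2 * M + 2) * PB ^ c' 1 (M + 1) *
          PC ^ (c' 0 (2 * M + 3) + c' 2 (M + 1))))) ?_ ?_ ?_
      · simp [ha, hs, hA, hB, hC1, hS]
      · simp [ha, hs, hA, hB, hC1, hS']
      · linear_combination h
    rw [r2] at h
    have h2 : P0 ^ a * (S * (PA ^ c 0 (2 * M + 2) * PB ^ c 1 (M + 1))) =
        P0 ^ a' * (S' * (PA ^ c' 0 (2 * M + 2) * PB ^ c' 1 (M + 1))) := by
      apply mul_right_cancel₀ (b := PC ^ (c' 0 (2 * M + 3) + c' 2 (M + 1)) *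
        PD ^ (c' 0 (2 * M + 3) + c' 3 (M + 2)))
      · exact mul_ne_zero (pow_ne_zero _ (nz _ _)) (pow_ne_zero _ (nz _ _))
      · linear_combination h
    have r3 : c 0 (2 * M + 2) = c' 0 (2 * M + 2) := by
      refine eq_of_pow_mul_eq (evSpike (2 * M + 1) (-1) : Poly →+* ℚ) (nz 0 (2 * M + 2)) hA0
        (u := P0 ^ a * (S * PB ^ c 1 (M + 1))) (u' := P0 ^ a' * (S' * PB ^ c' 1 (M + 1)))
        ?_ ?_ ?_
      · simp [ha, hs, hB1, hS]
      · simp [ha, hs, hB1, hS']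
      · linear_combination h2
    rw [r3] at h2
    have h3 : P0 ^ a * (S * PB ^ c 1 (M + 1)) = P0 ^ a' * (S' * PB ^ c' 1 (M + 1)) := by
      apply mul_right_cancel₀ (b := PA ^ c' 0 (2 * M + 2)) (pow_ne_zero _ (nz _ _))
      linear_combination h2
    have r4 : c 1 (M + 1) = c' 1 (M + 1) := by
      refine eq_of_pow_mul_eq (evSpike (2 * M + 1) 1 : Poly →+* ℚ) (nz 1 (M + 1)) hB0
        (u := P0 ^ a * S) (u' := P0 ^ a' * S') ?_ ?_ ?_
      · simp [ha, hs, hS]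
      · simp [ha, hs, hS']
      · linear_combination h3
    rw [r4] at h3
    have h4 : P0 ^ a * S = P0 ^ a' * S' := by
      apply mul_right_cancel₀ (b := PB ^ c' 1 (M + 1)) (pow_ne_zero _ (nz _ _))
      linear_combination h3
    intro m hm
    rcases Nat.lt_succ_iff_lt_or_eq.1 hm with hm | rfl
    · exact ih h4 m hm
    · exact ⟨r3, r4, r1, r2⟩

theorem prod_Icc_pairs {R : Type*} [CommMonoid R] (g : ℕ → R) (n : ℕ) :
    ∏ k ∈ Finset.Icc 1 (2 * n + 1), g k =
      g 1 * ∏ m ∈ Finset.range n, (g (2 * m + 2) * g (2 * m + 3)) := by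
  induction n with
  | zero => simp
  | succ n ih =>
    rw [show 2 * (n + 1) + 1 = 2 * n + 1 + 1 + 1 by ring,
      Finset.prod_Icc_succ_top (by omega), Finset.prod_Icc_succ_top (by omega), ih,
      Finset.prod_range_succ]
    simp only [mul_assoc]

/-- The family p is arbitrary because the regrouping is applied twice: to the factor polynomials,
and to the weights 2 ^ k that record the total size. -/
theorem prod_Icc_eq_stageProd {R : Type*} [CommMonoid R] (p : Fin 4 → ℕ → R)
    (hp : ∀ m, p 0 (2 * m + 1) = p 2 m * p 3 (m + 1)) (c : Fin 4 → ℕ → ℕ) (n : ℕ)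
    (h0 : ∀ k, n < k → c 0 k = 0) (h3 : ∀ k, n < k → c 3 k = 0) (h1 : c 3 1 = 0) :
    ∏ k ∈ Finset.Icc 1 n, ∏ τ, p τ k ^ c τ k = p 0 1 ^ c 0 1 * stageProd p c n := by
  simp only [Fin.prod_univ_four, Finset.prod_mul_distrib]
  -- The range is extended by trivial factors up to 2n + 1, so that the sizes above 1 pair up as 2m
  -- + 2, 2m + 3.
  have hA : ∏ k ∈ Finset.Icc 1 n, p 0 k ^ c 0 k =
      ∏ k ∈ Finset.Icc 1 (2 * n + 1), p 0 k ^ c 0 k := by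
    apply Finset.prod_subset (Finset.Icc_subset_Icc_right (by omega))
    intro k hk hk'
    rw [Finset.mem_Icc] at hk hk'
    rw [h0 k (by omega), pow_zero]
  have hI : ∀ g : ℕ → R, ∏ k ∈ Finset.Icc 1 n, g k = ∏ m ∈ Finset.range n, g (m + 1) := by
    intro g
    rw [Finset.range_eq_Ico, Finset.prod_Ico_add' g 0 n 1]
    rfl
  -- The type D sizes are shifted by one: size 1 is dropped and size n + 1 added, both with exponent
  -- 0.
  have hD : ∏ k ∈ Finset.Icc 1 n, p 3 k ^ c 3 k =
      ∏ m ∈ Finset.range n, p 3 (m + 2) ^ c 3 (m + 2) := by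
    rw [hI]
    have := (Finset.prod_range_succ' (fun m => p 3 (m + 1) ^ c 3 (m + 1)) n).symm.trans
      (Finset.prod_range_succ (fun m => p 3 (m + 1) ^ c 3 (m + 1)) n)
    simpa [h1, h3 (n + 1) (by omega)] using this.symm
  rw [hA, prod_Icc_pairs, hI, hI, hD, stageProd, mul_assoc, mul_assoc, mul_assoc,
    ← Finset.prod_mul_distrib, ← Finset.prod_mul_distrib, ← Finset.prod_mul_distrib]
  congr 1
  apply Finset.prod_congr rfl
  intro m _
  have := hp (m + 1)
  rw [show 2 * (m + 1) + 1 = 2 * m + 3 by ring, show m + 1 + 1 = m + 2 by ring] at this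
  rw [this, mul_pow, pow_add, pow_add]
  ac_rfl

theorem stageProd_congr {R : Type*} [CommMonoid R] (p : Fin 4 → ℕ → R) {n : ℕ}
    {c c' : Fin 4 → ℕ → ℕ}
    (h : ∀ m < n, c 0 (2 * m + 2) = c' 0 (2 * m + 2) ∧ c 1 (m + 1) = c' 1 (m + 1) ∧
      c 0 (2 * m + 3) + c 2 (m + 1) = c' 0 (2 * m + 3) + c' 2 (m + 1) ∧
      c 0 (2 * m + 3) + c 3 (m + 2) = c' 0 (2 * m + 3) + c' 3 (m + 2)) :
    stageProd p c n = stageProd p c' n := by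
  apply Finset.prod_congr rfl
  intro m hm
  obtain ⟨e1, e2, e3, e4⟩ := h m (Finset.mem_range.1 hm)
  rw [e1, e2, e3, e4]

/-- The number of trivial factors is determined by the total size and the numbers of the other
factors. -/
theorem eq_zero_one_of_stages {n : ℕ} {c c' : Fin 4 → ℕ → ℕ}
    (hc : ∀ τ k, n < k → c τ k = 0) (hc' : ∀ τ k, n < k → c' τ k = 0) (h1 : c 3 1 = 0)
    (h1' : c' 3 1 = 0) (hn : ∑ k ∈ Finset.Icc 1 n, ∑ τ, k * c τ k = n)
    (hn' : ∑ k ∈ Finset.Icc 1 n, ∑ τ, k * c' τ k = n)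
    (hs : ∀ m < n, c 0 (2 * m + 2) = c' 0 (2 * m + 2) ∧ c 1 (m + 1) = c' 1 (m + 1) ∧
      c 0 (2 * m + 3) + c 2 (m + 1) = c' 0 (2 * m + 3) + c' 2 (m + 1) ∧
      c 0 (2 * m + 3) + c 3 (m + 2) = c' 0 (2 * m + 3) + c' 3 (m + 2)) :
    c 0 1 = c' 0 1 := by
  -- The relation preserves sizes, 2m + 1 = m + (m + 1), so the weights 2 ^ k satisfy it and both
  -- stage products of weights agree. What remains of 2 ^ n is the part of the trivial factors.
  have hp : ∀ m : ℕ, 2 ^ (2 * m + 1) = 2 ^ m * 2 ^ (m + 1) := fun m => by rw [← pow_add]; ring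
  have r := prod_Icc_eq_stageProd (fun _ k => 2 ^ k) hp c n (hc 0) (hc 3) h1
  have r' := prod_Icc_eq_stageProd (fun _ k => 2 ^ k) hp c' n (hc' 0) (hc' 3) h1'
  simp only [← pow_mul, Finset.prod_pow_eq_pow_sum] at r r'
  rw [hn] at r
  rw [hn', ← stageProd_congr _ hs, r] at r'
  have hne : stageProd (fun _ k => 2 ^ k : Fin 4 → ℕ → ℕ) c n ≠ 0 := by
    simp [stageProd, Finset.prod_ne_zero_iff]
  have := Nat.eq_of_mul_eq_mul_right (Nat.pos_of_ne_zero hne) r'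
  simpa using this

/-- The only multiplicative relations between the polynomials of the factors are those that come
from `factorPoly_odd`. -/
theorem prod_factorPoly_eq_iff {n : ℕ} {c c' : Fin 4 → ℕ → ℕ}
    (hc : ∀ τ k, n < k → c τ k = 0) (hc' : ∀ τ k, n < k → c' τ k = 0) (h1 : c 3 1 = 0)
    (h1' : c' 3 1 = 0) (hn : ∑ k ∈ Finset.Icc 1 n, ∑ τ, k * c τ k = n)
    (hn' : ∑ k ∈ Finset.Icc 1 n, ∑ τ, k * c' τ k = n) :
    ∏ k ∈ Finset.Icc 1 n, ∏ τ, factorPoly τ k ^ c τ k =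
      ∏ k ∈ Finset.Icc 1 n, ∏ τ, factorPoly τ k ^ c' τ k ↔
    ∀ m < n, c 0 (2 * m + 2) = c' 0 (2 * m + 2) ∧ c 1 (m + 1) = c' 1 (m + 1) ∧
      c 0 (2 * m + 3) + c 2 (m + 1) = c' 0 (2 * m + 3) + c' 2 (m + 1) ∧
      c 0 (2 * m + 3) + c 3 (m + 2) = c' 0 (2 * m + 3) + c' 3 (m + 2) := by
  rw [prod_Icc_eq_stageProd _ factorPoly_odd c n (hc 0) (hc 3) h1,
    prod_Icc_eq_stageProd _ factorPoly_odd c' n (hc' 0) (hc' 3) h1']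
  refine ⟨stageProd_injective, fun hs => ?_⟩
  rw [eq_zero_one_of_stages hc hc' h1 h1' hn hn' hs, stageProd_congr _ hs]

end Independence

end RootChar

end

noncomputable section

namespace RootChar

/-! ### Linear evaluation of group ring elements -/

section Evaluation

variable {V M : Type*} [AddCommGroup M] [Module ℚ M]

/-- The linear extension of a function on `V` to the group ring `ℚ[V]`. -/
def evMap (m : V → M) : AddMonoidAlgebra ℚ V →ₗ[ℚ] M where
  toFun x := Finsupp.linearCombination ℚ m x.coeff
  map_add' x y := by simp
  map_smul' q x := by simp

@[simp]
theorem evMap_single (m : V → M) (v : V) (q : ℚ) :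
    evMap m (AddMonoidAlgebra.single v q) = q • m v := by
  simp [evMap]

theorem evMap_mapDomain {W : Type*} (m : W → M) (g : V → W) (x : AddMonoidAlgebra ℚ V) :
    evMap m (AddMonoidAlgebra.mapDomain g x) = evMap (m ∘ g) x := by
  simp [evMap, Finsupp.linearCombination_mapDomain]

/-- Linear extensions of functions with larger fibres identify more elements. -/
theorem evMap_eq_of_factorsThrough {σ : Type*} [Nonempty V]
    {m : V → M} {ex : V → σ →₀ ℕ} (hm : ∀ v v', ex v = ex v' → m v = m v')
    {x y : AddMonoidAlgebra ℚ V}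
    (h : evMap (fun v => MvPolynomial.monomial (ex v) (1 : ℚ)) x =
      evMap (fun v => MvPolynomial.monomial (ex v) (1 : ℚ)) y) :
    evMap m x = evMap m y := by
  -- Distinct monomials are linearly independent, so the hypothesis determines the push-forward of x
  -- and y along `ex`.
  have hid : ∀ (z : AddMonoidAlgebra ℚ (σ →₀ ℕ)) (e : σ →₀ ℕ),
      MvPolynomial.coeff e (evMap (fun e => MvPolynomial.monomial e (1 : ℚ)) z) = z.coeff e := by
    intro z e
    induction z using AddMonoidAlgebra.induction_linear with
    | zero => simp
    | add a b ha hb => rw [map_add, MvPolynomial.coeff_add, ha, hb]; rfl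
    | single a b =>
      classical
      rw [evMap_single, MvPolynomial.coeff_smul, MvPolynomial.coeff_monomial,
        AddMonoidAlgebra.coeff_single,
        Finsupp.single_apply]
      simp
  have h1 : AddMonoidAlgebra.mapDomain ex x = AddMonoidAlgebra.mapDomain ex y := by
    refine AddMonoidAlgebra.coeff_injective (Finsupp.ext fun e => ?_)
    rw [← hid, ← hid, evMap_mapDomain, evMap_mapDomain]
    exact congrArg _ h
  -- Since m is constant on the fibres of `ex`, it factors through any section of `ex`.
  have h2 : m = (fun e => m (Function.invFun ex e)) ∘ ex := by
    funext v
    exact hm _ _ (Function.invFun_eq ⟨v, rfl⟩).symm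
  rw [h2, ← evMap_mapDomain, ← evMap_mapDomain, h1]

end Evaluation

/-! ### Weyl groups and evaluations of A_Φ -/

section Weyl

variable {V : Type*} [NormedAddCommGroup V] [InnerProductSpace ℝ V] {Φ : Set V}

theorem refl_mul_self (α : V) : refl α * refl α = 1 := by
  ext v
  exact Submodule.reflection_reflection _ v

theorem refl_inv (α : V) : (refl α)⁻¹ = refl α :=
  inv_eq_iff_mul_eq_one.2 (refl_mul_self α)

theorem refl_mem_weylGroup {α : V} (h : α ∈ Φ) : refl α ∈ weylGroup Φ :=
  Subgroup.subset_closure ⟨α, h, rfl⟩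

/-- Induction over the Weyl group, multiplying by reflections. -/
theorem weylGroup_induction {p : (V ≃ₗ[ℝ] V) → Prop} {w : V ≃ₗ[ℝ] V} (hw : w ∈ weylGroup Φ)
    (one : p 1) (refl_mul : ∀ α ∈ Φ, ∀ w, w ∈ weylGroup Φ → p w → p (refl α * w)) : p w := by
  induction hw using Subgroup.closure_induction_left with
  | one => exact one
  | mul_left x hx y hy ih =>
    obtain ⟨α, hα, rfl⟩ := hx
    exact refl_mul α hα y hy ih
  | inv_mul_cancel x hx y hy ih =>
    obtain ⟨α, hα, rfl⟩ := hx
    rw [refl_inv]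
    exact refl_mul α hα y hy ih

theorem sgn_mul (w w' : V ≃ₗ[ℝ] V) : sgn (w * w') = sgn w * sgn w' := by
  have : ((w * w' : V ≃ₗ[ℝ] V) : V →ₗ[ℝ] V) = (w : V →ₗ[ℝ] V) * (w' : V →ₗ[ℝ] V) := rfl
  rw [sgn, this, map_mul, sign_mul, SignType.coe_mul, sgn, sgn]

@[simp]
theorem sgn_one : sgn (1 : V ≃ₗ[ℝ] V) = 1 := by
  simp [sgn]

theorem sgn_refl [FiniteDimensional ℝ V] {α : V} (h : α ≠ 0) : sgn (refl α) = -1 := by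
  have h1 : LinearMap.det ((refl α : V ≃ₗ[ℝ] V) : V →ₗ[ℝ] V) = -1 := by
    have := Submodule.det_reflection (𝕜 := ℝ) (ℝ ∙ α)ᗮ
    rw [Submodule.orthogonal_orthogonal, finrank_span_singleton h, pow_one] at this
    exact this
  rw [sgn, h1]
  simp

theorem weylGroup_apply_of_orthogonal {w : V ≃ₗ[ℝ] V} (hw : w ∈ weylGroup Φ) {v : V}
    (hv : ∀ α ∈ Φ, inner ℝ α v = 0) : w v = v := by
  refine weylGroup_induction (p := fun w => w v = v) hw rfl ?_
  intro α hα w _ ih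
  rw [LinearEquiv.mul_apply, ih, refl_apply, cusp, hv α hα]
  simp

theorem weylGroup_sub_mem_span {w : V ≃ₗ[ℝ] V} (hw : w ∈ weylGroup Φ) (v : V) :
    w v - v ∈ Submodule.span ℝ Φ := by
  refine weylGroup_induction (p := fun w => w v - v ∈ Submodule.span ℝ Φ) hw ?_ ?_
  · simp
  · intro α hα w _ ih
    rw [LinearEquiv.mul_apply, refl_apply, sub_right_comm]
    exact Submodule.sub_mem _ ih (Submodule.smul_mem _ _ (Submodule.subset_span hα))

/-- Weyl group elements fix the orthogonal complement of the roots, so their values on the roots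
determine them. -/
theorem weylGroup_ext [FiniteDimensional ℝ V] {w w' : V ≃ₗ[ℝ] V} (hw : w ∈ weylGroup Φ)
    (hw' : w' ∈ weylGroup Φ) (h : ∀ α ∈ Φ, w α = w' α) : w = w' := by
  apply LinearEquiv.toLinearMap_injective
  have h1 : Set.EqOn (w : V →ₗ[ℝ] V) (w' : V →ₗ[ℝ] V) (Submodule.span ℝ Φ) :=
    LinearMap.eqOn_span h
  ext v
  obtain ⟨a, ha, b, hb, rfl⟩ := (Submodule.span ℝ Φ).exists_add_mem_mem_orthogonal v
  rw [map_add, map_add, h1 ha]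
  congr 1
  have hb' : ∀ α ∈ Φ, inner ℝ α b = 0 := fun α hα => hb α (Submodule.subset_span hα)
  exact (weylGroup_apply_of_orthogonal hw hb').trans (weylGroup_apply_of_orthogonal hw' hb').symm

theorem delta_mem_span (f : V →ₗ[ℝ] ℝ) : delta f Φ ∈ Submodule.span ℝ Φ := by
  apply Submodule.smul_mem
  refine finsum_mem_induction (· ∈ Submodule.span ℝ Φ) (Submodule.zero_mem _)
    (fun _ _ => Submodule.add_mem _) fun α hα => Submodule.subset_span hα.1

theorem evMap_charA {M : Type*} [AddCommGroup M] [Module ℚ M] [Finite (weylGroup Φ)] (m : V → M)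
    (f : V →ₗ[ℝ] ℝ) : evMap m (charA f Φ) = ∑ᶠ w : weylGroup Φ,
      sgn (w : V ≃ₗ[ℝ] V) • m (delta f Φ - (w : V ≃ₗ[ℝ] V) (delta f Φ)) := by
  rw [charA]
  have := (evMap m).toAddMonoidHom.map_finsum (f := fun w : weylGroup Φ =>
    AddMonoidAlgebra.single (delta f Φ - (w : V ≃ₗ[ℝ] V) (delta f Φ)) (sgn (w : V ≃ₗ[ℝ] V)))
    (Set.toFinite _)
  refine Eq.trans this ?_
  simp

/-- `charA` evaluated through a parametrisation of the Weyl group. -/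
theorem evMap_charA_of_range {M ι : Type*} [AddCommGroup M] [Module ℚ M] [Fintype ι]
    (m : V → M) (f : V →ₗ[ℝ] ℝ) {F : ι → (V ≃ₗ[ℝ] V)} (hF : Function.Injective F)
    (hr : Set.range F = weylGroup Φ) :
    evMap m (charA f Φ) = ∑ i, sgn (F i) • m (delta f Φ - F i (delta f Φ)) := by
  let G : ι → weylGroup Φ := fun i => ⟨F i, by rw [← SetLike.mem_coe, ← hr]; exact ⟨i, rfl⟩⟩
  have hG : Function.Bijective G := by
    refine ⟨fun i j h => hF (congrArg Subtype.val h), ?_⟩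
    rintro ⟨w, hw⟩
    rw [← SetLike.mem_coe, ← hr] at hw
    obtain ⟨i, rfl⟩ := hw
    exact ⟨i, rfl⟩
  have : Finite (weylGroup Φ) := Finite.of_surjective G hG.2
  rw [evMap_charA, ← finsum_eq_sum_of_fintype]
  exact (finsum_eq_of_bijective G hG fun _ => rfl).symm

end Weyl

/-! ### Averaging over a finite group -/

section Average

variable {V : Type*} [NormedAddCommGroup V] [InnerProductSpace ℝ V]
  {M : Type*} [AddCommGroup M] [Module ℚ M]

/-- An invariant function takes the same value on every translate, so it does not notice the
averaging. -/
theorem evMap_charF {G : Subgroup (V ≃ₗ[ℝ] V)} [Finite G] {m : V → M}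
    (hm : ∀ g ∈ G, ∀ v, m (g v) = m v) (f : V →ₗ[ℝ] ℝ) (Φ : Set V) :
    evMap m (charF G f Φ) = evMap m (charA f Φ) := by
  have := Fintype.ofFinite G
  rw [charF, map_smul, finsum_eq_sum_of_fintype, map_sum]
  have : ∀ γ : G, evMap m (AddMonoidAlgebra.mapDomain (γ : V ≃ₗ[ℝ] V) (charA f Φ)) =
      evMap m (charA f Φ) := by
    intro γ
    rw [evMap_mapDomain]
    congr 1
    congr 1
    funext v
    exact hm γ γ.2 v
  rw [Finset.sum_congr rfl fun γ _ => this γ, Finset.sum_const, ← Nat.cast_smul_eq_nsmul ℚ,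
    smul_smul, Nat.card_eq_fintype_card, Finset.card_univ, one_div, inv_mul_cancel₀, one_smul]
  exact_mod_cast Fintype.card_ne_zero

/-- The orbit sum v ↦ ∑ [γ v] is constant on the fibres of `ex`, because each fibre lies in one
orbit. The average therefore depends only on the monomial evaluation. -/
theorem charF_eq_of_evMap_eq {σ : Type*} {G : Subgroup (V ≃ₗ[ℝ] V)} [Finite G]
    {ex : V → σ →₀ ℕ} (hex : ∀ v v', ex v = ex v' → ∃ g ∈ G, g v = v') {f : V →ₗ[ℝ] ℝ}
    {Φ₁ Φ₂ : Set V}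
    (h : evMap (fun v => MvPolynomial.monomial (ex v) (1 : ℚ)) (charA f Φ₁) =
      evMap (fun v => MvPolynomial.monomial (ex v) (1 : ℚ)) (charA f Φ₂)) :
    charF G f Φ₁ = charF G f Φ₂ := by
  have := Fintype.ofFinite G
  have key : ∀ x : AddMonoidAlgebra ℚ V,
      ∑ γ : G, AddMonoidAlgebra.mapDomain (γ : V ≃ₗ[ℝ] V) x =
      evMap (fun v => ∑ γ : G, AddMonoidAlgebra.single ((γ : V ≃ₗ[ℝ] V) v) (1 : ℚ)) x := by
    intro x
    induction x using AddMonoidAlgebra.induction_linear with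
    | zero => simp
    | add a b ha hb =>
      simp only [AddMonoidAlgebra.mapDomain_add, Finset.sum_add_distrib, ha, hb, map_add]
    | single a b =>
      simp [Finset.smul_sum]
  rw [charF, charF, finsum_eq_sum_of_fintype, finsum_eq_sum_of_fintype, key, key]
  congr 1
  refine evMap_eq_of_factorsThrough ?_ h
  intro v v' hv
  obtain ⟨g, hg, rfl⟩ := hex v v' hv
  -- Passing from v to g v only reindexes the orbit sum.
  refine (Fintype.sum_equiv (Equiv.mulRight (⟨g, hg⟩ : G)) _ _ ?_).symm
  intro γ
  rfl

end Average

/-! ### Transport along linear embeddings -/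

section Transport

variable {V V' : Type*} [NormedAddCommGroup V] [InnerProductSpace ℝ V]
  [NormedAddCommGroup V'] [InnerProductSpace ℝ V'] {Φ : Set V} {L : V →ₗ[ℝ] V'}

theorem IsRootSystem.image (hΦ : IsRootSystem Φ) (hL : Function.Injective L)
    (hc : ∀ α ∈ Φ, ∀ v, cusp (L v) (L α) = cusp v α) : IsRootSystem (L '' Φ) where
  finite := hΦ.finite.image _
  zero_notMem := by
    rintro ⟨α, hα, h⟩
    rw [map_eq_zero_iff L hL] at h
    exact hΦ.zero_notMem (h ▸ hα)
  reflect_mem := by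
    rintro _ ⟨α, hα, rfl⟩ _ ⟨β, hβ, rfl⟩
    exact ⟨_, hΦ.reflect_mem α hα β hβ, by rw [hc α hα, map_sub, map_smul]⟩
  integral := by
    rintro _ ⟨α, hα, rfl⟩ _ ⟨β, hβ, rfl⟩
    rw [hc α hα]
    exact hΦ.integral α hα β hβ

theorem IsReduced.image (hΦ : IsReduced Φ) (hL : Function.Injective L) :
    IsReduced (L '' Φ) := by
  rintro _ ⟨α, hα, rfl⟩ c ⟨β, hβ, h⟩
  rw [← map_smul] at h
  exact hΦ α hα c (hL h ▸ hβ)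

theorem delta_image (hL : Function.Injective L) {f : V →ₗ[ℝ] ℝ} {f' : V' →ₗ[ℝ] ℝ}
    (hfin : Φ.Finite) (hf : ∀ α ∈ Φ, 0 < f' (L α) ↔ 0 < f α) :
    delta f' (L '' Φ) = L (delta f Φ) := by
  have h : {α ∈ L '' Φ | 0 < f' α} = L '' {α ∈ Φ | 0 < f α} := by
    ext x
    constructor
    · rintro ⟨⟨α, hα, rfl⟩, hx⟩
      exact ⟨α, ⟨hα, (hf α hα).1 hx⟩, rfl⟩
    · rintro ⟨α, ⟨hα, hx⟩, rfl⟩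
      exact ⟨⟨α, hα, rfl⟩, (hf α hα).2 hx⟩
  rw [delta, h, finsum_mem_image hL.injOn, delta, map_smul]
  congr 1
  exact (L.toAddMonoidHom.map_finsum_mem _ (hfin.subset fun x hx => hx.1)).symm

/-- Evaluations of `charA` are transported by linear embeddings preserving the cusp products. -/
theorem evMap_charA_image [FiniteDimensional ℝ V] [FiniteDimensional ℝ V']
    {M : Type*} [AddCommGroup M] [Module ℚ M] (m : V' → M)
    (hΦ : IsRootSystem Φ) (hL : Function.Injective L)
    (hc : ∀ α ∈ Φ, ∀ v, cusp (L v) (L α) = cusp v α) {f : V →ₗ[ℝ] ℝ} {f' : V' →ₗ[ℝ] ℝ}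
    (hf : ∀ α ∈ Φ, 0 < f' (L α) ↔ 0 < f α) :
    evMap m (charA f' (L '' Φ)) = evMap (m ∘ L) (charA f Φ) := by
  have hΦ' := hΦ.image hL hc
  have := finite_weylGroup hΦ
  have := finite_weylGroup hΦ'
  have hr : ∀ α ∈ Φ, ∀ v, refl (L α) (L v) = L (refl α v) := by
    intro α hα v
    rw [refl_apply, refl_apply, hc α hα, map_sub, map_smul]
  have hs : ∀ α ∈ Φ, sgn (refl (L α)) = sgn (refl α) := by
    intro α hα
    rw [sgn_refl, sgn_refl]
    · rintro rfl; exact hΦ.zero_notMem hα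
    · intro h; exact hΦ'.zero_notMem (h ▸ Set.mem_image_of_mem L hα)
  -- L need be neither surjective nor an isometry, so the elements of the two Weyl groups are
  -- matched one reflection at a time, together with their signs.
  have fwd : ∀ w : weylGroup Φ, ∃ w' : weylGroup (L '' Φ),
      (∀ v, (w' : V' ≃ₗ[ℝ] V') (L v) = L ((w : V ≃ₗ[ℝ] V) v)) ∧
        sgn (w' : V' ≃ₗ[ℝ] V') = sgn (w : V ≃ₗ[ℝ] V) := by
    rintro ⟨w, hw⟩
    refine weylGroup_induction (p := fun w => ∃ w' : weylGroup (L '' Φ),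
      (∀ v, (w' : V' ≃ₗ[ℝ] V') (L v) = L (w v)) ∧ sgn (w' : V' ≃ₗ[ℝ] V') = sgn w)
      hw ⟨1, fun v => rfl, by simp⟩ ?_
    rintro α hα w _ ⟨w', h1, h2⟩
    refine ⟨⟨_, refl_mem_weylGroup (Set.mem_image_of_mem L hα)⟩ * w', fun v => ?_, ?_⟩
    · rw [Subgroup.coe_mul, LinearEquiv.mul_apply, LinearEquiv.mul_apply, h1, hr α hα]
    · rw [Subgroup.coe_mul, sgn_mul, sgn_mul, h2, hs α hα]
  have bwd : ∀ w' : weylGroup (L '' Φ), ∃ w : weylGroup Φ,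
      ∀ v, (w' : V' ≃ₗ[ℝ] V') (L v) = L ((w : V ≃ₗ[ℝ] V) v) := by
    rintro ⟨w', hw'⟩
    refine weylGroup_induction (p := fun w' => ∃ w : weylGroup Φ,
      ∀ v, w' (L v) = L ((w : V ≃ₗ[ℝ] V) v)) hw' ⟨1, fun v => rfl⟩ ?_
    rintro _ ⟨α, hα, rfl⟩ w' _ ⟨w, h1⟩
    refine ⟨⟨_, refl_mem_weylGroup hα⟩ * w, fun v => ?_⟩
    rw [Subgroup.coe_mul, LinearEquiv.mul_apply, LinearEquiv.mul_apply, h1, hr α hα]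
  choose F hF hFs using fwd
  have hbij : Function.Bijective F := by
    constructor
    · intro w₁ w₂ h
      ext v
      apply hL
      rw [← hF, ← hF, h]
    · intro w'
      obtain ⟨w, hw⟩ := bwd w'
      refine ⟨w, Subtype.ext (weylGroup_ext (F w).2 w'.2 ?_)⟩
      rintro _ ⟨α, hα, rfl⟩
      rw [hF, hw]
  rw [evMap_charA, evMap_charA]
  refine (finsum_eq_of_bijective F hbij fun w => ?_).symm
  rw [delta_image hL hΦ.finite hf, hF, hFs, Function.comp_apply, map_sub]

end Transport

/-! ### Orthogonal unions -/

section Product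

variable {V : Type*} [NormedAddCommGroup V] [InnerProductSpace ℝ V] [FiniteDimensional ℝ V]
  {R : Type*} [CommRing R] [Algebra ℚ R]

/-- Evaluations of `charA` are multiplicative over orthogonal unions. -/
theorem evMap_charA_union {Φ₁ Φ₂ : Set V} (h₁ : IsRootSystem Φ₁) (h₂ : IsRootSystem Φ₂)
    (ho : ∀ α ∈ Φ₁, ∀ β ∈ Φ₂, inner ℝ α β = 0) {m m₁ m₂ : V → R}
    (hm : ∀ v₁ ∈ Submodule.span ℝ Φ₁, ∀ v₂ ∈ Submodule.span ℝ Φ₂, m (v₁ + v₂) = m₁ v₁ * m₂ v₂)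
    (f : V →ₗ[ℝ] ℝ) :
    evMap m (charA f (Φ₁ ∪ Φ₂)) = evMap m₁ (charA f Φ₁) * evMap m₂ (charA f Φ₂) := by
  have fin1 := finite_weylGroup h₁
  have fin2 := finite_weylGroup h₂
  have := Fintype.ofFinite (weylGroup Φ₁)
  have := Fintype.ofFinite (weylGroup Φ₂)
  have ho' : ∀ β ∈ Φ₂, ∀ α ∈ Φ₁, inner ℝ β α = 0 := fun β hβ α hα => by
    rw [real_inner_comm]; exact ho α hα β hβ
  have fix1 : ∀ w ∈ weylGroup Φ₁, ∀ v ∈ Submodule.span ℝ Φ₂, w v = v := by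
    intro w hw v hv
    refine weylGroup_apply_of_orthogonal hw fun α hα => ?_
    induction hv using Submodule.span_induction with
    | mem x hx => exact ho α hα x hx
    | zero => simp
    | add x y _ _ hx hy => rw [inner_add_right, hx, hy, add_zero]
    | smul c x _ hx => rw [inner_smul_right, hx, mul_zero]
  have fix2 : ∀ w ∈ weylGroup Φ₂, ∀ v ∈ Submodule.span ℝ Φ₁, w v = v := by
    intro w hw v hv
    refine weylGroup_apply_of_orthogonal hw fun α hα => ?_
    induction hv using Submodule.span_induction with
    | mem x hx => exact ho' α hα x hx
    | zero => simp
    | add x y _ _ hx hy => rw [inner_add_right, hx, hy, add_zero]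
    | smul c x _ hx => rw [inner_smul_right, hx, mul_zero]
  -- Each group displaces vectors only within its own span, which the other group fixes.
  have comm : ∀ w₁ ∈ weylGroup Φ₁, ∀ w₂ ∈ weylGroup Φ₂, w₁ * w₂ = w₂ * w₁ := by
    intro w₁ hw₁ w₂ hw₂
    ext v
    rw [LinearEquiv.mul_apply, LinearEquiv.mul_apply]
    have e1 := fix1 w₁ hw₁ _ (weylGroup_sub_mem_span hw₂ v)
    have e2 := fix2 w₂ hw₂ _ (weylGroup_sub_mem_span hw₁ v)
    rw [map_sub, sub_eq_iff_eq_add] at e1 e2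
    rw [e1, e2]
    abel
  have hfix : ∀ w ∈ weylGroup Φ₁, w ∈ weylGroup Φ₂ → w = 1 := by
    intro w h h'
    refine weylGroup_ext h (one_mem _) fun α hα => ?_
    exact fix2 w h' α (Submodule.subset_span hα)
  let F : weylGroup Φ₁ × weylGroup Φ₂ →* (V ≃ₗ[ℝ] V) :=
    (weylGroup Φ₁).subtype.noncommCoprod (weylGroup Φ₂).subtype
      fun x y => comm x x.2 y y.2
  have hFa : ∀ p, F p = (p.1 : V ≃ₗ[ℝ] V) * (p.2 : V ≃ₗ[ℝ] V) := fun p => rfl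
  have hinj : Function.Injective F := by
    rw [injective_iff_map_eq_one]
    rintro ⟨⟨w₁, hw₁⟩, ⟨w₂, hw₂⟩⟩ h
    rw [hFa] at h
    have h1 : w₁ = w₂⁻¹ := eq_inv_of_mul_eq_one_left h
    have h2 : w₁ = 1 := hfix w₁ hw₁ (h1 ▸ inv_mem hw₂)
    have h3 : w₂ = 1 := by rw [h2] at h1; simpa using h1.symm
    subst h2 h3
    rfl
  have hrange : Set.range F = weylGroup (Φ₁ ∪ Φ₂) := by
    have h : F.range = _ := MonoidHom.noncommCoprod_range _ _ _
    rw [← MonoidHom.coe_range, h, Subgroup.range_subtype,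
      Subgroup.range_subtype, weylGroup, weylGroup, weylGroup, Set.image_union,
      Subgroup.closure_union]
  have hdelta : delta f (Φ₁ ∪ Φ₂) = delta f Φ₁ + delta f Φ₂ := by
    rw [delta, delta, delta, ← smul_add, ← finsum_mem_union]
    · congr 2
      ext x
      simp only [Set.mem_union, Set.mem_ofPred_eq, or_and_right]
    -- A common root would be orthogonal to itself.
    · rw [Set.disjoint_left]
      rintro x ⟨hx, _⟩ ⟨hx', _⟩
      have := ho x hx x hx'
      rw [inner_self_eq_zero] at this
      exact h₁.zero_notMem (this ▸ hx)
    · exact h₁.finite.subset fun x hx => hx.1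
    · exact h₂.finite.subset fun x hx => hx.1
  rw [evMap_charA_of_range m f hinj hrange, evMap_charA, evMap_charA, finsum_eq_sum_of_fintype,
    finsum_eq_sum_of_fintype, Finset.sum_mul_sum, Fintype.sum_prod_type]
  refine Finset.sum_congr rfl fun w₁ _ => Finset.sum_congr rfl fun w₂ _ => ?_
  rw [hFa, hdelta, sgn_mul, LinearEquiv.mul_apply, map_add, map_add,
    fix2 w₂ w₂.2 _ (delta_mem_span f)]
  have hm2 := weylGroup_sub_mem_span w₂.2 (delta f Φ₂)
  have hm1 := weylGroup_sub_mem_span w₁.2 (delta f Φ₁)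
  rw [← Submodule.neg_mem_iff, neg_sub] at hm1 hm2
  have hw2 : (w₂ : V ≃ₗ[ℝ] V) (delta f Φ₂) ∈ Submodule.span ℝ Φ₂ := by
    have := Submodule.sub_mem _ (delta_mem_span (Φ := Φ₂) f) hm2
    rwa [sub_sub_cancel] at this
  rw [fix1 w₁ w₁.2 _ hw2, add_sub_add_comm, hm _ hm1 _ hm2, smul_mul_smul_comm]

end Product

end RootChar

end

noncomputable section

namespace RootChar

open Equiv MvPolynomial

/-- The standard Euclidean space. -/
abbrev E (n : ℕ) := EuclideanSpace ℝ (Fin n)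

variable {n : ℕ}

theorem e_apply (i j : Fin n) : (e i) j = if j = i then 1 else 0 := by
  simp [e, PiLp.single_apply]

@[simp]
theorem e_apply_self (i : Fin n) : (e i) i = 1 := by simp [e_apply]

theorem e_apply_of_ne {i j : Fin n} (h : j ≠ i) : (e i) j = 0 := by simp [e_apply, h]

theorem units_smul_apply (s : ℤˣ) (v : E n) (i : Fin n) : (s • v) i = ((s : ℤ) : ℝ) * v i := by
  rcases Int.units_eq_one_or s with rfl | rfl <;> simp

theorem units_smul_eq (s : ℤˣ) (v : E n) : s • v = ((s : ℤ) : ℝ) • v := by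
  rcases Int.units_eq_one_or s with rfl | rfl <;> simp

theorem cast_units_mul_self (s : ℤˣ) : ((s : ℤ) : ℝ) * ((s : ℤ) : ℝ) = 1 := by
  rcases Int.units_eq_one_or s with rfl | rfl <;> simp

theorem abs_cast_units (s : ℤˣ) : |((s : ℤ) : ℝ)| = 1 := by
  rcases Int.units_eq_one_or s with rfl | rfl <;> simp

theorem inner_e (i : Fin n) (v : E n) : inner ℝ (e i) v = v i := by
  simp [e, EuclideanSpace.inner_single_left]

theorem inner_eq_sum (v w : E n) : inner ℝ v w = ∑ i, v i * w i := by
  simp [PiLp.inner_apply, mul_comm]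

theorem inner_units_smul_e (s : ℤˣ) (i : Fin n) (v : E n) :
    inner ℝ (s • e i) v = ((s : ℤ) : ℝ) * v i := by
  rw [units_smul_eq, real_inner_smul_left, inner_e]

theorem inner_long (s t : ℤˣ) (i j : Fin n) (v : E n) :
    inner ℝ (s • e i + t • e j) v = ((s : ℤ) : ℝ) * v i + ((t : ℤ) : ℝ) * v j := by
  rw [inner_add_left, inner_units_smul_e, inner_units_smul_e]

theorem cusp_long {i j : Fin n} (hij : i ≠ j) (s t : ℤˣ) (v : E n) :
    cusp v (s • e i + t • e j) = ((s : ℤ) : ℝ) * v i + ((t : ℤ) : ℝ) * v j := by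
  rw [cusp, inner_long, inner_long]
  simp only [PiLp.add_apply, units_smul_apply, e_apply_self, e_apply_of_ne hij,
    e_apply_of_ne hij.symm]
  have hs := cast_units_mul_self s
  have ht := cast_units_mul_self t
  rw [show ((s : ℤ) : ℝ) * (((s : ℤ) : ℝ) * 1 + ((t : ℤ) : ℝ) * 0) +
    ((t : ℤ) : ℝ) * (((s : ℤ) : ℝ) * 0 + ((t : ℤ) : ℝ) * 1) = 2 by linarith]
  ring

theorem cusp_short (s : ℤˣ) (i : Fin n) (v : E n) :
    cusp v (s • e i) = 2 * (((s : ℤ) : ℝ) * v i) := by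
  rw [cusp, inner_units_smul_e, inner_units_smul_e, units_smul_apply, e_apply_self, mul_one,
    cast_units_mul_self, div_one]

theorem cusp_double (s : ℤˣ) (i : Fin n) (v : E n) :
    cusp v (s • (2 : ℝ) • e i) = ((s : ℤ) : ℝ) * v i := by
  rw [smul_comm, cusp, real_inner_smul_left, real_inner_smul_left, real_inner_smul_right,
    inner_units_smul_e, inner_units_smul_e, units_smul_apply, e_apply_self, mul_one,
    cast_units_mul_self]
  ring

/-! ### Signed permutations and reflections -/

section SignedPermutations

/-- The signed permutation `e_i ↦ s_{σ i} e_{σ i}` of the coordinates. -/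
def sp (s : Fin n → ℤˣ) (σ : Perm (Fin n)) : E n ≃ₗ[ℝ] E n where
  toFun v := WithLp.toLp 2 fun i => ((s i : ℤ) : ℝ) * v (σ.symm i)
  invFun v := WithLp.toLp 2 fun i => ((s (σ i) : ℤ) : ℝ) * v (σ i)
  map_add' v w := by ext i; simp [mul_add]
  map_smul' c v := by ext i; simp [mul_left_comm]
  left_inv v := by
    ext i
    simp [← mul_assoc, cast_units_mul_self]
  right_inv v := by
    ext i
    simp [← mul_assoc, cast_units_mul_self]

theorem sp_apply (s : Fin n → ℤˣ) (σ : Perm (Fin n)) (v : E n) (i : Fin n) :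
    (sp s σ v) i = ((s i : ℤ) : ℝ) * v (σ.symm i) := rfl

theorem sp_one_right_apply (s : Fin n → ℤˣ) (v : E n) (i : Fin n) :
    (sp s 1 v) i = ((s i : ℤ) : ℝ) * v i := rfl

theorem sp_e (s : Fin n → ℤˣ) (σ : Perm (Fin n)) (i : Fin n) :
    sp s σ (e i) = s (σ i) • e (σ i) := by
  ext k
  rw [sp_apply, units_smul_apply, e_apply, e_apply]
  by_cases h : k = σ i
  · simp [h]
  · have : σ.symm k ≠ i := fun h' => h (by simp [← h'])
    simp [h, this]

theorem sp_mul (s s' : Fin n → ℤˣ) (σ σ' : Perm (Fin n)) :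
    sp s σ * sp s' σ' = sp (fun i => s i * s' (σ.symm i)) (σ * σ') := by
  ext v i
  rw [LinearEquiv.mul_apply, sp_apply, sp_apply, sp_apply]
  simp only [Units.val_mul, Int.cast_mul, mul_assoc]
  rfl

theorem sp_one : sp (1 : Fin n → ℤˣ) 1 = 1 := by
  ext v i
  rw [sp_apply]
  simp only [Pi.one_apply, Units.val_one, Int.cast_one, one_mul]
  rfl

theorem inner_sp (s : Fin n → ℤˣ) (σ : Perm (Fin n)) (v w : E n) :
    inner ℝ (sp s σ v) (sp s σ w) = inner ℝ v w := by
  rw [inner_eq_sum, inner_eq_sum, ← Equiv.sum_comp σ]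
  refine Finset.sum_congr rfl fun i _ => ?_
  rw [sp_apply, sp_apply, Equiv.symm_apply_apply, mul_mul_mul_comm, cast_units_mul_self, one_mul]

theorem cusp_sp (s : Fin n → ℤˣ) (σ : Perm (Fin n)) (v w : E n) :
    cusp (sp s σ v) (sp s σ w) = cusp v w := by
  rw [cusp, inner_sp, inner_sp, cusp]

theorem units_smul_e_inj {s t : ℤˣ} {i j : Fin n} (h : s • e i = t • e j) : i = j ∧ s = t := by
  have h1 := congrArg (fun v : E n => v i) h
  simp only [units_smul_apply, e_apply, if_true, mul_one] at h1
  by_cases hij : i = j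
  · refine ⟨hij, ?_⟩
    rw [if_pos hij, mul_one] at h1
    exact Units.ext (by exact_mod_cast h1)
  · rw [if_neg hij, mul_zero] at h1
    have := abs_cast_units s
    rw [h1] at this
    norm_num at this

theorem sp_injective :
    Function.Injective fun p : (Fin n → ℤˣ) × Perm (Fin n) => sp p.1 p.2 := by
  rintro ⟨s, σ⟩ ⟨s', σ'⟩ h
  have h1 : ∀ i, σ i = σ' i ∧ s (σ i) = s' (σ' i) := by
    intro i
    apply units_smul_e_inj
    rw [← sp_e, ← sp_e]
    exact congrArg (fun g : E n ≃ₗ[ℝ] E n => g (e i)) h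
  have h2 : σ = σ' := Equiv.ext fun i => (h1 i).1
  subst h2
  refine Prod.ext (funext fun i => ?_) rfl
  simpa using (h1 (σ.symm i)).2

theorem refl_long {i j : Fin n} (hij : i ≠ j) (s t : ℤˣ) :
    refl (s • e i + t • e j) =
      sp (fun k => if k = i ∨ k = j then -(s * t) else 1) (swap i j) := by
  ext v k
  rw [refl_apply, cusp_long hij, sp_apply, symm_swap]
  have hs := cast_units_mul_self s
  have ht := cast_units_mul_self t
  simp only [PiLp.sub_apply, PiLp.smul_apply, PiLp.add_apply, units_smul_apply, e_apply,
    smul_eq_mul]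
  by_cases h1 : k = i
  · subst h1
    simp [hij]
    linear_combination (-v k) * hs
  · by_cases h2 : k = j
    · subst h2
      simp [h1]
      linear_combination (-v k) * ht
    · simp [h1, h2, swap_apply_of_ne_of_ne]

theorem refl_long_neg {i j : Fin n} (hij : i ≠ j) : refl (e i - e j) = sp 1 (swap i j) := by
  have := refl_long hij 1 (-1)
  rw [one_smul, Units.neg_smul, one_smul, ← sub_eq_add_neg] at this
  rw [this]
  congr 1
  ext k
  simp

theorem refl_short (i : Fin n) (s : ℤˣ) : refl (s • e i) = sp (Pi.mulSingle i (-1)) 1 := by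
  ext v k
  rw [refl_apply, cusp_short, sp_one_right_apply]
  have hs := cast_units_mul_self s
  simp only [PiLp.sub_apply, PiLp.smul_apply, units_smul_apply, e_apply, smul_eq_mul]
  by_cases h1 : k = i
  · subst h1
    simp
    linear_combination (-2 * v k) * hs
  · simp [h1]

theorem refl_double (i : Fin n) (s : ℤˣ) :
    refl (s • (2 : ℝ) • e i) = sp (Pi.mulSingle i (-1)) 1 := by
  ext v k
  rw [refl_apply, cusp_double, sp_one_right_apply]
  have hs := cast_units_mul_self s
  simp only [PiLp.sub_apply, PiLp.smul_apply, units_smul_apply, e_apply, smul_eq_mul]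
  by_cases h1 : k = i
  · subst h1
    simp
    linear_combination (-2 * v k) * hs
  · simp [h1]

theorem e_ne_zero (i : Fin n) : e i ≠ 0 := by
  intro h
  have := congrArg (fun v : E n => v i) h
  simp at this

theorem e_sub_ne_zero {i j : Fin n} (hij : i ≠ j) : e i - e j ≠ 0 := by
  intro h
  have := congrArg (fun v : E n => v i) h
  simp [e_apply, hij] at this

theorem sgn_sp_one (σ : Perm (Fin n)) : sgn (sp 1 σ) = ((Perm.sign σ : ℤ) : ℚ) := by
  induction σ using Perm.swap_induction_on with
  | one => rw [sp_one]; simp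
  | swap_mul σ i j hij ih =>
    have : sp 1 (swap i j * σ) = sp 1 (swap i j) * sp 1 σ := by
      rw [sp_mul]; congr 1
    rw [this, sgn_mul, ih, ← refl_long_neg hij, sgn_refl (e_sub_ne_zero hij), Perm.sign_mul,
      Perm.sign_swap hij]
    simp

/-- The homomorphism of the sign changes into the linear group. -/
def signHom : (Fin n → ℤˣ) →* (E n ≃ₗ[ℝ] E n) where
  toFun s := sp s 1
  map_one' := sp_one
  map_mul' s t := (sp_mul s t 1 1).symm

/-- Both sides are multiplicative in s, so it suffices to compare them on a single sign flip, which
is the reflection in some e_i. -/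
theorem sgn_sp_sign (s : Fin n → ℤˣ) : sgn (sp s 1) = ((∏ i, s i : ℤˣ) : ℤ) := by
  let h : (Fin n → ℤˣ) →* ℚ :=
    { toFun := fun s => sgn (sp s 1)
      map_one' := by rw [sp_one, sgn_one]
      map_mul' := fun s t => by
        rw [← sgn_mul, sp_mul]
        rfl }
  let h' : (Fin n → ℤˣ) →* ℚ :=
    { toFun := fun s => ((∏ i, s i : ℤˣ) : ℤ)
      map_one' := by simp
      map_mul' := fun s t => by simp [Finset.prod_mul_distrib] }
  have : h = h' := by
    apply MonoidHom.functions_ext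
    intro i x
    rcases Int.units_eq_one_or x with rfl | rfl
    · simp
    · change sgn (sp (Pi.mulSingle i (-1)) 1) = ((∏ j, (Pi.mulSingle i (-1) : Fin n → ℤˣ) j : ℤˣ) : ℤ)
      rw [Finset.prod_pi_mulSingle', if_pos (Finset.mem_univ i), ← refl_short i 1, one_smul,
        sgn_refl (e_ne_zero i)]
      simp
  exact congrArg (fun g : (Fin n → ℤˣ) →* ℚ => g s) this

theorem sgn_sp (s : Fin n → ℤˣ) (σ : Perm (Fin n)) :
    sgn (sp s σ) = (((∏ i, s i : ℤˣ) : ℤ) : ℚ) * ((Perm.sign σ : ℤ) : ℚ) := by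
  rw [← sgn_sp_sign, ← sgn_sp_one, ← sgn_mul, sp_mul]
  simp

end SignedPermutations

/-! ### Weyl groups of the standard systems -/

section StandardWeylGroups

theorem mem_typeA {α : E n} : α ∈ typeA n ↔ ∃ i j, i ≠ j ∧ α = e i - e j := by
  simp [typeA, setA]

theorem mem_typeD {α : E n} :
    α ∈ typeD n ↔ ∃ i j, i ≠ j ∧ ∃ s t : ℤˣ, α = s • e i + t • e j := by
  simp [typeD, setD]

theorem mem_typeB {α : E n} : α ∈ typeB n ↔ α ∈ typeD n ∨ ∃ i, ∃ s : ℤˣ, α = s • e i := by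
  simp [typeB, setB, typeD]

theorem mem_typeC {α : E n} :
    α ∈ typeC n ↔ α ∈ typeD n ∨ ∃ i, ∃ s : ℤˣ, α = s • (2 : ℝ) • e i := by
  simp [typeC, setC, typeD]

theorem sub_mem_typeD {i j : Fin n} (hij : i ≠ j) : e i - e j ∈ typeD n :=
  mem_typeD.2 ⟨i, j, hij, 1, -1, by simp [sub_eq_add_neg]⟩

theorem add_mem_typeD {i j : Fin n} (hij : i ≠ j) : e i + e j ∈ typeD n :=
  mem_typeD.2 ⟨i, j, hij, 1, 1, by simp⟩

theorem typeA_subset_typeD : typeA n ⊆ typeD n := by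
  intro α h
  obtain ⟨i, j, hij, rfl⟩ := mem_typeA.1 h
  exact sub_mem_typeD hij

theorem weylGroup_typeA : Set.range (fun σ : Perm (Fin n) => sp 1 σ) = weylGroup (typeA n) := by
  have hmul : ∀ σ τ : Perm (Fin n), sp 1 (σ * τ) = sp 1 σ * sp 1 τ := by
    intro σ τ
    rw [sp_mul]; congr 1
  ext w
  constructor
  · rintro ⟨σ, rfl⟩
    induction σ using Perm.swap_induction_on with
    | one => change sp 1 1 ∈ weylGroup (typeA n); rw [sp_one]; exact one_mem _
    | swap_mul σ i j hij ih =>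
      change sp 1 _ ∈ weylGroup (typeA n)
      rw [hmul, ← refl_long_neg hij]
      exact mul_mem (refl_mem_weylGroup (mem_typeA.2 ⟨i, j, hij, rfl⟩)) ih
  · intro hw
    refine weylGroup_induction (p := fun w => w ∈ Set.range fun σ : Perm (Fin n) => sp 1 σ) hw
      ⟨1, sp_one⟩ ?_
    rintro α hα _ _ ⟨σ, rfl⟩
    obtain ⟨i, j, hij, rfl⟩ := mem_typeA.1 hα
    exact ⟨swap i j * σ, by simp only; rw [hmul, refl_long_neg hij]⟩

theorem sp_sign_mul (s : Fin n → ℤˣ) (σ : Perm (Fin n)) : sp s 1 * sp 1 σ = sp s σ := by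
  rw [sp_mul]; congr 1; ext; simp

theorem sp_one_mem_of_typeD_subset {Φ : Set (E n)} (hΦ : typeD n ⊆ Φ) (σ : Perm (Fin n)) :
    sp 1 σ ∈ weylGroup Φ := by
  have h : sp 1 σ ∈ weylGroup (typeA n) := by
    rw [← SetLike.mem_coe, ← weylGroup_typeA]
    exact ⟨σ, rfl⟩
  exact Subgroup.closure_mono (Set.image_mono (typeA_subset_typeD.trans hΦ)) h

theorem prod_neg_pair {i j : Fin n} (hij : i ≠ j) (u : ℤˣ) :
    ∏ k, (if k = i ∨ k = j then u else 1) = 1 := by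
  have : ∀ k, (if k = i ∨ k = j then u else 1) = (if k = i then u else 1) * if k = j then u else 1 := by
    intro k
    by_cases h1 : k = i
    · subst h1; simp [hij]
    · simp [h1]
  rw [Finset.prod_congr rfl fun k _ => this k, Finset.prod_mul_distrib]
  simp

/-- Common to B_n and C_n: the roots of D_n supply the permutations, and the roots ±e_i or ±2e_i
supply the single sign flips. -/
theorem weylGroup_eq_of_sign_flips {Φ : Set (E n)} (hΦ : typeD n ⊆ Φ)
    (h : ∀ α ∈ Φ, α ∉ typeD n → ∃ i, refl α = sp (Pi.mulSingle i (-1)) 1)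
    (hf : ∀ i, ∃ α ∈ Φ, refl α = sp (Pi.mulSingle i (-1)) 1) :
    Set.range (fun p : (Fin n → ℤˣ) × Perm (Fin n) => sp p.1 p.2) = weylGroup Φ := by
  ext w
  constructor
  · rintro ⟨⟨s, σ⟩, rfl⟩
    simp only
    rw [← sp_sign_mul]
    refine mul_mem ?_ (sp_one_mem_of_typeD_subset hΦ σ)
    change s ∈ (weylGroup Φ).comap signHom
    rw [← Finset.univ_prod_mulSingle s]
    refine Subgroup.prod_mem _ fun i _ => ?_
    rcases Int.units_eq_one_or (s i) with h1 | h1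
    · rw [h1, Pi.mulSingle_one]; exact one_mem _
    · rw [h1]
      obtain ⟨α, hα, he⟩ := hf i
      change sp _ 1 ∈ weylGroup Φ
      rw [← he]
      exact refl_mem_weylGroup hα
  · intro hw
    refine weylGroup_induction (p := fun w => w ∈ Set.range
      fun p : (Fin n → ℤˣ) × Perm (Fin n) => sp p.1 p.2) hw ⟨1, sp_one⟩ ?_
    rintro α hα _ _ ⟨⟨s, σ⟩, rfl⟩
    simp only
    by_cases hD : α ∈ typeD n
    · obtain ⟨i, j, hij, a, b, rfl⟩ := mem_typeD.1 hD
      rw [refl_long hij, sp_mul]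
      exact ⟨(_, _), rfl⟩
    · obtain ⟨i, hi⟩ := h α hα hD
      rw [hi, sp_mul]
      exact ⟨(_, _), rfl⟩

theorem weylGroup_typeB :
    Set.range (fun p : (Fin n → ℤˣ) × Perm (Fin n) => sp p.1 p.2) = weylGroup (typeB n) := by
  refine weylGroup_eq_of_sign_flips (fun α h => mem_typeB.2 (Or.inl h)) ?_ fun i =>
    ⟨_, mem_typeB.2 (Or.inr ⟨i, 1, rfl⟩), refl_short i 1⟩
  intro α hα hD
  obtain ⟨i, s, rfl⟩ := (mem_typeB.1 hα).resolve_left hD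
  exact ⟨i, refl_short i s⟩

theorem weylGroup_typeC :
    Set.range (fun p : (Fin n → ℤˣ) × Perm (Fin n) => sp p.1 p.2) = weylGroup (typeC n) := by
  refine weylGroup_eq_of_sign_flips (fun α h => mem_typeC.2 (Or.inl h)) ?_ fun i =>
    ⟨_, mem_typeC.2 (Or.inr ⟨i, 1, rfl⟩), refl_double i 1⟩
  intro α hα hD
  obtain ⟨i, s, rfl⟩ := (mem_typeC.1 hα).resolve_left hD
  exact ⟨i, refl_double i s⟩

theorem weylGroup_typeD :
    Set.range (fun p : {s : Fin n → ℤˣ // ∏ i, s i = 1} × Perm (Fin n) => sp p.1.1 p.2) =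
      weylGroup (typeD n) := by
  ext w
  constructor
  · rintro ⟨⟨⟨s, hs⟩, σ⟩, rfl⟩
    simp only
    rw [← sp_sign_mul]
    refine mul_mem ?_ (sp_one_mem_of_typeD_subset subset_rfl σ)
    change s ∈ (weylGroup (typeD n)).comap signHom
    rcases Nat.eq_zero_or_pos n with rfl | hn
    · have : s = 1 := Subsingleton.elim _ _
      rw [this]; exact one_mem _
    let o : Fin n := ⟨0, hn⟩
    -- Since the product of all signs is 1, the extra factors at o cancel. So s is a product of
    -- double flips at i and o, and each of these is the product of the reflections in e_i + e_o and
    -- e_i - e_o.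
    have h1 : s = ∏ i, (Pi.mulSingle i (s i) * Pi.mulSingle o (s i) : Fin n → ℤˣ) := by
      rw [Finset.prod_mul_distrib, Finset.univ_prod_mulSingle]
      have h2 := (map_prod (MonoidHom.mulSingle (fun _ : Fin n => ℤˣ) o) s Finset.univ).symm
      rw [hs, map_one] at h2
      change s = s * ∏ i, MonoidHom.mulSingle (fun _ : Fin n => ℤˣ) o (s i)
      rw [h2, mul_one]
    rw [h1]
    refine Subgroup.prod_mem _ fun i _ => ?_
    rcases Int.units_eq_one_or (s i) with h1 | h1
    · rw [h1, Pi.mulSingle_one, Pi.mulSingle_one]; exact one_mem _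
    · rw [h1]
      by_cases hi : i = o
      · rw [hi, ← Pi.mulSingle_mul]
        simp
      · change sp _ 1 ∈ weylGroup (typeD n)
        have : sp (Pi.mulSingle i (-1) * Pi.mulSingle o (-1)) 1 =
            refl (e i + e o) * refl (e i - e o) := by
          have := refl_long hi 1 1
          rw [one_smul, one_smul] at this
          rw [this, refl_long_neg hi, sp_mul, Equiv.swap_mul_self]
          congr 1
          ext k
          by_cases hk : k = i
          · subst hk; simp [hi]
          · by_cases hk' : k = o
            · subst hk'; simp [hk]
            · simp [hk, hk']
        rw [this]
        exact mul_mem (refl_mem_weylGroup (add_mem_typeD hi))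
          (refl_mem_weylGroup (sub_mem_typeD hi))
  · intro hw
    refine weylGroup_induction (p := fun w => w ∈ Set.range
      fun p : {s : Fin n → ℤˣ // ∏ i, s i = 1} × Perm (Fin n) => sp p.1.1 p.2) hw
      ⟨⟨⟨1, by simp⟩, 1⟩, sp_one⟩ ?_
    rintro α hα _ _ ⟨⟨⟨s, hs⟩, σ⟩, rfl⟩
    obtain ⟨i, j, hij, a, b, rfl⟩ := mem_typeD.1 hα
    simp only
    rw [refl_long hij, sp_mul]
    refine ⟨⟨⟨_, ?_⟩, _⟩, rfl⟩
    rw [Finset.prod_mul_distrib, prod_neg_pair hij, one_mul, Equiv.prod_comp, hs]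

end StandardWeylGroups

end RootChar

end

noncomputable section

namespace RootChar

open Equiv Matrix MvPolynomial

variable {n : ℕ}

/-! ### Alternating sums of monomials as determinants -/

/-- The monomial that records the absolute values of the coordinates in `I`. -/
def mono (I : Finset (Fin n)) (v : E n) : Poly := ∏ i ∈ I, X |v i|

theorem det_eq_sum_symm {R : Type*} [CommRing R] (M : Matrix (Fin n) (Fin n) R) :
    M.det = ∑ σ : Perm (Fin n), ((Perm.sign σ : ℤ) : R) * ∏ i, M i (σ.symm i) := by
  rw [det_apply']
  refine Finset.sum_congr rfl fun σ _ => ?_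
  congr 1
  rw [← Equiv.prod_comp σ fun i => M i (σ.symm i)]
  simp

/-- The monomial of δ - σδ is the product of the entries at (i, σ⁻¹ i), so the alternating sum is
the Leibniz expansion. -/
theorem sum_perm_mono (δ : E n) :
    ∑ σ : Perm (Fin n), ((Perm.sign σ : ℤ) : ℚ) • mono Finset.univ (δ - sp 1 σ δ) =
      det (of fun i j => (X |δ i - δ j| : Poly)) := by
  rw [det_eq_sum_symm]
  refine Finset.sum_congr rfl fun σ _ => ?_
  rw [Int.cast_smul_eq_zsmul, zsmul_eq_mul]
  congr 1
  simp [mono, sp_apply]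

/-- The sign of each coordinate can be summed separately, which turns each entry into a two-term
combination. The weight c is the sign character for B and C; type D needs the trivial weight as
well. -/
theorem sum_signed_perm_mono (c : ℤˣ → ℚ) (δ : E n) :
    ∑ p : (Fin n → ℤˣ) × Perm (Fin n), ((∏ i, c (p.1 i)) * ((Perm.sign p.2 : ℤ) : ℚ)) •
        mono Finset.univ (δ - sp p.1 p.2 δ) =
      det (of fun i j => (c 1 • X |δ i - δ j| + c (-1) • X |δ i + δ j| : Poly)) := by
  rw [det_eq_sum_symm, Fintype.sum_prod_type_right]
  refine Finset.sum_congr rfl fun σ _ => ?_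
  have h : ∀ i j, (c 1 • X |δ i - δ j| + c (-1) • X |δ i + δ j| : Poly) =
      ∑ u : ℤˣ, c u • X |δ i - ((u : ℤ) : ℝ) * δ j| := by
    intro i j
    rw [UnitsInt.univ, Finset.sum_pair (by decide)]
    simp
  simp only [of_apply, h]
  rw [Finset.prod_univ_sum, Fintype.piFinset_univ, Finset.mul_sum]
  refine Finset.sum_congr rfl fun s _ => ?_
  rw [mul_comm, mul_smul, Int.cast_smul_eq_zsmul, zsmul_eq_mul]
  congr 1
  simp only [mono, smul_eq_C_mul, Finset.prod_mul_distrib, PiLp.sub_apply, sp_apply, map_prod]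

/-! ### Half sums of positive roots in coordinates -/

section HalfSums

variable {f : E n →ₗ[ℝ] ℝ}

/-- The ordered pairs of indices. -/
def pairs (n : ℕ) : Finset (Fin n × Fin n) := Finset.univ.filter fun p => p.1 < p.2

theorem mem_pairs {p : Fin n × Fin n} : p ∈ pairs n ↔ p.1 < p.2 := by simp [pairs]

theorem sum_pairs_snd_apply (k : Fin n) : (∑ p ∈ pairs n, e p.2) k = (k : ℝ) := by
  have h : (∑ p ∈ pairs n, e p.2 : E n) k = ∑ p ∈ pairs n, (e p.2 : E n) k := by simp
  rw [h, pairs, Finset.sum_filter, Fintype.sum_prod_type]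
  simp only [e_apply]
  have : ∀ i : Fin n, ∑ j : Fin n, (if i < j then (if k = j then (1 : ℝ) else 0) else 0) =
      if i < k then 1 else 0 := by
    intro i
    rw [Finset.sum_eq_single k]
    · simp
    · intro j _ hj
      simp [hj.symm]
    · simp
  rw [Finset.sum_congr rfl fun i _ => this i, Finset.sum_boole]
  simp [Finset.filter_gt_eq_Iio]

theorem sum_pairs_fst_apply (k : Fin n) : (∑ p ∈ pairs n, e p.1) k = (n : ℝ) - 1 - k := by
  have h : (∑ p ∈ pairs n, e p.1 : E n) k = ∑ p ∈ pairs n, (e p.1 : E n) k := by simp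
  rw [h, pairs, Finset.sum_filter, Fintype.sum_prod_type_right]
  simp only [e_apply]
  have : ∀ j : Fin n, ∑ i : Fin n, (if i < j then (if k = i then (1 : ℝ) else 0) else 0) =
      if k < j then 1 else 0 := by
    intro i
    rw [Finset.sum_eq_single k]
    · simp
    · intro j _ hj
      simp [hj.symm]
    · simp
  rw [Finset.sum_congr rfl fun i _ => this i, Finset.sum_boole, Finset.filter_lt_eq_Ioi,
    Fin.card_Ioi]
  have := k.isLt
  rw [Nat.cast_sub (by omega), Nat.cast_sub (by omega)]
  simp

theorem e_sub_injOn : Set.InjOn (fun p : Fin n × Fin n => (e p.2 - e p.1 : E n)) (pairs n) := by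
  rintro ⟨i, j⟩ hp ⟨k, l⟩ hq h
  have hp := mem_pairs.1 (Finset.mem_coe.1 hp)
  have hq := mem_pairs.1 (Finset.mem_coe.1 hq)
  have h1 := congrArg (fun v : E n => v j) h
  have h2 := congrArg (fun v : E n => v i) h
  simp only [PiLp.sub_apply, e_apply] at h1 h2
  simp only at hp hq
  rw [if_pos trivial, if_neg hp.ne'] at h1
  rw [if_pos trivial, if_neg hp.ne] at h2
  have e1 : j = l := by
    by_contra hne
    rw [if_neg hne] at h1
    split_ifs at h1 <;> norm_num at h1
  have e2 : i = k := by
    by_contra hne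
    rw [if_neg hne] at h2
    split_ifs at h2 <;> norm_num at h2
  rw [e1, e2]

theorem e_add_injOn : Set.InjOn (fun p : Fin n × Fin n => (e p.2 + e p.1 : E n)) (pairs n) := by
  rintro ⟨i, j⟩ hp ⟨k, l⟩ hq h
  have hp := mem_pairs.1 (Finset.mem_coe.1 hp)
  have hq := mem_pairs.1 (Finset.mem_coe.1 hq)
  have h1 := congrArg (fun v : E n => v j) h
  have h2 := congrArg (fun v : E n => v i) h
  simp only [PiLp.add_apply, e_apply] at h1 h2
  simp only at hp hq
  rw [if_pos trivial, if_neg hp.ne'] at h1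
  rw [if_pos trivial, if_neg hp.ne] at h2
  have e1 : j = l ∨ j = k := by
    by_contra hne
    rw [not_or] at hne
    rw [if_neg hne.1, if_neg hne.2] at h1
    norm_num at h1
  have e2 : i = l ∨ i = k := by
    by_contra hne
    rw [not_or] at hne
    rw [if_neg hne.1, if_neg hne.2] at h2
    norm_num at h2
  rw [Prod.mk.injEq]
  omega

theorem positive_typeA (hf : StrictMono fun i => f (e i)) :
    {α ∈ typeA n | 0 < f α} = (fun p : Fin n × Fin n => (e p.2 - e p.1 : E n)) '' pairs n := by
  ext α
  constructor
  · rintro ⟨hα, h⟩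
    obtain ⟨i, j, -, rfl⟩ := mem_typeA.1 hα
    rw [map_sub, sub_pos] at h
    exact ⟨(j, i), Finset.mem_coe.2 (mem_pairs.2 (hf.lt_iff_lt.1 h)), rfl⟩
  · rintro ⟨⟨i, j⟩, h, rfl⟩
    have h := mem_pairs.1 (Finset.mem_coe.1 h)
    refine ⟨mem_typeA.2 ⟨j, i, h.ne', rfl⟩, ?_⟩
    simp only [map_sub, sub_pos]
    exact hf h

theorem map_units_smul (s : ℤˣ) (v : E n) : f (s • v) = ((s : ℤ) : ℝ) * f v := by
  rw [units_smul_eq, map_smul, smul_eq_mul]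

theorem positive_typeD (hf : StrictMono fun i => f (e i)) (hpos : ∀ i, 0 < f (e i)) :
    {α ∈ typeD n | 0 < f α} = (fun p : Fin n × Fin n => (e p.2 - e p.1 : E n)) '' pairs n ∪
      (fun p : Fin n × Fin n => (e p.2 + e p.1 : E n)) '' pairs n := by
  ext α
  constructor
  · rintro ⟨hα, h⟩
    have key : ∀ i j, i < j → ∀ s t : ℤˣ, 0 < f (s • e i + t • e j) →
        s • e i + t • e j ∈ (fun p : Fin n × Fin n => (e p.2 - e p.1 : E n)) '' pairs n ∪
          (fun p : Fin n × Fin n => (e p.2 + e p.1 : E n)) '' pairs n := by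
      intro i j hij s t h
      have h1 := hf hij
      have h2 := hpos i
      have h3 := hpos j
      simp only at h1
      rw [map_add, map_units_smul, map_units_smul] at h
      rcases Int.units_eq_one_or s with rfl | rfl <;> rcases Int.units_eq_one_or t with rfl | rfl
      · right
        refine ⟨(i, j), Finset.mem_coe.2 (mem_pairs.2 hij), ?_⟩
        simp [add_comm]
      · simp at h; linarith
      · left
        refine ⟨(i, j), Finset.mem_coe.2 (mem_pairs.2 hij), ?_⟩
        simp [sub_eq_neg_add]
      · simp at h; linarith
    obtain ⟨i, j, hij, s, t, rfl⟩ := mem_typeD.1 hα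
    rcases lt_or_gt_of_ne hij with h1 | h1
    · exact key i j h1 s t h
    · rw [add_comm] at h ⊢
      exact key j i h1 t s h
  · rintro (⟨⟨i, j⟩, h, rfl⟩ | ⟨⟨i, j⟩, h, rfl⟩)
    · have h := mem_pairs.1 (Finset.mem_coe.1 h)
      refine ⟨sub_mem_typeD h.ne', ?_⟩
      simp only [map_sub, sub_pos]
      exact hf h
    · have h := mem_pairs.1 (Finset.mem_coe.1 h)
      refine ⟨add_mem_typeD h.ne', ?_⟩
      simp only [map_add]
      exact add_pos (hpos _) (hpos _)

theorem positive_shorts (hpos : ∀ i, 0 < f (e i)) (c : ℝ) (hc : 0 < c) :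
    {α | (∃ i, ∃ s : ℤˣ, α = s • c • e i) ∧ 0 < f α} = Set.range fun i => c • (e i : E n) := by
  ext α
  constructor
  · rintro ⟨⟨i, s, rfl⟩, h⟩
    have h2 := mul_pos hc (hpos i)
    rw [map_units_smul, map_smul, smul_eq_mul] at h
    rcases Int.units_eq_one_or s with rfl | rfl
    · exact ⟨i, by simp⟩
    · simp at h; linarith
  · rintro ⟨i, rfl⟩
    refine ⟨⟨i, 1, by simp⟩, ?_⟩
    rw [map_smul, smul_eq_mul]
    exact mul_pos hc (hpos i)

theorem delta_typeA_apply (hf : StrictMono fun i => f (e i)) (k : Fin n) :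
    (delta f (typeA n)) k = k - ((n : ℝ) - 1) / 2 := by
  rw [delta, positive_typeA hf, finsum_mem_image e_sub_injOn, finsum_mem_coe_finset,
    Finset.sum_sub_distrib, PiLp.smul_apply, PiLp.sub_apply, sum_pairs_snd_apply,
    sum_pairs_fst_apply, smul_eq_mul]
  ring

theorem sum_positive_typeD (hf : StrictMono fun i => f (e i)) (hpos : ∀ i, 0 < f (e i)) :
    ∑ᶠ α ∈ {α ∈ typeD n | 0 < f α}, α = (2 : ℝ) • ∑ p ∈ pairs n, (e p.2 : E n) := by
  rw [positive_typeD hf hpos, finsum_mem_union, finsum_mem_image e_sub_injOn,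
    finsum_mem_image e_add_injOn, finsum_mem_coe_finset, finsum_mem_coe_finset,
    Finset.sum_sub_distrib, Finset.sum_add_distrib, two_smul]
  · abel
  · rw [Set.disjoint_left]
    rintro _ ⟨⟨i, j⟩, h, rfl⟩ ⟨⟨k, l⟩, _, h'⟩
    have h := mem_pairs.1 (Finset.mem_coe.1 h)
    have := congrArg (fun v : E n => v i) h'
    simp only [PiLp.sub_apply, PiLp.add_apply, e_apply] at this
    rw [if_neg h.ne, if_pos trivial] at this
    split_ifs at this <;> norm_num at this
  · exact (Finset.finite_toSet _).image _
  · exact (Finset.finite_toSet _).image _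

theorem delta_typeD_apply (hf : StrictMono fun i => f (e i)) (hpos : ∀ i, 0 < f (e i))
    (k : Fin n) : (delta f (typeD n)) k = k := by
  rw [delta, sum_positive_typeD hf hpos, smul_smul, PiLp.smul_apply, sum_pairs_snd_apply,
    smul_eq_mul]
  ring

theorem shorts_notMem_typeD {c : ℝ} {i : Fin n} {s : ℤˣ} : s • c • e i ∉ typeD n := by
  intro h
  obtain ⟨j, k, hjk, a, b, h⟩ := mem_typeD.1 h
  have hj := congrArg (fun v : E n => v j) h
  have hk := congrArg (fun v : E n => v k) h
  simp only [units_smul_apply, PiLp.smul_apply, PiLp.add_apply, e_apply, smul_eq_mul, if_neg hjk,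
    if_neg hjk.symm, if_true] at hj hk
  have ha := abs_cast_units a
  have hb := abs_cast_units b
  by_cases h1 : j = i
  · subst h1
    rw [if_neg hjk.symm] at hk
    simp only [mul_zero, mul_one, zero_add] at hk
    rw [← hk] at hb
    simp at hb
  · rw [if_neg h1] at hj
    simp only [mul_zero, mul_one, add_zero] at hj
    rw [← hj] at ha
    simp at ha

theorem typeD_finite : (typeD n).Finite := by
  have : typeD n ⊆ Set.range fun p : (Fin n × Fin n) × (ℤˣ × ℤˣ) =>
      (p.2.1 • e p.1.1 + p.2.2 • e p.1.2 : E n) := by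
    intro α h
    obtain ⟨i, j, -, s, t, rfl⟩ := mem_typeD.1 h
    exact ⟨((i, j), (s, t)), rfl⟩
  exact (Set.finite_range _).subset this

/-- Each coordinate of the half sum of D_n is raised by half of its root c e_i; c = 1 gives B_n and
c = 2 gives C_n. -/
theorem delta_typeD_union_apply (hf : StrictMono fun i => f (e i)) (hpos : ∀ i, 0 < f (e i))
    {c : ℝ} (hc : 0 < c) (k : Fin n) :
    (delta f (typeD n ∪ {α | ∃ i, ∃ s : ℤˣ, α = s • c • e i})) k = k + c / 2 := by
  have h : {α ∈ typeD n ∪ {α | ∃ i, ∃ s : ℤˣ, α = s • c • e i} | 0 < f α} =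
      {α ∈ typeD n | 0 < f α} ∪ {α | (∃ i, ∃ s : ℤˣ, α = s • c • e i) ∧ 0 < f α} := by
    ext x
    exact or_and_right
  rw [delta, h, finsum_mem_union, sum_positive_typeD hf hpos, positive_shorts hpos c hc,
    finsum_mem_range, finsum_eq_sum_of_fintype, PiLp.smul_apply, PiLp.add_apply,
    PiLp.smul_apply, sum_pairs_snd_apply, ← Finset.smul_sum, PiLp.smul_apply]
  · have : (∑ i, e i : E n) k = 1 := by
      have h : (∑ i, e i : E n) k = ∑ i, (e i : E n) k := by simp
      rw [h]
      simp [e_apply]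
    rw [this]
    simp only [smul_eq_mul]
    ring
  · intro i j hij
    have := congrArg (fun v : E n => v i) hij
    simp only [PiLp.smul_apply, e_apply, smul_eq_mul, if_true] at this
    by_contra hne
    rw [if_neg hne] at this
    simp [hc.ne'] at this
  · rw [Set.disjoint_left]
    rintro _ ⟨hx, _⟩ ⟨⟨i, s, rfl⟩, _⟩
    exact shorts_notMem_typeD hx
  · exact typeD_finite.subset fun x hx => hx.1
  · rw [positive_shorts hpos c hc]
    exact Set.finite_range _

theorem typeB_eq : typeB n = typeD n ∪ {α | ∃ i, ∃ s : ℤˣ, α = s • (1 : ℝ) • e i} := by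
  ext α
  simp [mem_typeB]

theorem typeC_eq : typeC n = typeD n ∪ {α | ∃ i, ∃ s : ℤˣ, α = s • (2 : ℝ) • e i} := by
  ext α
  simp [mem_typeC]

end HalfSums

/-! ### Orbit polynomials of the standard systems -/

section StandardCharacters

variable {f : E n →ₗ[ℝ] ℝ}

theorem abs_sub_cast (i j : Fin n) :
    |((i : ℕ) : ℝ) - ((j : ℕ) : ℝ)| = (((i : ℤ) - j).natAbs : ℝ) := by
  rw [Nat.cast_natAbs]
  push_cast
  rfl

theorem evMap_charA_typeA (hf : StrictMono fun i => f (e i)) :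
    evMap (mono Finset.univ) (charA f (typeA n)) = factorPoly 0 n := by
  rw [evMap_charA_of_range _ f (F := fun σ : Perm (Fin n) => sp 1 σ) ?_ weylGroup_typeA]
  · simp only [sgn_sp_one]
    rw [sum_perm_mono, factorPoly, toepA]
    congr 1
    ext i j : 2
    rw [of_apply, of_apply, delta_typeA_apply hf, delta_typeA_apply hf, sub_sub_sub_cancel_right,
      abs_sub_cast, var]
  · intro σ τ h
    have := sp_injective (a₁ := (1, σ)) (a₂ := (1, τ)) h
    simpa using this

theorem evMap_charA_of_signed {Φ : Set (E n)}
    (hr : Set.range (fun p : (Fin n → ℤˣ) × Perm (Fin n) => sp p.1 p.2) = weylGroup Φ) :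
    evMap (mono Finset.univ) (charA f Φ) =
      det (of fun i j => (X |delta f Φ i - delta f Φ j| - X |delta f Φ i + delta f Φ j| : Poly)) := by
  rw [evMap_charA_of_range _ f sp_injective hr]
  have := sum_signed_perm_mono (fun u : ℤˣ => ((u : ℤ) : ℚ)) (delta f Φ)
  simp only [Units.val_one, Int.cast_one, one_smul, Units.val_neg, Int.cast_neg, neg_smul,
    ← sub_eq_add_neg] at this
  rw [← this]
  refine Finset.sum_congr rfl fun p _ => ?_
  rw [sgn_sp]
  simp

/-- The half sum has coordinates i + 1/2, with differences i - j and sums i + j + 1. For type C they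
are i + 1, hence the sums i + j + 2. -/
theorem evMap_charA_typeB (hf : StrictMono fun i => f (e i)) (hpos : ∀ i, 0 < f (e i)) :
    evMap (mono Finset.univ) (charA f (typeB n)) = factorPoly 1 n := by
  rw [evMap_charA_of_signed weylGroup_typeB, factorPoly, toepB]
  congr 1
  ext i j : 2
  rw [of_apply, of_apply, typeB_eq, delta_typeD_union_apply hf hpos one_pos,
    delta_typeD_union_apply hf hpos one_pos, add_sub_add_right_eq_sub, abs_sub_cast, var, var,
    abs_of_nonneg (by positivity)]
  congr 3
  push_cast
  ring

theorem evMap_charA_typeC (hf : StrictMono fun i => f (e i)) (hpos : ∀ i, 0 < f (e i)) :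
    evMap (mono Finset.univ) (charA f (typeC n)) = factorPoly 2 n := by
  rw [evMap_charA_of_signed weylGroup_typeC, factorPoly, toepC]
  congr 1
  ext i j : 2
  rw [of_apply, of_apply, typeC_eq, delta_typeD_union_apply hf hpos two_pos,
    delta_typeD_union_apply hf hpos two_pos, add_sub_add_right_eq_sub, abs_sub_cast, var, var,
    abs_of_nonneg (by positivity)]
  congr 3
  push_cast
  ring

/-- The sum over even sign changes is half of the sum over all sign changes plus the one weighted by
their sign. Size 0 has to be excluded: the empty determinant would give 1/2 instead of 1. -/
theorem evMap_charA_typeD (hn : 1 ≤ n) (hf : StrictMono fun i => f (e i))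
    (hpos : ∀ i, 0 < f (e i)) :
    evMap (mono Finset.univ) (charA f (typeD n)) = factorPoly 3 n := by
  classical
  have hinj : Function.Injective
      fun p : {s : Fin n → ℤˣ // ∏ i, s i = 1} × Perm (Fin n) => sp p.1.1 p.2 := by
    rintro ⟨⟨s, hs⟩, σ⟩ ⟨⟨t, ht⟩, τ⟩ h
    have := sp_injective (a₁ := (s, σ)) (a₂ := (t, τ)) h
    simpa using this
  rw [evMap_charA_of_range _ f hinj weylGroup_typeD, factorPoly]
  have h1 := sum_signed_perm_mono (fun _ : ℤˣ => 1) (delta f (typeD n))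
  have h2 := sum_signed_perm_mono (fun u : ℤˣ => ((u : ℤ) : ℚ)) (delta f (typeD n))
  -- The half sum has zeroth coordinate 0, so the zeroth row consists of differences X_j - X_j.
  have z : det (of fun i j => (((((1 : ℤˣ) : ℤ) : ℚ)) • X |delta f (typeD n) i - delta f (typeD n) j|
      + ((((-1 : ℤˣ) : ℤ) : ℚ)) • X |delta f (typeD n) i + delta f (typeD n) j| : Poly)) = 0 := by
    apply det_eq_zero_of_row_eq_zero ⟨0, hn⟩
    intro j
    rw [of_apply, delta_typeD_apply hf hpos]
    simp
  have d : det (of fun i j => ((1 : ℚ) • X |delta f (typeD n) i - delta f (typeD n) j|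
      + (1 : ℚ) • X |delta f (typeD n) i + delta f (typeD n) j| : Poly)) = toepD var n := by
    rw [toepD]
    congr 1
    ext i j : 2
    rw [of_apply, of_apply, delta_typeD_apply hf hpos, delta_typeD_apply hf hpos, abs_sub_cast,
      abs_of_nonneg (by positivity), one_smul, one_smul, var, var]
    push_cast
    rfl
  rw [z] at h2
  rw [d] at h1
  let g : (Fin n → ℤˣ) → Poly := fun s => ∑ σ : Perm (Fin n), ((Perm.sign σ : ℤ) : ℚ) •
    mono Finset.univ (delta f (typeD n) - sp s σ (delta f (typeD n)))
  have e1 : ∑ s, g s = toepD var n := by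
    rw [← h1, Fintype.sum_prod_type]
    simp [g]
  have e2 : ∑ s : Fin n → ℤˣ, (((∏ i, s i : ℤˣ) : ℤ) : ℚ) • g s = 0 := by
    rw [← h2, Fintype.sum_prod_type]
    refine Finset.sum_congr rfl fun s _ => ?_
    rw [Finset.smul_sum]
    refine Finset.sum_congr rfl fun σ _ => ?_
    rw [smul_smul]
    simp
  have e3 : ∀ s : Fin n → ℤˣ, (if ∏ i, s i = 1 then g s else 0) =
      (1 / 2 : ℚ) • (g s + (((∏ i, s i : ℤˣ) : ℤ) : ℚ) • g s) := by
    intro s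
    rcases Int.units_eq_one_or (∏ i, s i) with h | h
    · rw [h, if_pos rfl, Units.val_one, Int.cast_one, one_smul, ← two_smul ℚ, smul_smul]
      norm_num
    · rw [h, if_neg (by decide)]
      simp
  have e4 : ∑ s : {s : Fin n → ℤˣ // ∏ i, s i = 1}, g s.1 =
      ∑ s, if ∏ i, s i = 1 then g s else 0 := by
    rw [← Finset.sum_filter]
    exact (Finset.sum_subtype _ (by simp) g).symm
  rw [← e1, Fintype.sum_prod_type]
  trans ∑ s : {s : Fin n → ℤˣ // ∏ i, s i = 1}, g s.1
  · refine Finset.sum_congr rfl fun s _ => Finset.sum_congr rfl fun σ _ => ?_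
    rw [sgn_sp, s.2]
    simp
  · rw [e4, Finset.sum_congr rfl fun s _ => e3 s, ← Finset.smul_sum, Finset.sum_add_distrib, e2,
      add_zero]

end StandardCharacters

end RootChar

end

noncomputable section

namespace RootChar

open MvPolynomial

variable {n : ℕ}

/-- The standard system of type `A`, `B`, `C` or `D` on the coordinates in `I`. -/
def std : Fin 4 → Finset (Fin n) → (Fin n → ℤˣ) → Set (E n)
  | 0, I, ε => setA I ε
  | 1, I, _ => setB I
  | 2, I, _ => setC I
  | 3, I, _ => setD I

/-! ### Blocks as signed coordinate embeddings -/

section Embedding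

variable {k : ℕ}

/-- The coordinate embedding `e_a ↦ s_a e_{ι a}`. -/
def emb (s : Fin k → ℤˣ) (ι : Fin k → Fin n) : E k →ₗ[ℝ] E n where
  toFun v := ∑ a, v a • s a • e (ι a)
  map_add' v w := by simp [add_smul, Finset.sum_add_distrib]
  map_smul' c v := by simp [mul_smul, Finset.smul_sum]

variable {s : Fin k → ℤˣ} {ι : Fin k → Fin n}

theorem emb_e (a : Fin k) : emb s ι (e a) = s a • e (ι a) := by
  change ∑ b, (e a) b • s b • e (ι b) = _
  rw [Finset.sum_eq_single a]
  · simp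
  · intro b _ hb
    rw [e_apply_of_ne hb, zero_smul]
  · simp

theorem emb_apply (hι : Function.Injective ι) (v : E k) (a : Fin k) :
    (emb s ι v) (ι a) = ((s a : ℤ) : ℝ) * v a := by
  have h : (emb s ι v) (ι a) = ∑ b, (v b • s b • e (ι b) : E n) (ι a) := by
    change (∑ b, v b • s b • e (ι b) : E n) (ι a) = _
    simp
  rw [h, Finset.sum_eq_single a]
  · rw [PiLp.smul_apply, units_smul_apply, e_apply_self, smul_eq_mul]
    ring
  · intro b _ hb
    rw [PiLp.smul_apply, units_smul_apply, e_apply_of_ne fun h => hb (hι h).symm]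
    simp
  · simp

theorem emb_apply_of_notMem (v : E k) {i : Fin n} (hi : ∀ a, ι a ≠ i) : (emb s ι v) i = 0 := by
  have h : (emb s ι v) i = ∑ b, (v b • s b • e (ι b) : E n) i := by
    change (∑ b, v b • s b • e (ι b) : E n) i = _
    simp
  rw [h]
  refine Finset.sum_eq_zero fun b _ => ?_
  rw [PiLp.smul_apply, units_smul_apply, e_apply_of_ne (hi b).symm]
  simp

theorem emb_injective (hι : Function.Injective ι) : Function.Injective (emb s ι) := by
  intro v w h
  ext a
  have := congrArg (fun x : E n => x (ι a)) h
  simp only [emb_apply hι] at this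
  have hs := cast_units_mul_self (s a)
  calc v a = ((s a : ℤ) : ℝ) * (((s a : ℤ) : ℝ) * v a) := by rw [← mul_assoc, hs, one_mul]
    _ = w a := by rw [this, ← mul_assoc, hs, one_mul]

theorem inner_emb (hι : Function.Injective ι) (v w : E k) :
    inner ℝ (emb s ι v) (emb s ι w) = inner ℝ v w := by
  rw [inner_eq_sum, inner_eq_sum]
  symm
  refine Finset.sum_of_injOn ι hι.injOn (by simp) ?_ ?_
  · intro i _ hi
    rw [emb_apply_of_notMem v, zero_mul]
    intro a h
    exact hi ⟨a, by simp, h⟩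
  · intro a _
    rw [emb_apply hι, emb_apply hι, mul_mul_mul_comm, cast_units_mul_self, one_mul]

theorem cusp_emb (hι : Function.Injective ι) (v w : E k) :
    cusp (emb s ι v) (emb s ι w) = cusp v w := by
  rw [cusp, cusp, inner_emb hι, inner_emb hι]

theorem mono_emb (hι : Function.Injective ι) (v : E k) :
    mono (Finset.univ.image ι) (emb s ι v) = mono Finset.univ v := by
  rw [mono, Finset.prod_image hι.injOn, mono]
  refine Finset.prod_congr rfl fun a _ => ?_
  rw [emb_apply hι, abs_mul, abs_cast_units, one_mul]

theorem emb_image_typeA {ε : Fin n → ℤˣ} (hι : Function.Injective ι) :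
    emb (fun a => ε (ι a)) ι '' typeA k = setA (Finset.univ.image ι) ε := by
  ext α
  constructor
  · rintro ⟨_, hx, rfl⟩
    obtain ⟨a, b, hab, rfl⟩ := mem_typeA.1 hx
    refine ⟨ι a, by simp, ι b, by simp, hι.ne hab, ?_⟩
    rw [map_sub, emb_e, emb_e]
  · rintro ⟨i, hi, j, hj, hij, rfl⟩
    obtain ⟨a, -, rfl⟩ := Finset.mem_image.1 hi
    obtain ⟨b, -, rfl⟩ := Finset.mem_image.1 hj
    refine ⟨e a - e b, mem_typeA.2 ⟨a, b, fun h => hij (h ▸ rfl), rfl⟩, ?_⟩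
    rw [map_sub, emb_e, emb_e]

theorem emb_units_smul (t : ℤˣ) (v : E k) : emb s ι (t • v) = t • emb s ι v := by
  rw [units_smul_eq, map_smul, units_smul_eq]

theorem emb_image_typeD (hι : Function.Injective ι) :
    emb s ι '' typeD k = setD (Finset.univ.image ι) := by
  ext α
  constructor
  · rintro ⟨_, hx, rfl⟩
    obtain ⟨a, b, hab, u, t, rfl⟩ := mem_typeD.1 hx
    refine ⟨ι a, by simp, ι b, by simp, hι.ne hab, u * s a, t * s b, ?_⟩
    rw [map_add, emb_units_smul, emb_units_smul, emb_e, emb_e, smul_smul, smul_smul]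
  · rintro ⟨i, hi, j, hj, hij, u, t, rfl⟩
    obtain ⟨a, -, rfl⟩ := Finset.mem_image.1 hi
    obtain ⟨b, -, rfl⟩ := Finset.mem_image.1 hj
    refine ⟨(u * s a) • e a + (t * s b) • e b,
      mem_typeD.2 ⟨a, b, fun h => hij (h ▸ rfl), _, _, rfl⟩, ?_⟩
    rw [map_add, emb_units_smul, emb_units_smul, emb_e, emb_e, smul_smul, smul_smul, mul_assoc,
      mul_assoc, Int.units_mul_self, Int.units_mul_self, mul_one, mul_one]

theorem emb_image_shorts (c : ℝ) :
    emb s ι '' {α | ∃ i, ∃ u : ℤˣ, α = u • c • e i} =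
      {α | ∃ i ∈ Finset.univ.image ι, ∃ u : ℤˣ, α = u • c • e i} := by
  ext α
  constructor
  · rintro ⟨_, ⟨a, u, rfl⟩, rfl⟩
    refine ⟨ι a, by simp, u * s a, ?_⟩
    rw [emb_units_smul, map_smul, emb_e, smul_comm c, smul_smul]
  · rintro ⟨i, hi, u, rfl⟩
    obtain ⟨a, -, rfl⟩ := Finset.mem_image.1 hi
    refine ⟨(u * s a) • c • e a, ⟨a, _, rfl⟩, ?_⟩
    rw [emb_units_smul, map_smul, emb_e, smul_comm c, smul_smul, mul_assoc, Int.units_mul_self,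
      mul_one]

theorem emb_image_typeB (hι : Function.Injective ι) :
    emb s ι '' typeB k = setB (Finset.univ.image ι) := by
  rw [typeB_eq, Set.image_union, emb_image_typeD hι, emb_image_shorts]
  simp [setB]

theorem emb_image_typeC (hι : Function.Injective ι) :
    emb s ι '' typeC k = setC (Finset.univ.image ι) := by
  rw [typeC_eq, Set.image_union, emb_image_typeD hι, emb_image_shorts]
  rfl

/-- The indices in I are listed in increasing order of h, which puts the positive system of a block
into standard form. -/
theorem exists_strictMono_param (I : Finset (Fin n)) {h : Fin n → ℝ} (hI : Set.InjOn h I) :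
    ∃ ι : Fin I.card → Fin n, Function.Injective ι ∧ Finset.univ.image ι = I ∧
      StrictMono fun a => h (ι a) := by
  have hc : (I.image h).card = I.card := Finset.card_image_of_injOn hI
  let g := (I.image h).orderEmbOfFin hc
  have hg : ∀ a, ∃ i ∈ I, h i = g a := fun a =>
    Finset.mem_image.1 ((I.image h).orderEmbOfFin_mem hc a)
  choose ι hι hιg using hg
  have hm : StrictMono fun a => h (ι a) := by
    intro a b hab
    simp only [hιg]
    exact g.strictMono hab
  have hinj : Function.Injective ι := fun a b hab => hm.injective (by simp only [hab])
  refine ⟨ι, hinj, ?_, hm⟩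
  apply Finset.eq_of_subset_of_card_le
  · intro i hi
    obtain ⟨a, -, rfl⟩ := Finset.mem_image.1 hi
    exact hι a
  · rw [Finset.card_image_of_injective _ hinj]
    simp

theorem IsRootSystem.of_image {V V' : Type*} [NormedAddCommGroup V] [InnerProductSpace ℝ V]
    [NormedAddCommGroup V'] [InnerProductSpace ℝ V'] {Φ : Set V} {L : V →ₗ[ℝ] V'}
    (hL : Function.Injective L) (hc : ∀ v w, cusp (L v) (L w) = cusp v w)
    (h : IsRootSystem (L '' Φ)) : IsRootSystem Φ where
  finite := Set.Finite.of_finite_image h.finite hL.injOn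
  zero_notMem h0 := h.zero_notMem ⟨0, h0, map_zero L⟩
  reflect_mem α hα β hβ := by
    have := h.reflect_mem _ (Set.mem_image_of_mem L hα) _ (Set.mem_image_of_mem L hβ)
    rw [hc, ← map_smul, ← map_sub] at this
    exact (hL.mem_set_image).1 this
  integral α hα β hβ := by
    have := h.integral _ (Set.mem_image_of_mem L hα) _ (Set.mem_image_of_mem L hβ)
    rwa [hc] at this

theorem evMap_charA_emb {Φ : Set (E k)} (hι : Function.Injective ι)
    (hΦ : IsRootSystem (emb s ι '' Φ)) (f : E n →ₗ[ℝ] ℝ) :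
    evMap (mono (Finset.univ.image ι)) (charA f (emb s ι '' Φ)) =
      evMap (mono Finset.univ) (charA (f ∘ₗ emb s ι) Φ) := by
  have hr := hΦ.of_image (emb_injective hι) (cusp_emb hι)
  rw [evMap_charA_image (f := f ∘ₗ emb s ι) _ hr (emb_injective hι)
    (fun α _ v => cusp_emb hι v α) (fun α _ => Iff.rfl)]
  congr 2
  funext v
  exact mono_emb hι v

theorem mem_typeBC {α : E n} : α ∈ typeBC n ↔ α ∈ typeD n ∨ (∃ i, ∃ s : ℤˣ, α = s • e i) ∨
    ∃ i, ∃ s : ℤˣ, α = s • (2 : ℝ) • e i := by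
  rw [typeBC, Set.mem_union, mem_typeB, mem_typeC, or_assoc, or_left_comm, or_self_left,
    or_left_comm]

/-- The character of a standard system is the polynomial of its type and size. -/
theorem evMap_charA_std {τ : Fin 4} {I : Finset (Fin n)} {ε : Fin n → ℤˣ}
    (h3 : τ = 3 → 1 ≤ I.card) (hr : IsRootSystem (std τ I ε)) {f : E n →ₗ[ℝ] ℝ}
    (hf : ∀ α ∈ typeBC n, f α ≠ 0) :
    evMap (mono I) (charA f (std τ I ε)) = factorPoly τ I.card := by
  have hlong : ∀ i j, i ≠ j → ∀ a b : ℤˣ,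
      ((a : ℤ) : ℝ) * f (e i) + ((b : ℤ) : ℝ) * f (e j) ≠ 0 := by
    intro i j hij a b
    have := hf (a • e i + b • e j) (mem_typeBC.2 (Or.inl (mem_typeD.2 ⟨i, j, hij, a, b, rfl⟩)))
    rwa [map_add, map_units_smul, map_units_smul] at this
  have hshort : ∀ i, f (e i) ≠ 0 := fun i =>
    hf (e i) (mem_typeBC.2 (Or.inr (Or.inl ⟨i, 1, by simp⟩)))
  have habs : ∀ i, ∃ s : ℤˣ, ((s : ℤ) : ℝ) * f (e i) = |f (e i)| := by
    intro i
    rcases abs_choice (f (e i)) with h | h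
    · exact ⟨1, by simp [h]⟩
    · exact ⟨-1, by simp [h]⟩
  choose sg hsg using habs
  have hinj : Set.InjOn (fun i => |f (e i)|) I := by
    intro i _ j _ hij
    by_contra hne
    simp only [← hsg] at hij
    apply hlong i j hne (sg i) (-sg j)
    push_cast
    linarith
  by_cases h0 : τ = 0
  · subst h0
    -- In type A the signs are prescribed by ε, so the indices are ordered by the values ε_i f(e_i),
    -- which may be negative.
    have hinjA : Set.InjOn (fun i => ((ε i : ℤ) : ℝ) * f (e i)) I := by
      intro i _ j _ hij
      by_contra hne
      apply hlong i j hne (ε i) (-ε j)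
      push_cast
      simp only at hij
      linarith
    obtain ⟨ι, hι, hI, hm⟩ := exists_strictMono_param I hinjA
    have himg := emb_image_typeA (ε := ε) hι
    rw [hI] at himg
    change IsRootSystem (setA I ε) at hr
    change evMap (mono I) (charA f (setA I ε)) = _
    have := evMap_charA_emb (s := fun a => ε (ι a)) hι (himg.symm ▸ hr) f
    rw [hI, himg] at this
    rw [this]
    apply evMap_charA_typeA
    simpa only [LinearMap.comp_apply, emb_e, map_units_smul] using hm
  -- The other types are stable under sign changes, so the signs `sg` can be chosen to make f
  -- positive on the images of the basis vectors.
  · obtain ⟨ι, hι, hI, hm⟩ := exists_strictMono_param I hinj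
    have hm' : StrictMono fun a => (f ∘ₗ emb (fun a => sg (ι a)) ι) (e a) := by
      simpa only [LinearMap.comp_apply, emb_e, map_units_smul, hsg] using hm
    have hpos : ∀ a, 0 < (f ∘ₗ emb (fun a => sg (ι a)) ι) (e a) := by
      intro a
      rw [LinearMap.comp_apply, emb_e, map_units_smul, hsg]
      exact abs_pos.2 (hshort _)
    have key : ∀ Φ : Set (E I.card), emb (fun a => sg (ι a)) ι '' Φ = std τ I ε →
        evMap (mono I) (charA f (std τ I ε)) =
          evMap (mono Finset.univ) (charA (f ∘ₗ emb (fun a => sg (ι a)) ι) Φ) := by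
      intro Φ hΦ
      have := evMap_charA_emb hι (hΦ.symm ▸ hr) f
      rwa [hI, hΦ] at this
    have hB := emb_image_typeB (s := fun a => sg (ι a)) hι
    have hC := emb_image_typeC (s := fun a => sg (ι a)) hι
    have hD := emb_image_typeD (s := fun a => sg (ι a)) hι
    rw [hI] at hB hC hD
    fin_cases τ
    · exact absurd rfl h0
    · rw [key _ hB]
      exact evMap_charA_typeB hm' hpos
    · rw [key _ hC]
      exact evMap_charA_typeC hm' hpos
    · rw [key _ hD]
      exact evMap_charA_typeD (h3 rfl) hm' hpos

end Embedding

/-! ### Regular functionals and perturbation -/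

section Perturbation

theorem charA_congr {V : Type*} [NormedAddCommGroup V] [InnerProductSpace ℝ V] {Φ : Set V}
    {f g : V →ₗ[ℝ] ℝ} (h : ∀ α ∈ Φ, 0 < f α ↔ 0 < g α) : charA f Φ = charA g Φ := by
  have : delta f Φ = delta g Φ := by
    rw [delta, delta]
    have : {α ∈ Φ | 0 < f α} = {α ∈ Φ | 0 < g α} := Set.ext fun x => and_congr_right (h x)
    rw [this]
  rw [charA, charA, this]

theorem typeBC_finite : (typeBC n).Finite := by
  have h : typeBC n ⊆ typeD n ∪ ((Set.range fun p : Fin n × ℤˣ => (p.2 • e p.1 : E n)) ∪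
      Set.range fun p : Fin n × ℤˣ => (p.2 • (2 : ℝ) • e p.1 : E n)) := by
    intro α hα
    rcases mem_typeBC.1 hα with h | ⟨i, s, rfl⟩ | ⟨i, s, rfl⟩
    · exact Or.inl h
    · exact Or.inr (Or.inl ⟨(i, s), rfl⟩)
    · exact Or.inr (Or.inr ⟨(i, s), rfl⟩)
  exact (typeD_finite.union ((Set.finite_range _).union (Set.finite_range _))).subset h

/-- A functional that vanishes on no root of `BC_n`. -/
theorem exists_regular : ∃ h : E n →ₗ[ℝ] ℝ, ∀ α ∈ typeBC n, h α ≠ 0 := by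
  -- The values h(e_i) = 2 ^ i are positive and distinct.
  let h : E n →ₗ[ℝ] ℝ :=
    { toFun := fun v => ∑ i : Fin n, (2 : ℝ) ^ (i : ℕ) * v i
      map_add' := fun v w => by simp [mul_add, Finset.sum_add_distrib]
      map_smul' := fun c v => by simp [Finset.mul_sum, mul_left_comm] }
  have he : ∀ i, h (e i) = 2 ^ (i : ℕ) := by
    intro i
    change ∑ j : Fin n, (2 : ℝ) ^ (j : ℕ) * (e i) j = _
    simp [e_apply]
  refine ⟨h, fun α hα => ?_⟩
  rcases mem_typeBC.1 hα with hD | ⟨i, s, rfl⟩ | ⟨i, s, rfl⟩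
  · obtain ⟨i, j, hij, s, t, rfl⟩ := mem_typeD.1 hD
    rw [map_add, map_units_smul, map_units_smul, he, he]
    intro h0
    have h1 : |((s : ℤ) : ℝ) * 2 ^ (i : ℕ)| = |((t : ℤ) : ℝ) * 2 ^ (j : ℕ)| := by
      rw [eq_neg_of_add_eq_zero_left h0, abs_neg]
    rw [abs_mul, abs_mul, abs_cast_units, abs_cast_units, one_mul, one_mul, abs_of_pos (by positivity),
      abs_of_pos (by positivity)] at h1
    exact hij (Fin.ext (pow_right_injective₀ (by norm_num) (by norm_num) h1))
  · rw [map_units_smul, he]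
    have := abs_cast_units s
    intro h0
    rcases mul_eq_zero.1 h0 with h1 | h1
    · simp [h1] at this
    · exact absurd h1 (by positivity)
  · rw [map_units_smul, map_smul, he]
    have := abs_cast_units s
    intro h0
    rcases mul_eq_zero.1 h0 with h1 | h1
    · simp [h1] at this
    · exact absurd h1 (by positivity)

open Filter Topology in
/-- A functional that vanishes on no root of a finite set can be perturbed to vanish on no root of
`BC_n`, without changing the signs. -/
theorem exists_regular_perturbation {Ψ : Set (E n)} (hΨ : Ψ.Finite) {f : E n →ₗ[ℝ] ℝ}
    (hf : ∀ α ∈ Ψ, f α ≠ 0) :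
    ∃ g : E n →ₗ[ℝ] ℝ, (∀ α ∈ Ψ, 0 < g α ↔ 0 < f α) ∧ ∀ α ∈ typeBC n, g α ≠ 0 := by
  obtain ⟨h, hh⟩ := exists_regular (n := n)
  -- The functional will be f + t h with small t > 0: where f is nonzero its sign survives, and
  -- where f vanishes on a root of BC_n the term t h takes over.
  have lim : ∀ α : E n, Tendsto (fun t : ℝ => f α + t * h α) (𝓝[>] 0) (𝓝 (f α)) := by
    intro α
    have : Tendsto (fun t : ℝ => f α + t * h α) (𝓝 0) (𝓝 (f α + 0 * h α)) :=
      (Continuous.tendsto (by fun_prop) 0)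
    rw [zero_mul, add_zero] at this
    exact this.mono_left nhdsWithin_le_nhds
  have h1 : ∀ α ∈ Ψ, ∀ᶠ t in 𝓝[>] (0 : ℝ), 0 < f α + t * h α ↔ 0 < f α := by
    intro α hα
    rcases lt_or_gt_of_ne (hf α hα) with hneg | hpos
    · filter_upwards [(lim α).eventually_lt_const hneg] with t ht
      exact ⟨fun h => absurd h ht.not_gt, fun h => absurd h hneg.not_gt⟩
    · filter_upwards [(lim α).eventually_const_lt hpos] with t ht
      exact ⟨fun _ => hpos, fun _ => ht⟩
  have h2 : ∀ α ∈ typeBC n, ∀ᶠ t in 𝓝[>] (0 : ℝ), f α + t * h α ≠ 0 := by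
    intro α hα
    by_cases h0 : f α = 0
    · filter_upwards [self_mem_nhdsWithin] with t ht
      rw [h0, zero_add]
      exact mul_ne_zero (ne_of_gt ht) (hh α hα)
    · exact (lim α).eventually_ne h0
  obtain ⟨t, ht1, ht2⟩ := (((eventually_all_finite hΨ).2 h1).and
    ((eventually_all_finite typeBC_finite).2 h2)).exists
  exact ⟨f + t • h, ht1, ht2⟩

end Perturbation

end RootChar

end

noncomputable section

namespace RootChar

open MvPolynomial

variable {n : ℕ} {Φ : Set (E n)}

/-- `I` is a block of `Φ` on which `Φ` is of type `τ`. -/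
def IsBlock (Φ : Set (E n)) (τ : Fin 4) (I : Finset (Fin n)) : Prop :=
  -- D_1 has no roots and would duplicate the trivial block A_0.
  I.Nonempty ∧ (τ = 3 → 2 ≤ I.card) ∧ ∃ ε, meet Φ I = std τ I ε

/-! ### Blocks and their types are unique -/

section Standard

theorem setA_subset_setD {I : Finset (Fin n)} {ε : Fin n → ℤˣ} : setA I ε ⊆ setD I := by
  rintro _ ⟨i, hi, j, hj, hij, rfl⟩
  exact ⟨i, hi, j, hj, hij, ε i, -ε j, by rw [Units.neg_smul, sub_eq_add_neg]⟩

theorem setD_subset_typeD {I : Finset (Fin n)} : setD I ⊆ typeD n := by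
  rintro _ ⟨i, -, j, -, hij, s, t, rfl⟩
  exact mem_typeD.2 ⟨i, j, hij, s, t, rfl⟩

theorem std_cases {τ : Fin 4} {I : Finset (Fin n)} {ε : Fin n → ℤˣ} {α : E n}
    (h : α ∈ std τ I ε) : α ∈ setD I ∨ (∃ i ∈ I, ∃ s : ℤˣ, α = s • e i) ∨
      ∃ i ∈ I, ∃ s : ℤˣ, α = s • (2 : ℝ) • e i := by
  fin_cases τ
  · exact Or.inl (setA_subset_setD h)
  · rcases h with h | h
    · exact Or.inl h
    · exact Or.inr (Or.inl h)
  · rcases h with h | h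
    · exact Or.inl h
    · exact Or.inr (Or.inr h)
  · exact Or.inl h

theorem std_apply_eq_zero {τ : Fin 4} {I : Finset (Fin n)} {ε : Fin n → ℤˣ} {α : E n}
    (h : α ∈ std τ I ε) {i : Fin n} (hi : i ∉ I) : α i = 0 := by
  have hne : ∀ j ∈ I, (e j : E n) i = 0 := fun j hj => e_apply_of_ne fun h => hi (h ▸ hj)
  rcases std_cases h with ⟨j, hj, k, hk, -, s, t, rfl⟩ | ⟨j, hj, s, rfl⟩ | ⟨j, hj, s, rfl⟩
  · simp [units_smul_apply, hne j hj, hne k hk]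
  · simp [units_smul_apply, hne j hj]
  · simp [units_smul_apply, hne j hj]

theorem exists_mem_std {τ : Fin 4} {I : Finset (Fin n)} (ε : Fin n → ℤˣ) {i j : Fin n}
    (hi : i ∈ I) (hj : j ∈ I) (hij : i ≠ j) : ∃ α ∈ std τ I ε, α i ≠ 0 ∧ α j ≠ 0 := by
  refine ⟨ε i • e i - ε j • e j, ?_, ?_, ?_⟩
  · have hA : ε i • e i - ε j • e j ∈ setA I ε := ⟨i, hi, j, hj, hij, rfl⟩
    fin_cases τ
    · exact hA
    · exact Or.inl (setA_subset_setD hA)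
    · exact Or.inl (setA_subset_setD hA)
    · exact setA_subset_setD hA
  · simp [units_smul_apply, e_apply_of_ne hij]
  · simp [units_smul_apply, e_apply_of_ne hij.symm]

/-- Any two indices of a block lie in the support of one root, and a root that meets a block is
supported in it. Overlapping blocks therefore contain each other. -/
theorem IsBlock.eq_of_mem {τ τ' : Fin 4} {I J : Finset (Fin n)} (hI : IsBlock Φ τ I)
    (hJ : IsBlock Φ τ' J) {i : Fin n} (hiI : i ∈ I) (hiJ : i ∈ J) : I = J := by
  have key : ∀ {τ τ' : Fin 4} {I J : Finset (Fin n)}, IsBlock Φ τ I → IsBlock Φ τ' J →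
      i ∈ I → i ∈ J → I ⊆ J := by
    rintro τ τ' I J ⟨-, -, ε, hε⟩ ⟨-, -, ε', hε'⟩ hi hj k hk
    by_cases hik : i = k
    · exact hik ▸ hj
    obtain ⟨α, hα, h1, h2⟩ := exists_mem_std (τ := τ) ε hi hk hik
    rw [← hε] at hα
    have hα' : α ∈ meet Φ J := ⟨hα.1, i, hj, h1⟩
    rw [hε'] at hα'
    by_contra hk'
    exact h2 (std_apply_eq_zero hα' hk')
  exact (key hI hJ hiI hiJ).antisymm (key hJ hI hiJ hiI)

theorem short_ne_double {i j : Fin n} {s : ℤˣ} : (e i : E n) ≠ s • (2 : ℝ) • e j := by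
  intro h
  have h1 := congrArg (fun v : E n => v i) h
  simp only [units_smul_apply, PiLp.smul_apply, smul_eq_mul, e_apply_self] at h1
  have h2 := abs_cast_units s
  by_cases hij : i = j
  · subst hij
    rw [e_apply_self] at h1
    have : |((s : ℤ) : ℝ) * (2 * 1)| = 2 := by rw [abs_mul, h2]; norm_num
    rw [← h1] at this
    norm_num at this
  · rw [e_apply_of_ne hij] at h1
    norm_num at h1

theorem e_notMem_typeD {i : Fin n} : e i ∉ typeD n := by
  have := shorts_notMem_typeD (c := 1) (i := i) (s := 1)
  simpa using this

theorem double_notMem_typeD {i : Fin n} : (2 : ℝ) • e i ∉ typeD n := by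
  have := shorts_notMem_typeD (c := 2) (i := i) (s := 1)
  simpa using this

theorem e_mem_std_iff {τ : Fin 4} {I : Finset (Fin n)} {ε : Fin n → ℤˣ} {i : Fin n}
    (hi : i ∈ I) : e i ∈ std τ I ε ↔ τ = 1 := by
  fin_cases τ
  · exact iff_of_false (fun h => e_notMem_typeD (setD_subset_typeD (setA_subset_setD h)))
      (by decide)
  · exact iff_of_true (Or.inr ⟨i, hi, 1, by simp⟩) rfl
  · refine iff_of_false ?_ (by decide)
    rintro (h | ⟨j, -, s, h⟩)
    · exact e_notMem_typeD (setD_subset_typeD h)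
    · exact short_ne_double h
  · exact iff_of_false (fun h => e_notMem_typeD (setD_subset_typeD h)) (by decide)

theorem double_mem_std_iff {τ : Fin 4} {I : Finset (Fin n)} {ε : Fin n → ℤˣ} {i : Fin n}
    (hi : i ∈ I) : (2 : ℝ) • e i ∈ std τ I ε ↔ τ = 2 := by
  fin_cases τ
  · exact iff_of_false (fun h => double_notMem_typeD (setD_subset_typeD (setA_subset_setD h)))
      (by decide)
  · refine iff_of_false ?_ (by decide)
    rintro (h | ⟨j, -, s, h⟩)
    · exact double_notMem_typeD (setD_subset_typeD h)
    · have h' : (e j : E n) = s • (2 : ℝ) • e i := by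
        rw [h, smul_smul, Int.units_mul_self, one_smul]
      exact short_ne_double h'
  · exact iff_of_true (Or.inr ⟨i, hi, 1, by simp⟩) rfl
  · exact iff_of_false (fun h => double_notMem_typeD (setD_subset_typeD h)) (by decide)

theorem long_eq_long {i j k l : Fin n} {a b c d : ℤˣ} (hij : i ≠ j)
    (h : a • e i + b • e j = (c • e k + d • e l : E n)) :
    (i = k ∧ j = l ∧ a = c ∧ b = d) ∨ (i = l ∧ j = k ∧ a = d ∧ b = c) := by
  have hi := congrArg (fun v : E n => v i) h
  have hj := congrArg (fun v : E n => v j) h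
  have hk := congrArg (fun v : E n => v k) h
  have hl := congrArg (fun v : E n => v l) h
  simp only [PiLp.add_apply, units_smul_apply, e_apply] at hi hj hk hl
  have cst : ∀ u v : ℤˣ, ((u : ℤ) : ℝ) = ((v : ℤ) : ℝ) → u = v := fun u v h =>
    Units.ext (by exact_mod_cast h)
  have nz : ∀ u : ℤˣ, ((u : ℤ) : ℝ) ≠ 0 := fun u h => by
    have := abs_cast_units u
    simp [h] at this
  by_cases h1 : i = k
  · subst h1
    by_cases h2 : j = l
    · subst h2
      refine Or.inl ⟨rfl, rfl, cst _ _ ?_, cst _ _ ?_⟩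
      · simpa [hij] using hi
      · simpa [hij.symm] using hj
    · exfalso
      rw [if_neg hij.symm, if_neg h2, if_pos trivial] at hj
      simp only [mul_zero, mul_one, zero_add, add_zero] at hj
      exact nz _ hj
  · by_cases h2 : i = l
    · subst h2
      by_cases h3 : j = k
      · subst h3
        refine Or.inr ⟨rfl, rfl, cst _ _ ?_, cst _ _ ?_⟩
        · simpa [hij] using hi
        · simpa [hij.symm] using hj
      · exfalso
        rw [if_neg hij.symm, if_neg h3, if_pos trivial] at hj
        simp only [mul_zero, mul_one, zero_add, add_zero] at hj
        exact nz _ hj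
    · exfalso
      rw [if_neg h1, if_neg h2, if_neg hij, if_pos trivial] at hi
      simp only [mul_zero, mul_one, add_zero] at hi
      exact nz _ hi

/-- The first root forces ε_i ε_j = -1, the second ε_i ε_j = 1. -/
theorem not_both_mem_setA {I : Finset (Fin n)} {ε : Fin n → ℤˣ} {i j : Fin n} (hij : i ≠ j)
    (h1 : e i + e j ∈ setA I ε) (h2 : e i - e j ∈ setA I ε) : False := by
  obtain ⟨k, -, l, -, -, h1⟩ := h1
  obtain ⟨k', -, l', -, -, h2⟩ := h2
  have h1' : (1 : ℤˣ) • e i + (1 : ℤˣ) • e j = ε k • e k + (-ε l) • e l := by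
    rw [one_smul, one_smul, h1, Units.neg_smul, sub_eq_add_neg]
  have h2' : (1 : ℤˣ) • e i + (-1 : ℤˣ) • e j = ε k' • e k' + (-ε l') • e l' := by
    rw [one_smul, Units.neg_smul, one_smul, ← sub_eq_add_neg, h2, Units.neg_smul, sub_eq_add_neg]
  have a1 : ε i * ε j = -1 := by
    rcases long_eq_long hij h1' with ⟨rfl, rfl, ha, hb⟩ | ⟨rfl, rfl, ha, hb⟩
    · rw [← ha, one_mul]
      exact (neg_eq_iff_eq_neg.1 hb.symm)
    · rw [← hb, mul_one]
      exact neg_eq_iff_eq_neg.1 ha.symm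
  have a2 : ε i * ε j = 1 := by
    rcases long_eq_long hij h2' with ⟨rfl, rfl, ha, hb⟩ | ⟨rfl, rfl, ha, hb⟩
    · rw [← ha, one_mul]
      exact (neg_injective hb).symm
    · rw [← hb]
      have := neg_eq_iff_eq_neg.1 ha.symm
      rw [this]
      simp
  rw [a1] at a2
  exact absurd a2 (by decide)

/-- The root e_i detects type B and 2e_i type C. Only D, on at least two indices, contains both e_j
+ e_k and e_j - e_k without containing these. -/
theorem IsBlock.type_unique {τ τ' : Fin 4} {I : Finset (Fin n)} (h : IsBlock Φ τ I)
    (h' : IsBlock Φ τ' I) : τ = τ' := by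
  obtain ⟨⟨i, hi⟩, hc, ε, hε⟩ := h
  obtain ⟨-, hc', ε', hε'⟩ := h'
  have hs : std τ I ε = std τ' I ε' := hε.symm.trans hε'
  have h1 : τ = 1 ↔ τ' = 1 := by
    rw [← e_mem_std_iff (ε := ε) hi, hs, e_mem_std_iff hi]
  have h2 : τ = 2 ↔ τ' = 2 := by
    rw [← double_mem_std_iff (ε := ε) hi, hs, double_mem_std_iff hi]
  have h30 : ∀ {ε ε' : Fin n → ℤˣ}, std 3 I ε = std 0 I ε' → ¬ 2 ≤ I.card := by
    intro ε ε' h hcard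
    obtain ⟨j, hj, k, hk, hjk⟩ := Finset.one_lt_card.1 hcard
    refine not_both_mem_setA (I := I) (ε := ε') hjk ?_ ?_
    · change _ ∈ std 0 I ε'
      rw [← h]
      exact ⟨j, hj, k, hk, hjk, 1, 1, by simp⟩
    · change _ ∈ std 0 I ε'
      rw [← h]
      exact ⟨j, hj, k, hk, hjk, 1, -1, by simp [sub_eq_add_neg]⟩
  fin_cases τ <;> fin_cases τ' <;> first
    | rfl
    | exact absurd (h1.1 rfl) (by decide)
    | exact absurd (h1.2 rfl) (by decide)
    | exact absurd (h2.1 rfl) (by decide)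
    | exact absurd (h2.2 rfl) (by decide)
    | exact absurd (hc rfl) (h30 hs)
    | exact absurd (hc' rfl) (h30 hs.symm)

end Standard

/-! ### Every index lies in a block -/

section Existence

theorem IsRootSystem.refl_mem {V : Type*} [NormedAddCommGroup V] [InnerProductSpace ℝ V]
    {Φ : Set V} (h : IsRootSystem Φ) {α β : V} (hα : α ∈ Φ) (hβ : β ∈ Φ) : refl α β ∈ Φ := by
  rw [refl_apply]
  exact h.reflect_mem α hα β hβ

theorem IsRootSystem.neg_mem {V : Type*} [NormedAddCommGroup V] [InnerProductSpace ℝ V]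
    {Φ : Set V} (h : IsRootSystem Φ) {α : V} (hα : α ∈ Φ) : -α ∈ Φ := by
  have h0 : inner ℝ α α ≠ 0 := fun h0 => h.zero_notMem (inner_self_eq_zero.1 h0 ▸ hα)
  have := h.reflect_mem α hα α hα
  rw [cusp, mul_div_assoc, div_self h0, mul_one, two_smul] at this
  simpa using this

theorem IsRootSystem.units_smul_mem (h : IsRootSystem Φ) {α : E n} (s : ℤˣ) (hα : α ∈ Φ) :
    s • α ∈ Φ := by
  rcases Int.units_eq_one_or s with rfl | rfl
  · rwa [one_smul]
  · rw [Units.neg_smul, one_smul]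
    exact h.neg_mem hα

theorem units_smul_mem_iff (h : IsRootSystem Φ) {α : E n} (s : ℤˣ) : s • α ∈ Φ ↔ α ∈ Φ := by
  refine ⟨fun hα => ?_, h.units_smul_mem s⟩
  have := h.units_smul_mem s hα
  rwa [smul_smul, Int.units_mul_self, one_smul] at this

theorem sp_units_smul (s : Fin n → ℤˣ) (σ : Equiv.Perm (Fin n)) (t : ℤˣ) (v : E n) :
    sp s σ (t • v) = t • sp s σ v := by
  rw [units_smul_eq, map_smul, units_smul_eq]

/-- The indices `i` and `j` are joined by a root `±(e_i - u e_j)`. -/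
def Link (Φ : Set (E n)) (i j : Fin n) (u : ℤˣ) : Prop := e i - u • e j ∈ Φ

theorem long_mem_iff (h : IsRootSystem Φ) {i j : Fin n} {s t : ℤˣ} :
    s • e i + t • e j ∈ Φ ↔ Link Φ i j (-(s * t)) := by
  have : e i - (-(s * t)) • e j = s • (s • e i + t • e j) := by
    rw [smul_add, smul_smul, smul_smul, Int.units_mul_self, one_smul, Units.neg_smul,
      sub_neg_eq_add]
  rw [Link, this, units_smul_mem_iff h]

theorem Link.symm (h : IsRootSystem Φ) {i j : Fin n} {u : ℤˣ} (hl : Link Φ i j u) :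
    Link Φ j i u := by
  have h1 : (1 : ℤˣ) • e i + (-u) • e j ∈ Φ := by
    rw [one_smul, Units.neg_smul, ← sub_eq_add_neg]; exact hl
  rw [add_comm, long_mem_iff h] at h1
  simpa using h1

/-- The reflection in the first root carries the second to the required root up to sign. -/
theorem Link.trans (h : IsRootSystem Φ) {i j k : Fin n} {u v : ℤˣ} (hij : i ≠ j) (hjk : j ≠ k)
    (hik : i ≠ k) (h1 : Link Φ i j u) (h2 : Link Φ j k v) : Link Φ i k (u * v) := by
  have h1' : (1 : ℤˣ) • e i + (-u) • e j ∈ Φ := by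
    rw [one_smul, Units.neg_smul, ← sub_eq_add_neg]; exact h1
  have h3 := h.refl_mem h1' h2
  rw [refl_long hij, map_sub, sp_units_smul, sp_e, sp_e, Equiv.swap_apply_right,
    Equiv.swap_apply_of_ne_of_ne hik.symm hjk.symm] at h3
  simp only [true_or, if_true, hik.symm, hjk.symm, or_false, if_false, one_mul, neg_neg,
    one_smul] at h3
  have h4 := h.units_smul_mem u h3
  rw [smul_sub, smul_smul, smul_smul, Int.units_mul_self, one_smul] at h4
  exact h4

/-- The reflection in ±e_i or ±2e_i reverses the i-th coordinate, so both signs occur. -/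
theorem Link.neg_of_short (h : IsRootSystem Φ) {i j : Fin n} {u : ℤˣ} (hij : i ≠ j) {α : E n}
    (hα : α ∈ Φ) (hr : refl α = sp (Pi.mulSingle i (-1)) 1) (hl : Link Φ i j u) :
    Link Φ i j (-u) := by
  have h3 := h.refl_mem hα hl
  rw [hr, map_sub, sp_units_smul, sp_e, sp_e, Equiv.Perm.one_apply, Equiv.Perm.one_apply,
    Pi.mulSingle_eq_same, Pi.mulSingle_eq_of_ne hij.symm, one_smul] at h3
  have h4 := h.neg_mem h3
  rw [Units.neg_smul, one_smul, sub_eq_add_neg, neg_add, neg_neg, neg_neg] at h4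
  rw [Link, Units.neg_smul, sub_neg_eq_add]
  exact h4

theorem Link.move (h : IsRootSystem Φ) {i j : Fin n} {u : ℤˣ} (hij : i ≠ j) (hl : Link Φ i j u)
    {c : ℝ} (hc : c • e j ∈ Φ) : c • e i ∈ Φ := by
  have h1' : (1 : ℤˣ) • e i + (-u) • e j ∈ Φ := by
    rw [one_smul, Units.neg_smul, ← sub_eq_add_neg]; exact hl
  have h3 := h.refl_mem h1' hc
  rw [refl_long hij, map_smul, sp_e, Equiv.swap_apply_right] at h3
  rw [smul_comm, units_smul_mem_iff h] at h3
  exact h3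

/-- The indices that are joined to `i`. -/
def component (Φ : Set (E n)) (i : Fin n) : Finset (Fin n) :=
  open Classical in Finset.univ.filter fun j => j = i ∨ ∃ u, Link Φ i j u

theorem mem_component {i j : Fin n} : j ∈ component Φ i ↔ j = i ∨ ∃ u, Link Φ i j u := by
  simp [component]

/-- Only direct links to i enter the definition of a component; transitivity turns it into a
complete graph. -/
theorem link_of_mem_component (h : IsRootSystem Φ) {i j k : Fin n} (hj : j ∈ component Φ i)
    (hk : k ∈ component Φ i) (hjk : j ≠ k) : ∃ u, Link Φ j k u := by
  rcases mem_component.1 hj with rfl | ⟨u, hu⟩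
  · exact (mem_component.1 hk).resolve_left hjk.symm
  rcases mem_component.1 hk with rfl | ⟨v, hv⟩
  · exact ⟨u, hu.symm h⟩
  by_cases hji : j = i
  · exact ⟨v, hji ▸ hv⟩
  by_cases hki : k = i
  · exact ⟨u, hki ▸ hu.symm h⟩
  exact ⟨_, (hu.symm h).trans h hji (fun e => hki e.symm) hjk hv⟩

theorem mem_component_of_link (h : IsRootSystem Φ) {i j k : Fin n} (hj : j ∈ component Φ i)
    (hjk : j ≠ k) {u : ℤˣ} (hl : Link Φ j k u) : k ∈ component Φ i := by
  by_cases hki : k = i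
  · exact mem_component.2 (Or.inl hki)
  rcases mem_component.1 hj with rfl | ⟨v, hv⟩
  · exact mem_component.2 (Or.inr ⟨u, hl⟩)
  by_cases hji : j = i
  · exact mem_component.2 (Or.inr ⟨u, hji ▸ hl⟩)
  exact mem_component.2 (Or.inr ⟨_, hv.trans h (fun e => hji e.symm) hjk (fun e => hki e.symm) hl⟩)

theorem meet_component_cases (h : IsRootSystem Φ) (hΦ : Φ ⊆ typeBC n) {i : Fin n} {α : E n}
    (hα : α ∈ meet Φ (component Φ i)) :
    (∃ j ∈ component Φ i, ∃ k ∈ component Φ i, j ≠ k ∧ ∃ s t : ℤˣ, α = s • e j + t • e k) ∨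
      (∃ j ∈ component Φ i, e j ∈ Φ ∧ ∃ s : ℤˣ, α = s • e j) ∨
      ∃ j ∈ component Φ i, (2 : ℝ) • e j ∈ Φ ∧ ∃ s : ℤˣ, α = s • (2 : ℝ) • e j := by
  obtain ⟨hα, j, hj, hne⟩ := hα
  rcases mem_typeBC.1 (hΦ hα) with hD | ⟨k, s, rfl⟩ | ⟨k, s, rfl⟩
  · left
    obtain ⟨k, l, hkl, s, t, rfl⟩ := mem_typeD.1 hD
    have hl := (long_mem_iff h).1 hα
    have : j = k ∨ j = l := by
      by_contra hjkl
      rw [not_or] at hjkl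
      apply hne
      simp [units_smul_apply, e_apply_of_ne hjkl.1, e_apply_of_ne hjkl.2]
    rcases this with rfl | rfl
    · exact ⟨j, hj, l, mem_component_of_link h hj hkl hl, hkl, s, t, rfl⟩
    · exact ⟨k, mem_component_of_link h hj hkl.symm (hl.symm h), j, hj, hkl, s, t, rfl⟩
  · right; left
    have : j = k := by
      by_contra hjk
      exact hne (by simp [units_smul_apply, e_apply_of_ne hjk])
    subst this
    exact ⟨j, hj, (units_smul_mem_iff h s).1 hα, s, rfl⟩
  · right; right
    have : j = k := by
      by_contra hjk
      exact hne (by simp [units_smul_apply, e_apply_of_ne hjk])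
    subst this
    exact ⟨j, hj, (units_smul_mem_iff h s).1 hα, s, rfl⟩

/-- If every pair in the component is linked with both signs (`full`), the component carries all of
D, and the roots proportional to some e_j decide between B, C and D; reducedness forbids e_j and
2e_j together. Otherwise every pair is linked with exactly one sign, these signs have the form ε_j
ε_k, and no root is proportional to an e_j: type A. -/
theorem exists_isBlock (h : IsReducedSub Φ (typeBC n)) (i : Fin n) :
    ∃ τ, IsBlock Φ τ (component Φ i) := by
  have hr := h.isRootSystem
  set J := component Φ i with hJ
  have hi : i ∈ J := mem_component.2 (Or.inl rfl)
  have hmem : ∀ {α : E n} {j : Fin n}, α ∈ Φ → j ∈ J → α j ≠ 0 → α ∈ meet Φ J :=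
    fun hα hj hne => ⟨hα, _, hj, hne⟩
  have hshort : ∀ {c : ℝ}, (∃ j ∈ J, c • e j ∈ Φ) → ∀ j ∈ J, c • e j ∈ Φ := by
    rintro c ⟨j, hj, hc⟩ k hk
    by_cases hjk : k = j
    · exact hjk ▸ hc
    obtain ⟨u, hu⟩ := link_of_mem_component hr hk hj hjk
    exact hu.move hr hjk hc
  have hred : ∀ j, e j ∈ Φ → (2 : ℝ) • e j ∉ Φ := by
    intro j h1 h2
    rcases h.isReduced _ h1 2 h2 with h3 | h3 <;> norm_num at h3
  have smulne : ∀ (s : ℤˣ) (c : ℝ) (j : Fin n), c ≠ 0 → (s • c • e j : E n) j ≠ 0 := by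
    intro s c j hc
    have := abs_cast_units s
    rw [units_smul_apply, PiLp.smul_apply, e_apply_self, smul_eq_mul, mul_one]
    exact mul_ne_zero (fun h0 => by simp [h0] at this) hc
  have nz : ∀ u : ℤˣ, ((u : ℤ) : ℝ) ≠ 0 := fun u h => by
    have := abs_cast_units u
    simp [h] at this
  have longne : ∀ (s t : ℤˣ) (j k : Fin n), j ≠ k → (s • e j + t • e k : E n) j ≠ 0 := by
    intro s t j k hjk
    simp [units_smul_apply, e_apply_of_ne hjk]
  by_cases full : ∀ j ∈ J, ∀ k ∈ J, j ≠ k → ∀ u, Link Φ j k u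
  · have hD : setD J ⊆ meet Φ J := by
      rintro _ ⟨j, hj, k, hk, hjk, s, t, rfl⟩
      exact hmem ((long_mem_iff hr).2 (full j hj k hk hjk _)) hj (longne s t j k hjk)
    by_cases hB : ∃ j ∈ J, e j ∈ Φ
    · have hB' : ∀ j ∈ J, e j ∈ Φ := by
        have := hshort (c := 1) (by simpa using hB)
        simpa using this
      refine ⟨1, ⟨i, hi⟩, fun h => absurd h (by decide), 1, Set.Subset.antisymm ?_ ?_⟩
      · intro α hα
        rcases meet_component_cases hr h.subset hα with hl | ⟨j, hj, -, s, rfl⟩ | ⟨j, hj, h2, -⟩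
        · exact Or.inl hl
        · exact Or.inr ⟨j, hj, s, rfl⟩
        · exact absurd h2 (hred j (hB' j hj))
      · rintro α (hα | ⟨j, hj, s, rfl⟩)
        · exact hD hα
        · refine hmem (hr.units_smul_mem s (hB' j hj)) hj ?_
          have := smulne s 1 j one_ne_zero
          rwa [one_smul] at this
    · by_cases hC : ∃ j ∈ J, (2 : ℝ) • e j ∈ Φ
      · have hC' := hshort hC
        refine ⟨2, ⟨i, hi⟩, fun h => absurd h (by decide), 1, Set.Subset.antisymm ?_ ?_⟩
        · intro α hα
          rcases meet_component_cases hr h.subset hα with hl | ⟨j, hj, h2, -⟩ | ⟨j, hj, -, s, rfl⟩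
          · exact Or.inl hl
          · exact absurd ⟨j, hj, h2⟩ hB
          · exact Or.inr ⟨j, hj, s, rfl⟩
        · rintro α (hα | ⟨j, hj, s, rfl⟩)
          · exact hD hα
          · exact hmem (hr.units_smul_mem s (hC' j hj)) hj (smulne s 2 j two_ne_zero)
      · have hsub : meet Φ J = setD J := by
          refine Set.Subset.antisymm ?_ hD
          intro α hα
          rcases meet_component_cases hr h.subset hα with hl | ⟨j, hj, h2, -⟩ | ⟨j, hj, h2, -⟩
          · exact hl
          · exact absurd ⟨j, hj, h2⟩ hB
          · exact absurd ⟨j, hj, h2⟩ hC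
        by_cases hcard : 2 ≤ J.card
        · exact ⟨3, ⟨i, hi⟩, fun _ => hcard, 1, hsub⟩
        -- A single index without a root of its own is the trivial block A_0.
        · refine ⟨0, ⟨i, hi⟩, fun h => absurd h (by decide), 1, hsub.trans ?_⟩
          have hone := Finset.card_le_one.1 (by omega : J.card ≤ 1)
          refine Set.Subset.antisymm ?_ setA_subset_setD
          rintro _ ⟨j, hj, k, hk, hjk, -⟩
          exact absurd (hone j hj k hk) hjk
  -- One double link at i would spread by transitivity to all pairs, against the failure of `full`.
  · have uniq : ∀ j u, i ≠ j → Link Φ i j u → ¬ Link Φ i j (-u) := by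
      intro j u hij h1 h2
      apply full
      have hij' : ∀ v, Link Φ i j v := by
        intro v
        rcases eq_or_ne v u with rfl | hne
        · exact h1
        · rwa [Int.units_ne_iff_eq_neg.1 hne]
      have step : ∀ k ∈ J, i ≠ k → ∀ v, Link Φ i k v := by
        intro k hk hik v
        by_cases hjk : j = k
        · exact hjk ▸ hij' v
        have hj : j ∈ J := mem_component.2 (Or.inr ⟨u, h1⟩)
        obtain ⟨w, hw⟩ := link_of_mem_component hr hj hk hjk
        have := (hij' (v * w)).trans hr hij hjk hik hw
        rwa [mul_assoc, Int.units_mul_self, mul_one] at this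
      intro k hk l hl hkl v
      by_cases hik : i = k
      · exact hik ▸ step l hl (hik ▸ hkl) v
      by_cases hil : i = l
      · exact (hil ▸ step k hk hik v).symm hr
      have := ((step k hk hik 1).symm hr).trans hr (Ne.symm hik) hil hkl (step l hl hil v)
      rwa [one_mul] at this
    classical
    -- The signs are normalised by ε i = 1, and ε j is then the sign of the link from i to j.
    let ε : Fin n → ℤˣ := fun j => if j = i then 1 else if Link Φ i j 1 then 1 else -1
    have hεi : ε i = 1 := if_pos rfl
    have hε : ∀ j ∈ J, i ≠ j → Link Φ i j (ε j) := by
      intro j hj hij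
      obtain ⟨u, hu⟩ := link_of_mem_component hr hi hj hij
      simp only [ε, if_neg hij.symm]
      rcases Int.units_eq_one_or u with rfl | rfl
      · rwa [if_pos hu]
      · rwa [if_neg fun h1 => uniq j 1 hij h1 hu]
    have hε2 : ∀ j ∈ J, ∀ k ∈ J, j ≠ k → ∀ u, Link Φ j k u ↔ u = ε j * ε k := by
      intro j hj k hk hjk u
      have base : ∀ k ∈ J, i ≠ k → ∀ u, Link Φ i k u ↔ u = ε k := by
        intro k hk hik u
        refine ⟨fun hu => ?_, fun hu => hu ▸ hε k hk hik⟩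
        by_contra hne
        rw [Int.units_ne_iff_eq_neg.1 hne] at hu
        exact uniq k _ hik (hε k hk hik) hu
      by_cases hij : i = j
      · subst hij
        rw [hεi, one_mul]
        exact base k hk hjk u
      by_cases hik : i = k
      · subst hik
        rw [hεi, mul_one, ← base j hj hjk.symm u]
        exact ⟨fun h => h.symm hr, fun h => h.symm hr⟩
      constructor
      · intro hu
        have h1 := (base k hk hik _).1 ((hε j hj hij).trans hr hij hjk hik hu)
        rw [← h1, ← mul_assoc, Int.units_mul_self, one_mul]
      · rintro rfl
        exact ((hε j hj hij).symm hr).trans hr (Ne.symm hij) hik hjk (hε k hk hik)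
    -- A root proportional to e_j would reverse the sign of a link at j and so create a double link.
    have noshort : ∀ (c : ℝ) (j : Fin n), j ∈ J → c • e j ∈ Φ →
        refl (c • e j : E n) = sp (Pi.mulSingle j (-1)) 1 → False := by
      intro c j hj hc hrefl
      apply full
      intro k hk l hl hkl
      obtain ⟨m, hm, hjm⟩ : ∃ m ∈ J, j ≠ m := by
        by_cases hjk : j = k
        · exact ⟨l, hl, hjk ▸ hkl⟩
        · exact ⟨k, hk, hjk⟩
      have h1 := (hε2 j hj m hm hjm _).2 rfl
      have h2 := (hε2 j hj m hm hjm _).1 (h1.neg_of_short hr hjm hc hrefl)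
      exact absurd h2 (Int.units_ne_iff_eq_neg.2 rfl)
    refine ⟨0, ⟨i, hi⟩, fun h => absurd h (by decide), ε, Set.Subset.antisymm ?_ ?_⟩
    · intro α hα
      rcases meet_component_cases hr h.subset hα with
        ⟨j, hj, k, hk, hjk, s, t, rfl⟩ | ⟨j, hj, h2, -⟩ | ⟨j, hj, h2, -⟩
      · have h1 := (hε2 j hj k hk hjk _).1 ((long_mem_iff hr).1 hα.1)
        rcases eq_or_ne s (ε j) with h2 | h2
        · refine ⟨j, hj, k, hk, hjk, ?_⟩
          have h3 : t = -ε k := by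
            rw [h2] at h1
            have := congrArg (ε j * ·) h1
            simp only [mul_neg, ← mul_assoc, Int.units_mul_self, one_mul] at this
            rw [← this, neg_neg]
          rw [h2, h3, Units.neg_smul, sub_eq_add_neg]
        · refine ⟨k, hk, j, hj, hjk.symm, ?_⟩
          have h2 := Int.units_ne_iff_eq_neg.1 h2
          have h3 : t = ε k := by
            rw [h2, neg_mul, neg_neg] at h1
            exact mul_left_cancel h1
          rw [h2, h3, Units.neg_smul, sub_eq_add_neg, add_comm]
      · exfalso
        refine noshort 1 j hj (by rwa [one_smul]) ?_
        rw [one_smul]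
        have := refl_short j 1
        rwa [one_smul] at this
      · exfalso
        refine noshort 2 j hj h2 ?_
        have := refl_double j 1
        rwa [one_smul] at this
    · rintro _ ⟨j, hj, k, hk, hjk, rfl⟩
      rw [sub_eq_add_neg, ← Units.neg_smul]
      refine hmem ((long_mem_iff hr).2 ((hε2 j hj k hk hjk _).2 ?_)) hj (longne _ _ j k hjk)
      simp

end Existence

end RootChar

end

noncomputable section

namespace RootChar

open MvPolynomial

variable {n : ℕ} {Φ : Set (E n)}

/-- The blocks of `Φ`, with their types. -/
def blocks (Φ : Set (E n)) : Finset (Fin 4 × Finset (Fin n)) :=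
  open Classical in Finset.univ.filter fun p => IsBlock Φ p.1 p.2

/-- The number of blocks of `Φ` of given type and size. -/
def blockCount (Φ : Set (E n)) (τ : Fin 4) (k : ℕ) : ℕ :=
  ((blocks Φ).filter fun p => p.1 = τ ∧ p.2.card = k).card

theorem mem_blocks {p : Fin 4 × Finset (Fin n)} : p ∈ blocks Φ ↔ IsBlock Φ p.1 p.2 := by
  simp [blocks]

theorem blocks_eq_of_mem {p q : Fin 4 × Finset (Fin n)} (hp : p ∈ blocks Φ) (hq : q ∈ blocks Φ)
    {i : Fin n} (hip : i ∈ p.2) (hiq : i ∈ q.2) : p = q := by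
  obtain ⟨τ, I⟩ := p
  obtain ⟨τ', J⟩ := q
  have hp := mem_blocks.1 hp
  have hq := mem_blocks.1 hq
  have hIJ : I = J := hp.eq_of_mem hq hip hiq
  subst hIJ
  exact Prod.ext (hp.type_unique hq) rfl

theorem blocks_pairwiseDisjoint :
    ((blocks Φ : Finset _) : Set (Fin 4 × Finset (Fin n))).PairwiseDisjoint Prod.snd := by
  intro p hp q hq hne
  rw [Function.onFun, Finset.disjoint_left]
  intro i hip hiq
  exact hne (blocks_eq_of_mem hp hq hip hiq)

theorem exists_mem_blocks (h : IsReducedSub Φ (typeBC n)) (i : Fin n) :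
    ∃ p ∈ blocks Φ, i ∈ p.2 := by
  obtain ⟨τ, hτ⟩ := exists_isBlock h i
  exact ⟨(τ, component Φ i), mem_blocks.2 hτ, mem_component.2 (Or.inl rfl)⟩

theorem biUnion_blocks (h : IsReducedSub Φ (typeBC n)) :
    (blocks Φ).biUnion Prod.snd = Finset.univ := by
  ext i
  simpa using (exists_mem_blocks h i)

/-! ### The product formula for the orbit polynomial -/

section Product

/-- The roots of `Φ` that are supported on `U`. -/
def inside (Φ : Set (E n)) (U : Finset (Fin n)) : Set (E n) := {α ∈ Φ | ∀ i ∉ U, α i = 0}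

theorem IsRootSystem.inside (h : IsRootSystem Φ) (U : Finset (Fin n)) :
    IsRootSystem (inside Φ U) where
  finite := h.finite.subset fun _ hx => hx.1
  zero_notMem h0 := h.zero_notMem h0.1
  reflect_mem α hα β hβ := by
    refine ⟨h.reflect_mem α hα.1 β hβ.1, fun i hi => ?_⟩
    simp [hα.2 i hi, hβ.2 i hi]
  integral α hα β hβ := h.integral α hα.1 β hβ.1

theorem exists_apply_ne_zero (h : IsRootSystem Φ) {α : E n} (hα : α ∈ Φ) : ∃ i, α i ≠ 0 := by
  by_contra! h0
  have : α = 0 := by ext i; exact h0 i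
  exact h.zero_notMem (this ▸ hα)

theorem IsBlock.inside_eq (h : IsRootSystem Φ) {τ : Fin 4} {I : Finset (Fin n)}
    (hI : IsBlock Φ τ I) : inside Φ I = meet Φ I := by
  ext α
  constructor
  · rintro ⟨hα, h0⟩
    obtain ⟨i, hi⟩ := exists_apply_ne_zero h hα
    exact ⟨hα, i, by_contra fun hiI => hi (h0 i hiI), hi⟩
  · intro hα
    obtain ⟨-, -, ε, hε⟩ := hI
    refine ⟨hα.1, fun i hi => ?_⟩
    rw [hε] at hα
    exact std_apply_eq_zero hα hi

theorem span_inside_apply {U : Finset (Fin n)} {v : E n}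
    (hv : v ∈ Submodule.span ℝ (inside Φ U)) {i : Fin n} (hi : i ∉ U) : v i = 0 := by
  induction hv using Submodule.span_induction with
  | mem x hx => exact hx.2 i hi
  | zero => simp
  | add x y _ _ hx hy => simp [hx, hy]
  | smul c x _ hx => simp [hx]

theorem evMap_charA_empty {f : E n →ₗ[ℝ] ℝ} : evMap (mono ∅) (charA f (∅ : Set (E n))) = 1 := by
  rw [evMap_charA_of_range (ι := Unit) _ f (F := fun _ => 1) (fun _ _ _ => rfl)]
  · simp [mono]
  · simp [weylGroup]

/-- Blocks have disjoint supports. Adding one block is thus an orthogonal union along which the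
monomial is multiplicative. -/
theorem evMap_charA_inside_biUnion (h : IsReducedSub Φ (typeBC n)) {f : E n →ₗ[ℝ] ℝ}
    (hf : ∀ α ∈ typeBC n, f α ≠ 0) (S : Finset (Fin 4 × Finset (Fin n))) (hS : S ⊆ blocks Φ) :
    evMap (mono (S.biUnion Prod.snd)) (charA f (inside Φ (S.biUnion Prod.snd))) =
      ∏ p ∈ S, factorPoly p.1 p.2.card := by
  classical
  have hr := h.isRootSystem
  induction S using Finset.induction_on with
  | empty =>
    have : inside Φ ∅ = ∅ := by
      ext α
      refine iff_of_false (fun hα => ?_) (Set.notMem_empty α)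
      obtain ⟨i, hi⟩ := exists_apply_ne_zero hr hα.1
      exact hi (hα.2 i (Finset.notMem_empty i))
    rw [Finset.biUnion_empty, this, evMap_charA_empty, Finset.prod_empty]
  | insert p S hpS ih =>
    have hp := hS (Finset.mem_insert_self p S)
    have hS' : S ⊆ blocks Φ := (Finset.subset_insert p S).trans hS
    have hb := mem_blocks.1 hp
    set U := S.biUnion Prod.snd with hU
    have hdisj : Disjoint p.2 U := by
      rw [hU, Finset.disjoint_biUnion_right]
      intro q hq
      exact blocks_pairwiseDisjoint hp (hS' hq) fun h => hpS (h ▸ hq)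
    have hunion : inside Φ (p.2 ∪ U) = inside Φ p.2 ∪ inside Φ U := by
      ext α
      constructor
      · rintro ⟨hα, h0⟩
        by_cases hm : ∃ i ∈ p.2, α i ≠ 0
        · left
          rw [hb.inside_eq hr]
          exact ⟨hα, hm⟩
        · right
          refine ⟨hα, fun i hi => ?_⟩
          by_cases hip : i ∈ p.2
          · exact by_contra fun h1 => hm ⟨i, hip, h1⟩
          · exact h0 i (by simp [hip, hi])
      · rintro (⟨hα, h0⟩ | ⟨hα, h0⟩)
        · exact ⟨hα, fun i hi => h0 i fun h1 => hi (Finset.mem_union_left _ h1)⟩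
        · exact ⟨hα, fun i hi => h0 i fun h1 => hi (Finset.mem_union_right _ h1)⟩
    have hortho : ∀ α ∈ inside Φ p.2, ∀ β ∈ inside Φ U, inner ℝ α β = 0 := by
      intro α hα β hβ
      rw [inner_eq_sum]
      refine Finset.sum_eq_zero fun i _ => ?_
      by_cases hip : i ∈ p.2
      · rw [hβ.2 i (Finset.disjoint_left.1 hdisj hip), mul_zero]
      · rw [hα.2 i hip, zero_mul]
    rw [Finset.biUnion_insert, hunion, Finset.prod_insert hpS, ← ih hS',
      evMap_charA_union (m₁ := mono p.2) (m₂ := mono U) (hr.inside _) (hr.inside _) hortho]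
    · congr 1
      rw [hb.inside_eq hr]
      obtain ⟨hne, h3, ε, hε⟩ := hb
      rw [hε]
      refine evMap_charA_std (fun _ => hne.card_pos) ?_ hf
      rw [← hε, ← (mem_blocks.1 hp).inside_eq hr]
      exact hr.inside _
    · intro v hv w hw
      rw [mono, Finset.prod_union hdisj, mono, mono]
      congr 1
      · refine Finset.prod_congr rfl fun i hi => ?_
        rw [PiLp.add_apply, span_inside_apply hw (Finset.disjoint_left.1 hdisj hi), add_zero]
      · refine Finset.prod_congr rfl fun i hi => ?_
        rw [PiLp.add_apply, span_inside_apply hv (Finset.disjoint_right.1 hdisj hi), zero_add]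

/-- The orbit polynomial of `A_Φ` is the product of the polynomials of the blocks of `Φ`. -/
theorem evMap_charA_eq_prod_blocks (h : IsReducedSub Φ (typeBC n)) {f : E n →ₗ[ℝ] ℝ}
    (hf : ∀ α ∈ Φ, f α ≠ 0) :
    evMap (mono Finset.univ) (charA f Φ) = ∏ p ∈ blocks Φ, factorPoly p.1 p.2.card := by
  -- The functional f is only known not to vanish on Φ, whereas the standard form of a block uses
  -- regularity on all of BC_n. The perturbation leaves A_Φ unchanged.
  obtain ⟨g, hg, hreg⟩ := exists_regular_perturbation h.isRootSystem.finite hf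
  rw [← charA_congr hg, ← evMap_charA_inside_biUnion h hreg _ subset_rfl, biUnion_blocks h]
  congr 2
  ext α
  simp [inside]

theorem prod_blocks {R : Type*} [CommMonoid R] (g : Fin 4 → ℕ → R) :
    ∏ p ∈ blocks Φ, g p.1 p.2.card =
      ∏ k ∈ Finset.Icc 1 n, ∏ τ, g τ k ^ blockCount Φ τ k := by
  rw [← Finset.prod_product' (Finset.Icc 1 n) Finset.univ fun k τ => g τ k ^ blockCount Φ τ k]
  rw [← Finset.prod_fiberwise_of_maps_to
    (g := fun p : Fin 4 × Finset (Fin n) => (p.2.card, p.1))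
    (t := Finset.Icc 1 n ×ˢ Finset.univ)]
  · refine Finset.prod_congr rfl fun q _ => ?_
    have : (blocks Φ).filter (fun p => (p.2.card, p.1) = q) =
        (blocks Φ).filter fun p => p.1 = q.2 ∧ p.2.card = q.1 := by
      refine Finset.filter_congr fun p _ => ?_
      rw [Prod.ext_iff, and_comm]
    rw [this, blockCount, ← Finset.prod_const]
    refine Finset.prod_congr rfl fun p hp => ?_
    rw [(Finset.mem_filter.1 hp).2.1, (Finset.mem_filter.1 hp).2.2]
  · intro p hp
    have := (mem_blocks.1 hp).1.card_pos
    have h2 := Finset.card_le_univ p.2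
    rw [Fintype.card_fin] at h2
    simp only [Finset.mem_product, Finset.mem_Icc, Finset.mem_univ, and_true]
    omega

theorem sum_blockCount (h : IsReducedSub Φ (typeBC n)) :
    ∑ k ∈ Finset.Icc 1 n, ∑ τ, k * blockCount Φ τ k = n := by
  have h1 : ∑ p ∈ blocks Φ, p.2.card = n := by
    rw [← Finset.card_biUnion blocks_pairwiseDisjoint, biUnion_blocks h]
    simp
  -- The multiplicative regrouping becomes additive in the exponents of 2.
  have h2 := prod_blocks (Φ := Φ) (fun _ k => 2 ^ k)
  simp only [← pow_mul, Finset.prod_pow_eq_pow_sum, h1] at h2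
  exact (Nat.pow_right_injective le_rfl h2).symm

theorem blockCount_eq_zero_of_lt (τ : Fin 4) {k : ℕ} (hk : n < k) : blockCount Φ τ k = 0 := by
  rw [blockCount, Finset.card_eq_zero, Finset.filter_eq_empty_iff]
  rintro p - ⟨-, h⟩
  have h2 := Finset.card_le_univ p.2
  rw [Fintype.card_fin] at h2
  omega

theorem blockCount_three_one : blockCount Φ 3 1 = 0 := by
  rw [blockCount, Finset.card_eq_zero, Finset.filter_eq_empty_iff]
  rintro p hp ⟨h3, h⟩
  have := (mem_blocks.1 hp).2.1 h3
  omega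

/-- When the orbit polynomials of two reduced subsystems of `BC_n` agree. -/
theorem evMap_charA_eq_iff {Φ' : Set (E n)} (h : IsReducedSub Φ (typeBC n))
    (h' : IsReducedSub Φ' (typeBC n)) {f : E n →ₗ[ℝ] ℝ} (hf : ∀ α ∈ Φ, f α ≠ 0)
    (hf' : ∀ α ∈ Φ', f α ≠ 0) :
    evMap (mono Finset.univ) (charA f Φ) = evMap (mono Finset.univ) (charA f Φ') ↔
      ∀ m < n, blockCount Φ 0 (2 * m + 2) = blockCount Φ' 0 (2 * m + 2) ∧
        blockCount Φ 1 (m + 1) = blockCount Φ' 1 (m + 1) ∧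
        blockCount Φ 0 (2 * m + 3) + blockCount Φ 2 (m + 1) =
          blockCount Φ' 0 (2 * m + 3) + blockCount Φ' 2 (m + 1) ∧
        blockCount Φ 0 (2 * m + 3) + blockCount Φ 3 (m + 2) =
          blockCount Φ' 0 (2 * m + 3) + blockCount Φ' 3 (m + 2) := by
  rw [evMap_charA_eq_prod_blocks h hf, evMap_charA_eq_prod_blocks h' hf', prod_blocks, prod_blocks]
  exact prod_factorPoly_eq_iff (fun τ k => blockCount_eq_zero_of_lt τ)
    (fun τ k => blockCount_eq_zero_of_lt τ) blockCount_three_one blockCount_three_one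
    (sum_blockCount h) (sum_blockCount h')

theorem blockCount_zero_one_eq {Φ' : Set (E n)} (h : IsReducedSub Φ (typeBC n))
    (h' : IsReducedSub Φ' (typeBC n))
    (hs : ∀ m < n, blockCount Φ 0 (2 * m + 2) = blockCount Φ' 0 (2 * m + 2) ∧
        blockCount Φ 1 (m + 1) = blockCount Φ' 1 (m + 1) ∧
        blockCount Φ 0 (2 * m + 3) + blockCount Φ 2 (m + 1) =
          blockCount Φ' 0 (2 * m + 3) + blockCount Φ' 2 (m + 1) ∧
        blockCount Φ 0 (2 * m + 3) + blockCount Φ 3 (m + 2) =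
          blockCount Φ' 0 (2 * m + 3) + blockCount Φ' 3 (m + 2)) :
    blockCount Φ 0 1 = blockCount Φ' 0 1 :=
  eq_zero_one_of_stages (fun τ _ => blockCount_eq_zero_of_lt τ)
    (fun τ _ => blockCount_eq_zero_of_lt τ) blockCount_three_one blockCount_three_one
    (sum_blockCount h) (sum_blockCount h') hs

end Product

/-! ### The counts of the statement as numbers of blocks -/

section Counts

theorem ncard_isBlock (Φ : Set (E n)) (τ : Fin 4) (k : ℕ) :
    Set.ncard {I : Finset (Fin n) | I.card = k ∧ IsBlock Φ τ I} = blockCount Φ τ k := by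
  classical
  have h : {I : Finset (Fin n) | I.card = k ∧ IsBlock Φ τ I} =
      (((blocks Φ).filter fun p => p.1 = τ ∧ p.2.card = k).image Prod.snd : Finset _) := by
    ext I
    simp only [Set.mem_ofPred_eq, Finset.coe_image, Set.mem_image, Finset.mem_coe,
      Finset.mem_filter, mem_blocks]
    constructor
    · rintro ⟨h1, h2⟩
      exact ⟨(τ, I), ⟨h2, rfl, h1⟩, rfl⟩
    · rintro ⟨⟨τ', J⟩, ⟨h1, rfl, h2⟩, rfl⟩
      exact ⟨h2, h1⟩
  rw [h, Set.ncard_coe_finset, Finset.card_image_of_injOn, blockCount]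
  rintro ⟨τ₁, I⟩ h1 ⟨τ₂, J⟩ h2 hIJ
  have h1 := (Finset.mem_filter.1 (Finset.mem_coe.1 h1)).2.1
  have h2 := (Finset.mem_filter.1 (Finset.mem_coe.1 h2)).2.1
  exact Prod.ext (h1.trans h2.symm) hIJ

theorem countA_eq {m : ℕ} (hm : 1 ≤ m) (Φ : Set (E n)) : countA m Φ = blockCount Φ 0 m := by
  rw [← ncard_isBlock, countA]
  congr 1
  ext I
  refine and_congr_right fun h => ?_
  exact ⟨fun h1 => ⟨Finset.card_pos.1 (by omega), fun h => absurd h (by decide), h1⟩,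
    fun h1 => h1.2.2⟩

theorem countB_eq {m : ℕ} (hm : 1 ≤ m) (Φ : Set (E n)) : countB m Φ = blockCount Φ 1 m := by
  rw [← ncard_isBlock, countB]
  congr 1
  ext I
  refine and_congr_right fun h => ?_
  exact ⟨fun h1 => ⟨Finset.card_pos.1 (by omega), fun h => absurd h (by decide), 1, h1⟩,
    fun h1 => h1.2.2.choose_spec⟩

theorem countC_eq {m : ℕ} (hm : 1 ≤ m) (Φ : Set (E n)) : countC m Φ = blockCount Φ 2 m := by
  rw [← ncard_isBlock, countC]
  congr 1
  ext I
  refine and_congr_right fun h => ?_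
  exact ⟨fun h1 => ⟨Finset.card_pos.1 (by omega), fun h => absurd h (by decide), 1, h1⟩,
    fun h1 => h1.2.2.choose_spec⟩

theorem countD_eq {m : ℕ} (hm : 2 ≤ m) (Φ : Set (E n)) : countD m Φ = blockCount Φ 3 m := by
  rw [← ncard_isBlock, countD]
  congr 1
  ext I
  refine and_congr_right fun h => ?_
  exact ⟨fun h1 => ⟨Finset.card_pos.1 (by omega), fun _ => by omega, 1, h1⟩,
    fun h1 => h1.2.2.choose_spec⟩

end Counts

/-! ### Subsystems with equal numbers of blocks -/

section Conjugacy

variable {Φ' : Set (E n)}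

theorem exists_blocks_equiv (h : ∀ τ k, blockCount Φ τ k = blockCount Φ' τ k) :
    ∃ κ : blocks Φ ≃ blocks Φ', ∀ p, (κ p).1.1 = p.1.1 ∧ (κ p).1.2.card = p.1.2.card := by
  classical
  let F : blocks Φ → Fin 4 × ℕ := fun p => (p.1.1, p.1.2.card)
  let F' : blocks Φ' → Fin 4 × ℕ := fun p => (p.1.1, p.1.2.card)
  have hcard : ∀ (Φ : Set (E n)) (c : Fin 4 × ℕ),
      Fintype.card {p : blocks Φ // ((p.1.1, p.1.2.card) : Fin 4 × ℕ) = c} =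
        blockCount Φ c.1 c.2 := by
    intro Φ c
    rw [Fintype.card_subtype, blockCount]
    refine Finset.card_bij (fun p _ => p.1) ?_ ?_ ?_
    · intro p hp
      have := (Finset.mem_filter.1 hp).2
      exact Finset.mem_filter.2 ⟨p.2, by rw [← this], by rw [← this]⟩
    · intro p _ q _ hpq
      exact Subtype.ext hpq
    · intro p hp
      obtain ⟨h1, h2, h3⟩ := Finset.mem_filter.1 hp
      exact ⟨⟨p, h1⟩, Finset.mem_filter.2 ⟨Finset.mem_univ _, Prod.ext h2 h3⟩, rfl⟩
  have he : ∀ c, Nonempty ({p : blocks Φ // F p = c} ≃ {p : blocks Φ' // F' p = c}) := by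
    intro c
    refine ⟨Fintype.equivOfCardEq ?_⟩
    exact (hcard Φ c).trans ((h _ _).trans (hcard Φ' c).symm)
  let κ : blocks Φ ≃ blocks Φ' := Equiv.ofFiberEquiv fun c => (he c).some
  refine ⟨κ, fun p => ?_⟩
  have := Equiv.ofFiberEquiv_map (fun c => (he c).some) p
  exact ⟨(Prod.ext_iff.1 this).1, (Prod.ext_iff.1 this).2⟩

/-- Subsystems with the same numbers of blocks are related by a signed permutation, whose signs
are governed by the signs of the blocks. -/
theorem exists_sp_image_subset (h : IsReducedSub Φ (typeBC n))
    {ε ε' : Finset (Fin n) → Fin n → ℤˣ}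
    (hε : ∀ p ∈ blocks Φ, meet Φ p.2 = std p.1 p.2 (ε p.2))
    (hε' : ∀ p ∈ blocks Φ', meet Φ' p.2 = std p.1 p.2 (ε' p.2))
    (hc : ∀ τ k, blockCount Φ τ k = blockCount Φ' τ k) :
    ∃ s σ, sp s σ '' Φ ⊆ Φ' ∧ ((∀ I, ε I = 1) → (∀ I, ε' I = 1) → s = 1) := by
  obtain ⟨κ, hκ⟩ := exists_blocks_equiv hc
  have hp : ∀ i, ∃ p : blocks Φ, i ∈ p.1.2 := fun i => by
    obtain ⟨p, hp, hi⟩ := exists_mem_blocks h i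
    exact ⟨⟨p, hp⟩, hi⟩
  choose P hP using hp
  have hPu : ∀ (p : blocks Φ) i, i ∈ p.1.2 → P i = p := fun p i hi =>
    Subtype.ext (blocks_eq_of_mem (P i).2 p.2 (hP i) hi)
  let β : ∀ p : blocks Φ, p.1.2 ≃ (κ p).1.2 := fun p => Finset.equivOfCardEq (hκ p).2.symm
  let b : ∀ p : blocks Φ, Fin n → Fin n := fun p i =>
    open Classical in if hi : i ∈ p.1.2 then (β p ⟨i, hi⟩ : Fin n) else i
  have hb : ∀ (p : blocks Φ) i, i ∈ p.1.2 → b p i ∈ (κ p).1.2 := by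
    intro p i hi
    simp only [b, dif_pos hi]
    exact (β p ⟨i, hi⟩).2
  have hbinj : ∀ (p : blocks Φ) i j, i ∈ p.1.2 → j ∈ p.1.2 → b p i = b p j → i = j := by
    intro p i j hi hj hij
    simp only [b, dif_pos hi, dif_pos hj] at hij
    exact congrArg Subtype.val ((β p).injective (Subtype.ext hij))
  have hinj : Function.Injective fun i => b (P i) i := by
    intro i j hij
    simp only at hij
    have h1 := hb (P i) i (hP i)
    have h2 := hb (P j) j (hP j)
    rw [← hij] at h2
    have h3 : P i = P j :=
      κ.injective (Subtype.ext (blocks_eq_of_mem (κ (P i)).2 (κ (P j)).2 h1 h2))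
    rw [← h3] at hij
    exact hbinj (P i) i j (hP i) (h3 ▸ hP j) hij
  let σ : Equiv.Perm (Fin n) := Equiv.ofBijective _ (Finite.injective_iff_bijective.1 hinj)
  have hσ : ∀ (p : blocks Φ) i, i ∈ p.1.2 → σ i ∈ (κ p).1.2 := by
    intro p i hi
    have : P i = p := hPu p i hi
    rw [← this]
    exact hb (P i) i (hP i)
  -- These signs carry ε_i e_i to ε'_{σ i} e_{σ i}, as blocks of type A require; the other types
  -- allow any signs.
  let s : Fin n → ℤˣ := fun j =>
    ε (P (σ.symm j)).1.2 (σ.symm j) * ε' (κ (P (σ.symm j))).1.2 j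
  have hs : ∀ (p : blocks Φ) i, i ∈ p.1.2 → s (σ i) = ε p.1.2 i * ε' (κ p).1.2 (σ i) := by
    intro p i hi
    simp only [s, Equiv.symm_apply_apply, hPu p i hi]
  refine ⟨s, σ, ?_, ?_⟩
  · rintro _ ⟨α, hα, rfl⟩
    obtain ⟨i, hi⟩ := exists_apply_ne_zero h.isRootSystem hα
    have hm : α ∈ meet Φ (P i).1.2 := ⟨hα, i, hP i, hi⟩
    generalize P i = p at hm
    have hmem : ∀ α ∈ std p.1.1 (κ p).1.2 (ε' (κ p).1.2), α ∈ Φ' := by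
      intro α hα
      have h1 := hε' (κ p).1 (κ p).2
      rw [(hκ p).1] at h1
      rw [← h1] at hα
      exact hα.1
    apply hmem
    rw [hε p.1 p.2] at hm
    have hD : ∀ {α}, α ∈ setD p.1.2 → sp s σ α ∈ setD (κ p).1.2 := by
      rintro _ ⟨j, hj, k, hk, hjk, u, t, rfl⟩
      refine ⟨σ j, hσ p j hj, σ k, hσ p k hk, σ.injective.ne hjk, u * s (σ j), t * s (σ k), ?_⟩
      rw [map_add, sp_units_smul, sp_units_smul, sp_e, sp_e, smul_smul, smul_smul]
    generalize hτ : p.1.1 = τ at hm ⊢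
    fin_cases τ
    · obtain ⟨j, hj, k, hk, hjk, rfl⟩ := hm
      refine ⟨σ j, hσ p j hj, σ k, hσ p k hk, σ.injective.ne hjk, ?_⟩
      rw [map_sub, sp_units_smul, sp_units_smul, sp_e, sp_e, smul_smul, smul_smul, hs p j hj,
        hs p k hk, ← mul_assoc, ← mul_assoc, Int.units_mul_self, Int.units_mul_self, one_mul,
        one_mul]
    · rcases hm with hm | ⟨j, hj, t, rfl⟩
      · exact Or.inl (hD hm)
      · refine Or.inr ⟨σ j, hσ p j hj, t * s (σ j), ?_⟩
        rw [sp_units_smul, sp_e, smul_smul]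
    · rcases hm with hm | ⟨j, hj, t, rfl⟩
      · exact Or.inl (hD hm)
      · refine Or.inr ⟨σ j, hσ p j hj, t * s (σ j), ?_⟩
        rw [sp_units_smul, map_smul, sp_e, smul_comm (2 : ℝ), smul_smul]
    · exact hD hm
  · intro h1 h2
    funext j
    simp [s, h1, h2]

/-- Inclusions in both directions between finite sets force equal cardinalities. The clause s = 1
serves type A, where the conjugating element has to be a permutation without signs. -/
theorem exists_sp_image_eq_of_signs (h : IsReducedSub Φ (typeBC n))
    (h' : IsReducedSub Φ' (typeBC n)) {ε ε' : Finset (Fin n) → Fin n → ℤˣ}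
    (hε : ∀ p ∈ blocks Φ, meet Φ p.2 = std p.1 p.2 (ε p.2))
    (hε' : ∀ p ∈ blocks Φ', meet Φ' p.2 = std p.1 p.2 (ε' p.2))
    (hc : ∀ τ k, blockCount Φ τ k = blockCount Φ' τ k) :
    ∃ s σ, sp s σ '' Φ = Φ' ∧ ((∀ I, ε I = 1) → (∀ I, ε' I = 1) → s = 1) := by
  obtain ⟨s, σ, h1, h2⟩ := exists_sp_image_subset h hε hε' hc
  obtain ⟨s', σ', h1', -⟩ := exists_sp_image_subset h' hε' hε fun τ k => (hc τ k).symm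
  refine ⟨s, σ, Set.eq_of_subset_of_ncard_le h1 ?_ h'.isRootSystem.finite, h2⟩
  have := Set.ncard_le_ncard h1' h.isRootSystem.finite
  rwa [Set.ncard_image_of_injective _ (sp s' σ').injective,
    ← Set.ncard_image_of_injective Φ (sp s σ).injective] at this

theorem exists_sp_image_eq (h : IsReducedSub Φ (typeBC n)) (h' : IsReducedSub Φ' (typeBC n))
    (hc : ∀ τ k, blockCount Φ τ k = blockCount Φ' τ k) : ∃ s σ, sp s σ '' Φ = Φ' := by
  have key : ∀ Φ : Set (E n), ∃ ε : Finset (Fin n) → Fin n → ℤˣ,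
      ∀ p ∈ blocks Φ, meet Φ p.2 = std p.1 p.2 (ε p.2) := by
    intro Φ
    have : ∀ I : Finset (Fin n), ∃ ε, ∀ τ, IsBlock Φ τ I → meet Φ I = std τ I ε := by
      intro I
      by_cases hI : ∃ τ, IsBlock Φ τ I
      · obtain ⟨τ, hτ⟩ := hI
        obtain ⟨ε, hε⟩ := hτ.2.2
        exact ⟨ε, fun τ' h' => hτ.type_unique h' ▸ hε⟩
      · exact ⟨1, fun τ h => absurd ⟨τ, h⟩ hI⟩
    choose ε hε using this
    exact ⟨ε, fun p hp => hε p.2 p.1 (mem_blocks.1 hp)⟩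
  obtain ⟨ε, hε⟩ := key Φ
  obtain ⟨ε', hε'⟩ := key Φ'
  obtain ⟨s, σ, h1, -⟩ := exists_sp_image_eq_of_signs h h' hε hε' hc
  exact ⟨s, σ, h1⟩

end Conjugacy

end RootChar

end

noncomputable section

namespace RootChar

open MvPolynomial

variable {n : ℕ}

/-! ### Signed permutations as automorphisms -/

section SignedPermutationGroup

theorem map_units_smul_equiv (g : E n ≃ₗ[ℝ] E n) (s : ℤˣ) (v : E n) : g (s • v) = s • g v := by
  rw [units_smul_eq, map_smul, units_smul_eq]

theorem ext_e {g h : E n ≃ₗ[ℝ] E n} (H : ∀ i, g (e i) = h (e i)) : g = h := by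
  ext v : 1
  have hv : v = ∑ i, v i • (e i : E n) := by
    ext j
    simp [e_apply]
  rw [hv]
  simp [H]

/-- A linear automorphism that permutes the coordinate axes without scaling is a signed
permutation. -/
theorem exists_eq_sp {g : E n ≃ₗ[ℝ] E n} (h : ∀ i, ∃ j, ∃ s : ℤˣ, g (e i) = s • e j) :
    ∃ s σ, g = sp s σ := by
  choose τ u hg using h
  have hinj : Function.Injective τ := by
    intro i j hij
    have h1 : g (u i • e i) = g (u j • e j) := by
      rw [map_units_smul_equiv, map_units_smul_equiv, hg, hg, hij, smul_smul, smul_smul,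
        Int.units_mul_self, Int.units_mul_self]
    exact (units_smul_e_inj (g.injective h1)).1
  let σ : Equiv.Perm (Fin n) := Equiv.ofBijective τ (Finite.injective_iff_bijective.1 hinj)
  refine ⟨fun j => u (σ.symm j), σ, ext_e fun i => ?_⟩
  rw [hg, sp_e, Equiv.symm_apply_apply]
  rfl

theorem mono_sp (s : Fin n → ℤˣ) (σ : Equiv.Perm (Fin n)) (v : E n) :
    mono Finset.univ (sp s σ v) = mono Finset.univ v := by
  rw [mono, mono, ← Equiv.prod_comp σ]
  refine Finset.prod_congr rfl fun i _ => ?_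
  rw [sp_apply, Equiv.symm_apply_apply, abs_mul, abs_cast_units, one_mul]

theorem sp_image_typeD (s : Fin n → ℤˣ) (σ : Equiv.Perm (Fin n)) :
    sp s σ '' typeD n = typeD n := by
  have key : ∀ (s : Fin n → ℤˣ) (σ : Equiv.Perm (Fin n)), sp s σ '' typeD n ⊆ typeD n := by
    rintro s σ _ ⟨α, hα, rfl⟩
    obtain ⟨i, j, hij, a, b, rfl⟩ := mem_typeD.1 hα
    refine mem_typeD.2 ⟨σ i, σ j, σ.injective.ne hij, a * s (σ i), b * s (σ j), ?_⟩
    rw [map_add, sp_units_smul, sp_units_smul, sp_e, sp_e, smul_smul, smul_smul]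
  exact Set.eq_of_subset_of_ncard_le (key s σ)
    (Set.ncard_image_of_injective _ (sp s σ).injective).ge typeD_finite

theorem sp_image_shorts (s : Fin n → ℤˣ) (σ : Equiv.Perm (Fin n)) (c : ℝ) :
    sp s σ '' {α | ∃ i, ∃ t : ℤˣ, α = t • c • e i} = {α | ∃ i, ∃ t : ℤˣ, α = t • c • e i} := by
  ext α
  constructor
  · rintro ⟨_, ⟨i, t, rfl⟩, rfl⟩
    refine ⟨σ i, t * s (σ i), ?_⟩
    rw [sp_units_smul, map_smul, sp_e, smul_comm c, smul_smul]
  · rintro ⟨i, t, rfl⟩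
    refine ⟨(t * s i) • c • e (σ.symm i), ⟨_, _, rfl⟩, ?_⟩
    rw [sp_units_smul, map_smul, sp_e, smul_comm c, smul_smul, Equiv.apply_symm_apply, mul_assoc,
      Int.units_mul_self, mul_one]

theorem sp_image_typeB (s : Fin n → ℤˣ) (σ : Equiv.Perm (Fin n)) :
    sp s σ '' typeB n = typeB n := by
  rw [typeB_eq, Set.image_union, sp_image_typeD, sp_image_shorts]

theorem sp_image_typeC (s : Fin n → ℤˣ) (σ : Equiv.Perm (Fin n)) :
    sp s σ '' typeC n = typeC n := by
  rw [typeC_eq, Set.image_union, sp_image_typeD, sp_image_shorts]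

theorem sp_image_typeBC (s : Fin n → ℤˣ) (σ : Equiv.Perm (Fin n)) :
    sp s σ '' typeBC n = typeBC n := by
  rw [typeBC, Set.image_union, sp_image_typeB, sp_image_typeC]

theorem sp_image_typeA (σ : Equiv.Perm (Fin n)) : sp 1 σ '' typeA n = typeA n := by
  ext α
  constructor
  · rintro ⟨_, hα, rfl⟩
    obtain ⟨i, j, hij, rfl⟩ := mem_typeA.1 hα
    refine mem_typeA.2 ⟨σ i, σ j, σ.injective.ne hij, ?_⟩
    rw [map_sub, sp_e, sp_e]
    simp
  · intro hα
    obtain ⟨i, j, hij, rfl⟩ := mem_typeA.1 hα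
    refine ⟨e (σ.symm i) - e (σ.symm j),
      mem_typeA.2 ⟨_, _, σ.symm.injective.ne hij, rfl⟩, ?_⟩
    rw [map_sub, sp_e, sp_e]
    simp

theorem sp_mem_autGroup {Ψ : Set (E n)} {s : Fin n → ℤˣ} {σ : Equiv.Perm (Fin n)}
    (h : sp s σ '' Ψ = Ψ) : sp s σ ∈ autGroup Ψ :=
  ⟨h, fun _ _ _ _ => cusp_sp _ _ _ _⟩

end SignedPermutationGroup

/-! ### Automorphisms of C_n, BC_n, B_n and D_n (n ≠ 4) are signed permutations -/

section Automorphisms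

variable {Ψ : Set (E n)} {g : E n ≃ₗ[ℝ] E n}

theorem autGroup_mem {V : Type*} [NormedAddCommGroup V] [InnerProductSpace ℝ V] {Ψ : Set V}
    {g : V ≃ₗ[ℝ] V} (hg : g ∈ autGroup Ψ) {α : V} (hα : α ∈ Ψ) : g α ∈ Ψ :=
  hg.1.subset (Set.mem_image_of_mem g hα)

theorem abs_long_apply_le {α : E n} (h : α ∈ typeD n) (i : Fin n) : |α i| ≤ 1 := by
  obtain ⟨j, k, hjk, s, t, rfl⟩ := mem_typeD.1 h
  simp only [PiLp.add_apply, units_smul_apply, e_apply]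
  have hs := abs_cast_units s
  have ht := abs_cast_units t
  split_ifs with h1 h2 h2
  · exact absurd (h1.symm.trans h2) hjk
  · simp [hs]
  · simp [ht]
  · simp

theorem eq_or_neg_of_units (s t : ℤˣ) (v : E n) : s • v = t • v ∨ s • v = -(t • v) := by
  rcases Int.units_eq_one_or s with rfl | rfl <;> rcases Int.units_eq_one_or t with rfl | rfl <;>
    simp

theorem long_ne_smul_e {i j k : Fin n} {s t u : ℤˣ} {c : ℝ} (hij : i ≠ j) :
    s • e i + t • e j ≠ (u • c • e k : E n) := fun h =>
  shorts_notMem_typeD (h ▸ mem_typeD.2 ⟨i, j, hij, s, t, rfl⟩)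

theorem smul_e_ne_long {i j k : Fin n} {s t : ℤˣ} {c : ℝ} (hij : i ≠ j) :
    c • e k ≠ (s • e i + t • e j : E n) := fun h =>
  long_ne_smul_e (s := s) (t := t) (u := 1) (c := c) (k := k) hij (by rw [one_smul]; exact h.symm)

theorem smul_e_ne_neg_long {i j k : Fin n} {s t : ℤˣ} {c : ℝ} (hij : i ≠ j) :
    c • e k ≠ -(s • e i + t • e j : E n) := fun h =>
  long_ne_smul_e (s := s) (t := t) (u := -1) (c := c) (k := k) hij
    (by rw [Units.neg_smul, one_smul, h, neg_neg])

theorem one_le_abs_two_mul (s : ℤˣ) : 2 ≤ |2 * ((s : ℤ) : ℝ)| := by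
  rw [abs_mul, abs_cast_units]; norm_num

/-- The roots `±2e_i` of `C_n` and `BC_n` are characterised by their cusp products. -/
theorem double_iff (hC : typeC n ⊆ Ψ) (hBC : Ψ ⊆ typeBC n) {α : E n} (hα : α ∈ Ψ) :
    (∃ i, ∃ s : ℤˣ, α = s • (2 : ℝ) • e i) ↔
      ∀ β ∈ Ψ, 2 ≤ |cusp β α| → β = α ∨ β = -α := by
  constructor
  · rintro ⟨i, s, rfl⟩ β hβ h
    rw [cusp_double, abs_mul, abs_cast_units, one_mul] at h
    rcases mem_typeBC.1 (hBC hβ) with h1 | ⟨j, t, rfl⟩ | ⟨j, t, rfl⟩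
    · have := abs_long_apply_le h1 i
      linarith
    · rw [units_smul_apply, abs_mul, abs_cast_units, one_mul, e_apply] at h
      split_ifs at h <;> norm_num at h
    · rw [units_smul_apply, abs_mul, abs_cast_units, one_mul, PiLp.smul_apply, e_apply] at h
      split_ifs at h with hij
      · subst hij
        exact eq_or_neg_of_units _ _ _
      · norm_num at h
  · intro h
    have hd : ∀ i, (2 : ℝ) • e i ∈ Ψ := fun i =>
      hC (mem_typeC.2 (Or.inr ⟨i, 1, by simp⟩))
    rcases mem_typeBC.1 (hBC hα) with h1 | ⟨i, s, rfl⟩ | h1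
    · exfalso
      obtain ⟨i, j, hij, s, t, rfl⟩ := mem_typeD.1 h1
      have h2 := h _ (hd i) (by
        rw [cusp_long hij]
        simp only [PiLp.smul_apply, e_apply_self, e_apply_of_ne hij.symm, smul_eq_mul]
        have := one_le_abs_two_mul s
        rwa [mul_one, mul_zero, mul_zero, add_zero, mul_comm])
      rcases h2 with h2 | h2
      · exact smul_e_ne_long hij h2
      · exact smul_e_ne_neg_long hij h2
    · exfalso
      have h2 := h _ (hd i) (by
        rw [cusp_short, PiLp.smul_apply, e_apply_self]
        have := one_le_abs_two_mul s
        rw [smul_eq_mul, mul_one, ← mul_assoc, abs_mul, abs_two]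
        linarith)
      have hi : (2 : ℝ) = |((2 : ℝ) • e i : E n) i| := by simp
      rcases h2 with h2 | h2
      · rw [h2, units_smul_apply, e_apply_self, mul_one, abs_cast_units] at hi
        norm_num at hi
      · rw [h2, PiLp.neg_apply, abs_neg, units_smul_apply, e_apply_self, mul_one,
          abs_cast_units] at hi
        norm_num at hi
    · exact h1

/-- Automorphisms preserve cusp products, and `double_iff` describes the roots ±2e_i by these alone.
So the coordinate axes are permuted without scaling. -/
theorem autGroup_typeC_or_typeBC (hC : typeC n ⊆ Ψ) (hBC : Ψ ⊆ typeBC n) (hg : g ∈ autGroup Ψ) :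
    ∃ s σ, g = sp s σ := by
  refine exists_eq_sp fun i => ?_
  have hd : (2 : ℝ) • e i ∈ Ψ := hC (mem_typeC.2 (Or.inr ⟨i, 1, by simp⟩))
  have h1 := (double_iff hC hBC hd).1 ⟨i, 1, by simp⟩
  have h2 : ∃ j, ∃ s : ℤˣ, g ((2 : ℝ) • e i) = s • (2 : ℝ) • e j := by
    refine (double_iff hC hBC (autGroup_mem hg hd)).2 ?_
    intro β hβ h
    rw [← hg.1] at hβ
    obtain ⟨γ, hγ, rfl⟩ := hβ
    rw [hg.2 γ hγ _ hd] at h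
    rw [← map_neg]
    exact (h1 γ hγ h).imp (congrArg g) (congrArg g)
  obtain ⟨j, s, h⟩ := h2
  refine ⟨j, s, ?_⟩
  rw [map_smul, smul_comm s] at h
  exact smul_right_injective (E n) two_ne_zero h

/-- The short roots of `B_n` are characterised by their cusp products. -/
theorem short_iff {α : E n} (hα : α ∈ typeB n) :
    (∃ i, ∃ s : ℤˣ, α = s • e i) ↔
      ∀ β ∈ typeB n, 2 ≤ |cusp α β| → β = α ∨ β = -α := by
  constructor
  · rintro ⟨i, s, rfl⟩ β hβ h
    rcases mem_typeB.1 hβ with h1 | ⟨j, t, rfl⟩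
    · obtain ⟨j, k, hjk, a, b, rfl⟩ := mem_typeD.1 h1
      exfalso
      rw [cusp_long hjk] at h
      simp only [units_smul_apply, e_apply] at h
      have hs := abs_cast_units s
      have ha := abs_cast_units a
      have hb := abs_cast_units b
      split_ifs at h with h2 h3 h3
      · exact hjk (h2.trans h3.symm)
      · simp [abs_mul, hs, ha] at h
      · simp [abs_mul, hs, hb] at h
      · norm_num at h
    · rw [cusp_short, units_smul_apply, e_apply] at h
      split_ifs at h with hij
      · subst hij
        exact eq_or_neg_of_units _ _ _
      · norm_num at h
  · intro h
    have hd : ∀ i, e i ∈ typeB n := fun i => mem_typeB.2 (Or.inr ⟨i, 1, by simp⟩)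
    rcases mem_typeB.1 hα with h1 | h1
    · exfalso
      obtain ⟨i, j, hij, s, t, rfl⟩ := mem_typeD.1 h1
      have h2 := h _ (hd i) (by
        have h3 := cusp_short 1 i (s • e i + t • e j)
        rw [one_smul] at h3
        rw [h3]
        simp only [PiLp.add_apply, units_smul_apply, e_apply_self, e_apply_of_ne hij]
        have := one_le_abs_two_mul s
        simpa using this)
      rcases h2 with h2 | h2
      · exact smul_e_ne_long (c := 1) hij (by rw [one_smul]; exact h2)
      · exact smul_e_ne_neg_long (c := 1) hij (by rw [one_smul]; exact h2)
    · exact h1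

theorem autGroup_typeB (hg : g ∈ autGroup (typeB n)) : ∃ s σ, g = sp s σ := by
  refine exists_eq_sp fun i => ?_
  have hd : e i ∈ typeB n := mem_typeB.2 (Or.inr ⟨i, 1, by simp⟩)
  have h1 := (short_iff hd).1 ⟨i, 1, by simp⟩
  refine (short_iff (autGroup_mem hg hd)).2 ?_
  intro β hβ h
  rw [← hg.1] at hβ
  obtain ⟨γ, hγ, rfl⟩ := hβ
  rw [hg.2 _ hd γ hγ] at h
  rw [← map_neg]
  exact (h1 γ hγ h).imp (congrArg g) (congrArg g)

/-- With only one common index the cusp product would be ±1. Hence both indices agree, and in the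
sum one coordinate cancels. -/
theorem add_eq_double_of_orthogonal {i j l : Fin n} (hij : i ≠ j) (hil : i ≠ l) {a b c d : ℤˣ}
    (h : cusp (a • e i + b • e j) (c • e i + d • e l : E n) = 0) :
    ∃ m, ∃ s : ℤˣ, a • e i + b • e j + (c • e i + d • e l) = (s • (2 : ℝ) • e m : E n) := by
  rw [cusp_long hil] at h
  simp only [PiLp.add_apply, units_smul_apply, e_apply_self, e_apply_of_ne hij,
    e_apply_of_ne hil.symm] at h
  by_cases hjl : j = l
  · subst hjl
    rcases Int.units_eq_one_or a with rfl | rfl <;> rcases Int.units_eq_one_or b with rfl | rfl <;>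
      rcases Int.units_eq_one_or c with rfl | rfl <;>
      rcases Int.units_eq_one_or d with rfl | rfl <;> norm_num at h
    · exact ⟨i, 1, by simp [two_smul]; abel⟩
    · exact ⟨j, 1, by simp [two_smul]; abel⟩
    · exact ⟨i, 1, by simp [two_smul]; abel⟩
    · exact ⟨j, -1, by simp [two_smul]; abel⟩
    · exact ⟨j, 1, by simp [two_smul]; abel⟩
    · exact ⟨i, -1, by simp [two_smul]; abel⟩
    · exact ⟨j, -1, by simp [two_smul]; abel⟩
    · exact ⟨i, -1, by simp [two_smul]; abel⟩
  · exfalso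
    rw [e_apply_of_ne (Ne.symm hjl)] at h
    simp only [mul_one, mul_zero, add_zero] at h
    have h2 := congrArg abs h
    rw [abs_mul, abs_cast_units, abs_cast_units] at h2
    norm_num at h2

/-- Apart from `n = 4`, two orthogonal roots of `D_n` that have the same inner products modulo `2`
with all roots add up to some `±2e_i`. -/
theorem add_eq_double_of_parity (hn : n ≠ 4) {α β : E n} (hα : α ∈ typeD n) (hβ : β ∈ typeD n)
    (ho : cusp α β = 0) (hp : ∀ γ ∈ typeD n, ∃ k : ℤ, cusp γ α - cusp γ β = 2 * k) :
    ∃ m, ∃ s : ℤˣ, α + β = s • (2 : ℝ) • e m := by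
  obtain ⟨i, j, hij, a, b, rfl⟩ := mem_typeD.1 hα
  obtain ⟨k, l, hkl, c, d, rfl⟩ := mem_typeD.1 hβ
  by_cases hik : i = k
  · subst hik
    exact add_eq_double_of_orthogonal hij hkl ho
  by_cases hil : i = l
  · subst hil
    rw [add_comm (c • e k)] at ho ⊢
    exact add_eq_double_of_orthogonal hij hkl.symm ho
  by_cases hjk : j = k
  · subst hjk
    rw [add_comm (a • e i)] at ho ⊢
    exact add_eq_double_of_orthogonal hij.symm hkl ho
  by_cases hjl : j = l
  · subst hjl
    rw [add_comm (a • e i), add_comm (c • e k)] at ho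
    rw [add_comm (a • e i), add_comm (c • e k)]
    exact add_eq_double_of_orthogonal hij.symm hkl.symm ho
  exfalso
  have hcard : ({i, j, k, l} : Finset (Fin n)).card = 4 := by
    rw [Finset.card_insert_of_notMem, Finset.card_insert_of_notMem, Finset.card_insert_of_notMem,
      Finset.card_singleton] <;> simp [*]
  have hle : 4 ≤ n := by
    have := Finset.card_le_univ ({i, j, k, l} : Finset (Fin n))
    rwa [hcard, Fintype.card_fin] at this
  -- This is where n ≠ 4 enters: for an index m outside both supports, e_i + e_m pairs to ±1 with
  -- the first root and to 0 with the second, against the parity hypothesis.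
  obtain ⟨m, hm⟩ : ∃ m, m ∉ ({i, j, k, l} : Finset (Fin n)) := by
    by_contra! h
    have : ({i, j, k, l} : Finset (Fin n)) = Finset.univ := Finset.eq_univ_iff_forall.2 h
    rw [this, Finset.card_univ, Fintype.card_fin] at hcard
    omega
  simp only [Finset.mem_insert, Finset.mem_singleton, not_or] at hm
  obtain ⟨hmi, hmj, hmk, hml⟩ := hm
  obtain ⟨z, hz⟩ := hp _ (add_mem_typeD (Ne.symm hmi))
  rw [cusp_long hij, cusp_long hkl] at hz
  simp only [PiLp.add_apply, e_apply_self, e_apply_of_ne hij.symm, e_apply_of_ne (Ne.symm hmi),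
    e_apply_of_ne (Ne.symm hmj), e_apply_of_ne (Ne.symm hmk), e_apply_of_ne (Ne.symm hml),
    e_apply_of_ne (Ne.symm hik), e_apply_of_ne (Ne.symm hil)] at hz
  have hz' : (a : ℤ) = 2 * z := by
    have : ((a : ℤ) : ℝ) = 2 * z := by linarith
    exact_mod_cast this
  rcases Int.units_eq_one_or a with rfl | rfl <;> simp at hz' <;> omega

/-- The orthogonal roots e_i + e_j and e_i - e_j have cusp products with any γ that differ by 2γ_j,
an even number. This property passes to their images, whose sum g(2e_i) is therefore some ±2e_m. -/
theorem autGroup_typeD (hn : 3 ≤ n) (hn4 : n ≠ 4) (hg : g ∈ autGroup (typeD n)) :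
    ∃ s σ, g = sp s σ := by
  refine exists_eq_sp fun i => ?_
  obtain ⟨j, hij⟩ : ∃ j : Fin n, i ≠ j := by
    have : Nontrivial (Fin n) := Fin.nontrivial_iff_two_le.2 (by omega)
    obtain ⟨j, hj⟩ := exists_ne i
    exact ⟨j, hj.symm⟩
  have hα := add_mem_typeD hij
  have hβ := sub_mem_typeD hij
  have cα : ∀ γ : E n, cusp γ (e i + e j) = γ i + γ j := by
    intro γ
    have := cusp_long hij 1 1 γ
    simpa using this
  have cβ : ∀ γ : E n, cusp γ (e i - e j) = γ i - γ j := by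
    intro γ
    have := cusp_long hij 1 (-1) γ
    simpa [← sub_eq_add_neg] using this
  obtain ⟨m, s, h⟩ := add_eq_double_of_parity hn4 (autGroup_mem hg hα) (autGroup_mem hg hβ)
    (by
      rw [hg.2 _ hα _ hβ, cβ]
      simp [e_apply_of_ne hij, e_apply_of_ne hij.symm])
    (by
      intro γ hγ
      rw [← hg.1] at hγ
      obtain ⟨γ, hγ, rfl⟩ := hγ
      rw [hg.2 _ hγ _ hα, hg.2 _ hγ _ hβ, cα, cβ]
      obtain ⟨k, l, hkl, a, b, rfl⟩ := mem_typeD.1 hγ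
      refine ⟨a * (if j = k then 1 else 0) + b * (if j = l then 1 else 0), ?_⟩
      simp only [PiLp.add_apply, units_smul_apply, e_apply]
      push_cast
      ring)
  refine ⟨m, s, ?_⟩
  rw [← map_add, add_add_sub_cancel, ← two_smul ℝ, map_smul, smul_comm s] at h
  exact smul_right_injective (E n) two_ne_zero h

end Automorphisms

/-! ### Spanning sets -/

section Spans

theorem span_eq_top_of_e_mem {S : Submodule ℝ (E n)} (h : ∀ i, e i ∈ S) : S = ⊤ := by
  rw [eq_top_iff]
  intro v _
  have hv : v = ∑ i, v i • (e i : E n) := by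
    ext j
    simp [e_apply]
  rw [hv]
  exact Submodule.sum_mem _ fun i _ => Submodule.smul_mem _ _ (h i)

theorem span_typeB : Submodule.span ℝ (typeB n) = ⊤ :=
  span_eq_top_of_e_mem fun i => Submodule.subset_span (mem_typeB.2 (Or.inr ⟨i, 1, by simp⟩))

theorem span_eq_top_of_typeC_subset {Ψ : Set (E n)} (h : typeC n ⊆ Ψ) :
    Submodule.span ℝ Ψ = ⊤ := by
  refine span_eq_top_of_e_mem fun i => ?_
  have h1 : (2 : ℝ) • e i ∈ Submodule.span ℝ Ψ :=
    Submodule.subset_span (h (mem_typeC.2 (Or.inr ⟨i, 1, by simp⟩)))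
  have h2 := Submodule.smul_mem _ (1 / 2 : ℝ) h1
  rw [smul_smul] at h2
  norm_num at h2
  exact h2

theorem span_typeD (hn : 2 ≤ n) : Submodule.span ℝ (typeD n) = ⊤ := by
  refine span_eq_top_of_e_mem fun i => ?_
  obtain ⟨j, hij⟩ : ∃ j : Fin n, i ≠ j := by
    have : Nontrivial (Fin n) := Fin.nontrivial_iff_two_le.2 hn
    obtain ⟨j, hj⟩ := exists_ne i
    exact ⟨j, hj.symm⟩
  have h1 := Submodule.add_mem _ (Submodule.subset_span (R := ℝ) (add_mem_typeD hij))
    (Submodule.subset_span (R := ℝ) (sub_mem_typeD hij))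
  have h2 := Submodule.smul_mem _ (1 / 2 : ℝ) h1
  rw [add_add_sub_cancel, ← two_smul ℝ, smul_smul] at h2
  norm_num at h2
  exact h2

end Spans

/-! ### The criterion when all automorphisms are signed permutations -/

section HyperoctahedralCase

/-- The exponent vector of the monomial `mono univ v`. -/
def expo (v : E n) : ℝ →₀ ℕ := ∑ i, Finsupp.single |v i| 1

theorem mono_eq_monomial (v : E n) : mono Finset.univ v = monomial (expo v) (1 : ℚ) := by
  rw [mono, expo, MvPolynomial.monomial_sum_one]
  rfl

/-- Equal exponents mean equal multisets of absolute values: a permutation matches them, and signs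
correct the rest. -/
theorem exists_sp_apply_eq {v w : E n} (h : expo v = expo w) : ∃ s σ, sp s σ v = w := by
  classical
  have hcard : ∀ (v : E n) (r : ℝ), expo v r = Fintype.card {i // |v i| = r} := by
    intro v r
    rw [expo, Finsupp.finsetSum_apply, Fintype.card_subtype, Finset.card_filter]
    exact Finset.sum_congr rfl fun i _ => Finsupp.single_apply
  have hne : ∀ r, Nonempty ({i // |v i| = r} ≃ {i // |w i| = r}) := fun r =>
    ⟨Fintype.equivOfCardEq (by rw [← hcard, ← hcard, h])⟩
  let σ : Equiv.Perm (Fin n) := Equiv.ofFiberEquiv fun r => (hne r).some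
  have hσ : ∀ i, |w (σ i)| = |v i| := Equiv.ofFiberEquiv_map fun r => (hne r).some
  have hs : ∀ j, ∃ u : ℤˣ, ((u : ℤ) : ℝ) * v (σ.symm j) = w j := by
    intro j
    have := hσ (σ.symm j)
    rw [Equiv.apply_symm_apply] at this
    rcases abs_eq_abs.1 this with h1 | h1
    · exact ⟨1, by simp [h1]⟩
    · exact ⟨-1, by simp [h1]⟩
  choose s hs using hs
  refine ⟨s, σ, ?_⟩
  ext j
  rw [sp_apply, hs]

/-- The monomial is invariant under the automorphisms, and since every signed permutation is an
automorphism it also separates their orbits. -/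
theorem charF_eq_iff {Ψ Φ₁ Φ₂ : Set (E n)} (hfin : Ψ.Finite) (hspan : Submodule.span ℝ Ψ = ⊤)
    (hg : ∀ g ∈ autGroup Ψ, ∃ s σ, g = sp s σ) (hsp : ∀ s σ, sp s σ '' Ψ = Ψ)
    (f : E n →ₗ[ℝ] ℝ) :
    charF (autGroup Ψ) f Φ₁ = charF (autGroup Ψ) f Φ₂ ↔
      evMap (mono Finset.univ) (charA f Φ₁) = evMap (mono Finset.univ) (charA f Φ₂) := by
  have := finite_autGroup hfin hspan
  constructor
  · intro h
    have hm : ∀ g ∈ autGroup Ψ, ∀ v, mono Finset.univ (g v) = mono Finset.univ v := by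
      intro g hg' v
      obtain ⟨s, σ, rfl⟩ := hg g hg'
      exact mono_sp s σ v
    rw [← evMap_charF hm, ← evMap_charF hm, h]
  · intro h
    rw [show mono (n := n) Finset.univ = fun v => monomial (expo v) (1 : ℚ) from
      funext mono_eq_monomial] at h
    refine charF_eq_of_evMap_eq ?_ h
    intro v w hvw
    obtain ⟨s, σ, h⟩ := exists_sp_apply_eq hvw
    exact ⟨_, sp_mem_autGroup (hsp s σ), h⟩

/-- The coincidences of characters in types `C` and `BC`. -/
theorem charF_eq_iff_counts {Ψ : Set (E n)} (hΨ : Ψ = typeC n ∨ Ψ = typeBC n)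
    {f : E n →ₗ[ℝ] ℝ} (hf : ∀ α ∈ Ψ, f α ≠ 0) {Φ₁ Φ₂ : Set (E n)} (h₁ : IsReducedSub Φ₁ Ψ)
    (h₂ : IsReducedSub Φ₂ Ψ) :
    charF (autGroup Ψ) f Φ₁ = charF (autGroup Ψ) f Φ₂ ↔
      ∀ m : ℕ, 1 ≤ m → m ≤ n →
        (countB m Φ₁ : ℤ) - countB m Φ₂ = 0 ∧
        (countA (2 * m) Φ₁ : ℤ) - countA (2 * m) Φ₂ = 0 ∧
        (countA (2 * m + 1) Φ₁ : ℤ) - countA (2 * m + 1) Φ₂ =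
          (countC m Φ₂ : ℤ) - countC m Φ₁ ∧
        (countC m Φ₂ : ℤ) - countC m Φ₁ =
          (countD (m + 1) Φ₂ : ℤ) - countD (m + 1) Φ₁ := by
  have hC : typeC n ⊆ Ψ := by
    rcases hΨ with rfl | rfl
    · exact subset_rfl
    · exact Set.subset_union_right
  have hBC : Ψ ⊆ typeBC n := by
    rcases hΨ with rfl | rfl
    · exact Set.subset_union_right
    · exact subset_rfl
  have hsp : ∀ s σ, sp s σ '' Ψ = Ψ := by
    rcases hΨ with rfl | rfl
    · exact sp_image_typeC
    · exact sp_image_typeBC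
  have r₁ : IsReducedSub Φ₁ (typeBC n) := ⟨h₁.1, h₁.2, h₁.3.trans hBC⟩
  have r₂ : IsReducedSub Φ₂ (typeBC n) := ⟨h₂.1, h₂.2, h₂.3.trans hBC⟩
  rw [charF_eq_iff (typeBC_finite.subset hBC) (span_eq_top_of_typeC_subset hC)
    (fun g hg => autGroup_typeC_or_typeBC hC hBC hg) hsp,
    evMap_charA_eq_iff r₁ r₂ (fun α hα => hf α (h₁.3 hα)) (fun α hα => hf α (h₂.3 hα))]
  constructor
  · intro h m hm hmn
    obtain ⟨m, rfl⟩ := Nat.exists_eq_add_of_le' hm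
    obtain ⟨e1, e2, e3, e4⟩ := h m (by omega)
    rw [countA_eq (by omega), countA_eq (by omega), countA_eq (by omega), countA_eq (by omega),
      countB_eq hm, countB_eq hm, countC_eq hm, countC_eq hm, countD_eq (by omega),
      countD_eq (by omega), show 2 * (m + 1) = 2 * m + 2 by ring,
      show 2 * m + 2 + 1 = 2 * m + 3 by ring, show m + 1 + 1 = m + 2 by ring]
    omega
  · intro h m hm
    have := h (m + 1) (by omega) hm
    rw [countA_eq (by omega), countA_eq (by omega), countA_eq (by omega), countA_eq (by omega),
      countB_eq (by omega), countB_eq (by omega), countC_eq (by omega), countC_eq (by omega),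
      countD_eq (by omega), countD_eq (by omega), show 2 * (m + 1) = 2 * m + 2 by ring,
      show 2 * m + 2 + 1 = 2 * m + 3 by ring, show m + 1 + 1 = m + 2 by ring] at this
    omega

end HyperoctahedralCase

end RootChar

end

noncomputable section

namespace RootChar

/-! ### Isomorphisms of root systems as linear maps -/

section Transport

variable {V W : Type*} [NormedAddCommGroup V] [InnerProductSpace ℝ V]
  [NormedAddCommGroup W] [InnerProductSpace ℝ W] {Ψ Φ : Set V} {Ψ' : Set W}

/-- The coroot functional `v ↦ ⟨v, α⟩`. -/
def coroot (α : V) : V →ₗ[ℝ] ℝ := (2 / inner ℝ α α) • innerₗ V α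

theorem coroot_apply (α v : V) : coroot α v = cusp v α := by
  simp only [coroot, cusp, LinearMap.smul_apply, innerₗ_apply_apply, smul_eq_mul]
  ring

theorem eq_zero_of_cusp_eq_zero (h0 : 0 ∉ Ψ) {v : V} (hv : v ∈ Submodule.span ℝ Ψ)
    (h : ∀ α ∈ Ψ, cusp v α = 0) : v = 0 := by
  have key : ∀ w ∈ Submodule.span ℝ Ψ, inner ℝ w v = 0 := by
    intro w hw
    induction hw using Submodule.span_induction with
    | mem α hα =>
      have h1 := h α hα
      have h2 : inner ℝ α α ≠ 0 := fun h2 => h0 (inner_self_eq_zero.1 h2 ▸ hα)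
      rw [cusp, div_eq_zero_iff] at h1
      have := h1.resolve_right h2
      linarith
    | zero => simp
    | add x y _ _ hx hy => rw [inner_add_left, hx, hy, add_zero]
    | smul c x _ hx => rw [real_inner_smul_left, hx, mul_zero]
  exact inner_self_eq_zero.1 (key v hv)

/-- An isomorphism of root systems is induced by a linear map. -/
theorem exists_linearMap_of_iso (h0 : 0 ∉ Ψ) (h0' : 0 ∉ Ψ')
    (hspan : Submodule.span ℝ Ψ = ⊤) (h : Iso Ψ Ψ') :
    ∃ L : V →ₗ[ℝ] W, Function.Injective L ∧ L '' Ψ = Ψ' ∧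
      ∀ α ∈ Ψ, ∀ v, cusp (L v) (L α) = cusp v α := by
  obtain ⟨g, hg⟩ := h
  -- Both systems are presented by the free space on Ψ; L is the induced map between the quotients.
  -- It need not be onto, as with A_{n-1} in its hyperplane.
  let T : (Ψ →₀ ℝ) →ₗ[ℝ] V := Finsupp.linearCombination ℝ Subtype.val
  let T' : (Ψ →₀ ℝ) →ₗ[ℝ] W := Finsupp.linearCombination ℝ fun α => (g α : W)
  have hT : LinearMap.range T = ⊤ := by
    rw [Finsupp.range_linearCombination, Subtype.range_coe, hspan]
  have hT' : ∀ x, T' x ∈ Submodule.span ℝ Ψ' := by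
    intro x
    have h1 : T' x ∈ LinearMap.range T' := ⟨x, rfl⟩
    rw [Finsupp.range_linearCombination] at h1
    refine Submodule.span_mono ?_ h1
    rintro _ ⟨α, rfl⟩
    exact (g α).2
  have hc : ∀ x, ∀ α : Ψ, cusp (T' x) (g α : W) = cusp (T x) (α : V) := by
    intro x α
    have h1 : coroot (g α : W) ∘ₗ T' = coroot (α : V) ∘ₗ T := by
      ext β
      simp [T, T', coroot_apply, hg]
    have := LinearMap.congr_fun h1 x
    simpa [coroot_apply] using this
  -- A vector in the span of the roots is zero once all its cusp products vanish, and these agree on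
  -- both sides.
  have hker : ∀ x, T x = 0 ↔ T' x = 0 := by
    intro x
    constructor
    · intro hx
      refine eq_zero_of_cusp_eq_zero h0' (hT' x) fun α hα => ?_
      have := hc x (g.symm ⟨α, hα⟩)
      rw [Equiv.apply_symm_apply, hx] at this
      rw [this]
      simp [cusp]
    · intro hx
      refine eq_zero_of_cusp_eq_zero h0 (by rw [hspan]; trivial) fun α hα => ?_
      rw [← hc x ⟨α, hα⟩, hx]
      simp [cusp]
  obtain ⟨S, hS⟩ := T.exists_rightInverse_of_surjective hT
  have hS' : ∀ v, T (S v) = v := fun v => LinearMap.congr_fun hS v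
  have hL : ∀ x, T' (S (T x)) = T' x := by
    intro x
    rw [← sub_eq_zero, ← map_sub, ← hker, map_sub, hS', sub_self]
  have hLg : ∀ α : Ψ, T' (S α) = g α := by
    intro α
    have := hL (Finsupp.single α 1)
    simpa [T, T'] using this
  refine ⟨T' ∘ₗ S, ?_, ?_, ?_⟩
  · rw [← LinearMap.ker_eq_bot, LinearMap.ker_eq_bot']
    intro v hv
    rw [LinearMap.comp_apply, ← hker, hS'] at hv
    exact hv
  · ext β
    constructor
    · rintro ⟨α, hα, rfl⟩
      rw [LinearMap.comp_apply, hLg ⟨α, hα⟩]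
      exact (g _).2
    · intro hβ
      refine ⟨g.symm ⟨β, hβ⟩, Subtype.prop _, ?_⟩
      rw [LinearMap.comp_apply, hLg, Equiv.apply_symm_apply]
  · intro α hα v
    rw [LinearMap.comp_apply, LinearMap.comp_apply, hLg ⟨α, hα⟩, hc, hS']

variable {L : V →ₗ[ℝ] W} (hL : Function.Injective L) (hΨ : L '' Ψ = Ψ')
  (hspan : Submodule.span ℝ Ψ = ⊤) (hc : ∀ α ∈ Ψ, ∀ v, cusp (L v) (L α) = cusp v α)

include hΨ hspan in
-- The range of L is the span of Ψ', which automorphisms preserve.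
theorem autGroup_apply_mem_range {g : W ≃ₗ[ℝ] W} (hg : g ∈ autGroup Ψ') (v : V) :
    ∃ w, L w = g (L v) := by
  have hv : v ∈ Submodule.span ℝ Ψ := by rw [hspan]; trivial
  induction hv using Submodule.span_induction with
  | mem α hα =>
    have h1 : g (L α) ∈ Ψ' := autGroup_mem hg (hΨ ▸ Set.mem_image_of_mem L hα)
    rw [← hΨ] at h1
    obtain ⟨w, -, hw⟩ := h1
    exact ⟨w, hw⟩
  | zero => exact ⟨0, by simp⟩
  | add x y _ _ hx hy =>
    obtain ⟨a, ha⟩ := hx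
    obtain ⟨b, hb⟩ := hy
    exact ⟨a + b, by simp [ha, hb]⟩
  | smul c x _ hx =>
    obtain ⟨a, ha⟩ := hx
    exact ⟨c • a, by simp [ha]⟩

include hL hΨ hspan hc in
-- With a left inverse R of L, the restriction of g to the range of L is pulled back as R g L.
theorem exists_autGroup_of_image {g : W ≃ₗ[ℝ] W} (hg : g ∈ autGroup Ψ') :
    ∃ γ ∈ autGroup Ψ, ∀ v, L (γ v) = g (L v) := by
  obtain ⟨R, hR⟩ := L.exists_leftInverse_of_injective (LinearMap.ker_eq_bot.2 hL)
  have hR' : ∀ v, R (L v) = v := fun v => LinearMap.congr_fun hR v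
  have key : ∀ g ∈ autGroup Ψ', ∀ v, L (R (g (L v))) = g (L v) := by
    intro g hg v
    obtain ⟨w, hw⟩ := autGroup_apply_mem_range hΨ hspan hg v
    rw [← hw, hR']
  have hinv := inv_mem hg
  have h1 : ∀ w, g (g⁻¹ w) = w := fun w => g.apply_symm_apply w
  have h2 : ∀ w, g⁻¹ (g w) = w := fun w => g.symm_apply_apply w
  let γ : V ≃ₗ[ℝ] V := LinearEquiv.ofLinearMap (R ∘ₗ g.toLinearMap ∘ₗ L)
    (R ∘ₗ (g⁻¹ : W ≃ₗ[ℝ] W).toLinearMap ∘ₗ L)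
    (by
      ext v
      change R (g (L (R (g⁻¹ (L v))))) = v
      rw [key _ hinv, h1, hR'])
    (by
      ext v
      change R (g⁻¹ (L (R (g (L v))))) = v
      rw [key _ hg, h2, hR'])
  have hγ : ∀ v, L (γ v) = g (L v) := key g hg
  refine ⟨γ, ⟨?_, ?_⟩, hγ⟩
  · apply hL.image_injective
    rw [← Set.image_comp, show L ∘ γ = g ∘ L from funext hγ, Set.image_comp, hΨ, hg.1]
  · have hmem : ∀ α ∈ Ψ, γ α ∈ Ψ := by
      intro α hα
      have h3 : g (L α) ∈ Ψ' := autGroup_mem hg (hΨ ▸ Set.mem_image_of_mem L hα)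
      rw [← hΨ, ← hγ] at h3
      exact (hL.mem_set_image).1 h3
    intro α hα β hβ
    rw [← hc _ (hmem β hβ), hγ, hγ, hg.2 _ (hΨ ▸ Set.mem_image_of_mem L hα) _
      (hΨ ▸ Set.mem_image_of_mem L hβ), hc _ hβ]

include hL hΨ hspan hc in
theorem conj_of_image {Φ₁ Φ₂ : Set V} (h : Conj Ψ' (L '' Φ₁) (L '' Φ₂)) : Conj Ψ Φ₁ Φ₂ := by
  obtain ⟨g, hg, h⟩ := h
  obtain ⟨γ, hγ, hγ'⟩ := exists_autGroup_of_image hL hΨ hspan hc hg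
  refine ⟨γ, hγ, hL.image_injective ?_⟩
  rw [← Set.image_comp, show L ∘ γ = g ∘ L from funext hγ', Set.image_comp, h]

include hL hΨ hc in
-- Here Ψ' has to span, so that L is an isomorphism and γ can be conjugated by it.
theorem exists_autGroup_image (hspan' : Submodule.span ℝ Ψ' = ⊤) {γ : V ≃ₗ[ℝ] V}
    (hγ : γ ∈ autGroup Ψ) : ∃ g ∈ autGroup Ψ', ∀ v, g (L v) = L (γ v) := by
  have hsurj : Function.Surjective L := by
    rw [← LinearMap.range_eq_top, eq_top_iff, ← hspan', Submodule.span_le, ← hΨ]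
    rintro _ ⟨v, -, rfl⟩
    exact ⟨v, rfl⟩
  let ℓ := LinearEquiv.ofBijective L ⟨hL, hsurj⟩
  have hg : ∀ v, (ℓ.symm ≪≫ₗ γ ≪≫ₗ ℓ) (L v) = L (γ v) := by
    intro v
    change ℓ (γ (ℓ.symm (ℓ v))) = L (γ v)
    rw [LinearEquiv.symm_apply_apply]
    rfl
  refine ⟨ℓ.symm ≪≫ₗ γ ≪≫ₗ ℓ, ⟨?_, ?_⟩, hg⟩
  · rw [← hΨ, ← Set.image_comp, show _ ∘ L = L ∘ γ from funext hg, Set.image_comp, hγ.1]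
  · rw [← hΨ]
    rintro _ ⟨α, hα, rfl⟩ _ ⟨β, hβ, rfl⟩
    rw [hg, hg, hc _ (autGroup_mem hγ hβ), hγ.2 _ hα _ hβ, hc _ hβ]

include hL hΨ hc in
theorem IsReducedSub.image (h : IsReducedSub Φ Ψ) : IsReducedSub (L '' Φ) Ψ' :=
  ⟨h.1.image hL fun α hα => hc α (h.3 hα), h.2.image hL, hΨ ▸ Set.image_mono h.3⟩

end Transport

/-! ### Types B_n and D_n (n ≠ 4) -/

section StandardTransport

variable {V : Type*} [NormedAddCommGroup V] [InnerProductSpace ℝ V] [FiniteDimensional ℝ V]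
  {n : ℕ} {Ψ Φ₁ Φ₂ : Set V} {Ψ' : Set (E n)} {f : V →ₗ[ℝ] ℝ}

theorem zero_notMem_typeBC : (0 : E n) ∉ typeBC n := by
  obtain ⟨h, hh⟩ := exists_regular (n := n)
  exact fun h0 => hh 0 h0 (map_zero h)

/-- Characters with the same average, transported to a standard root system, are not separated
by functions that are invariant under the automorphism group. -/
theorem exists_transport (hI : IsIrreducible Ψ) (hiso : Iso Ψ Ψ') (hBC : Ψ' ⊆ typeBC n)
    (hf : ∀ α ∈ Ψ, f α ≠ 0) (h₁ : IsReducedSub Φ₁ Ψ) (h₂ : IsReducedSub Φ₂ Ψ)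
    (hF : charF (autGroup Ψ) f Φ₁ = charF (autGroup Ψ) f Φ₂) :
    ∃ (L : V →ₗ[ℝ] E n) (f' : E n →ₗ[ℝ] ℝ), Function.Injective L ∧ L '' Ψ = Ψ' ∧
      (∀ α ∈ Ψ, ∀ v, cusp (L v) (L α) = cusp v α) ∧ (∀ α ∈ Ψ', f' α ≠ 0) ∧
      IsReducedSub (L '' Φ₁) Ψ' ∧ IsReducedSub (L '' Φ₂) Ψ' ∧
      (Conj Ψ' (L '' Φ₁) (L '' Φ₂) → Conj Ψ Φ₁ Φ₂) ∧
      ∀ {M : Type} [AddCommGroup M] [Module ℚ M] (m : E n → M),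
        (∀ γ ∈ autGroup Ψ, ∀ v, m (L (γ v)) = m (L v)) →
        evMap m (charA f' (L '' Φ₁)) = evMap m (charA f' (L '' Φ₂)) := by
  have hspan := hI.span_eq_top
  have hfin := finite_autGroup hI.isRootSystem.finite hspan
  obtain ⟨L, hL, hΨ, hc⟩ := exists_linearMap_of_iso hI.isRootSystem.zero_notMem
    (fun h => zero_notMem_typeBC (hBC h)) hspan hiso
  obtain ⟨R, hR⟩ := L.exists_leftInverse_of_injective (LinearMap.ker_eq_bot.2 hL)
  have hR' : ∀ v, R (L v) = v := fun v => LinearMap.congr_fun hR v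
  have hf' : ∀ v, (f ∘ₗ R) (L v) = f v := fun v => by rw [LinearMap.comp_apply, hR']
  refine ⟨L, f ∘ₗ R, hL, hΨ, hc, ?_, h₁.image hL hΨ hc, h₂.image hL hΨ hc,
    conj_of_image hL hΨ hspan hc, ?_⟩
  · rw [← hΨ]
    rintro _ ⟨α, hα, rfl⟩
    rw [hf']
    exact hf α hα
  · intro M _ _ m hm
    have hm' : ∀ γ ∈ autGroup Ψ, ∀ v, (m ∘ L) (γ v) = (m ∘ L) v := hm
    rw [evMap_charA_image m h₁.1 hL (fun α hα => hc α (h₁.3 hα)) (fun α _ => by rw [hf']),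
      evMap_charA_image m h₂.1 hL (fun α hα => hc α (h₂.3 hα)) (fun α _ => by rw [hf']),
      ← evMap_charF hm', ← evMap_charF hm', hF]

theorem blockCount_two_eq_zero {Φ : Set (E n)} (hd : ∀ i, (2 : ℝ) • e i ∉ Φ) (k : ℕ) :
    blockCount Φ 2 k = 0 := by
  rw [blockCount, Finset.card_eq_zero, Finset.filter_eq_empty_iff]
  rintro ⟨τ, I⟩ hp ⟨h2, -⟩
  obtain ⟨⟨i, hi⟩, -, ε, hε⟩ := mem_blocks.1 hp
  obtain rfl : τ = 2 := h2
  have h1 : (2 : ℝ) • e i ∈ meet Φ I := by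
    rw [hε]
    exact Or.inr ⟨i, hi, 1, by simp⟩
  exact hd i h1.1

theorem blockCount_zero_right {Φ : Set (E n)} (τ : Fin 4) : blockCount Φ τ 0 = 0 := by
  rw [blockCount, Finset.card_eq_zero, Finset.filter_eq_empty_iff]
  rintro p hp ⟨-, h⟩
  exact (mem_blocks.1 hp).1.card_pos.ne' h

/-- Without roots `±2e_i`, the orbit polynomial determines the blocks. -/
theorem blockCount_eq_of_evMap_eq {Φ Φ' : Set (E n)} (h : IsReducedSub Φ (typeBC n))
    (h' : IsReducedSub Φ' (typeBC n)) (hd : ∀ i, (2 : ℝ) • e i ∉ Φ)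
    (hd' : ∀ i, (2 : ℝ) • e i ∉ Φ') {f : E n →ₗ[ℝ] ℝ} (hf : ∀ α ∈ Φ, f α ≠ 0)
    (hf' : ∀ α ∈ Φ', f α ≠ 0)
    (he : evMap (mono Finset.univ) (charA f Φ) = evMap (mono Finset.univ) (charA f Φ'))
    (τ : Fin 4) (k : ℕ) : blockCount Φ τ k = blockCount Φ' τ k := by
  have hs := (evMap_charA_eq_iff h h' hf hf').1 he
  have h1 := blockCount_zero_one_eq h h' hs
  rcases Nat.lt_or_ge n k with hk | hk
  · rw [blockCount_eq_zero_of_lt τ hk, blockCount_eq_zero_of_lt τ hk]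
  rcases Nat.eq_zero_or_pos k with rfl | hk0
  · rw [blockCount_zero_right, blockCount_zero_right]
  -- Without blocks of type C the third relation fixes the numbers of odd A blocks, and the fourth
  -- then those of D blocks.
  simp only [blockCount_two_eq_zero hd, blockCount_two_eq_zero hd', add_zero] at hs
  fin_cases τ
  · obtain ⟨m, rfl | rfl⟩ := Nat.even_or_odd' k
    · obtain ⟨m, rfl⟩ := Nat.exists_eq_add_of_le' (show 1 ≤ m by omega)
      exact (hs m (by omega)).1
    · rcases m with _ | m
      · exact h1
      · exact (hs m (by omega)).2.2.1
  · obtain ⟨m, rfl⟩ := Nat.exists_eq_add_of_le' hk0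
    exact (hs m (by omega)).2.1
  · exact (blockCount_two_eq_zero hd k).trans (blockCount_two_eq_zero hd' k).symm
  · obtain ⟨m, rfl⟩ := Nat.exists_eq_add_of_le' hk0
    rcases m with _ | m
    · exact blockCount_three_one.trans blockCount_three_one.symm
    · have := hs m (by omega)
      change blockCount Φ 3 (m + 2) = blockCount Φ' 3 (m + 2)
      omega

/-- The character determines the conjugacy class in a standard root system without roots `±2e_i`
all of whose automorphisms are signed permutations. -/
theorem conj_of_charF_eq (hBC : Ψ' ⊆ typeBC n) (hspan' : Submodule.span ℝ Ψ' = ⊤)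
    (hg : ∀ g ∈ autGroup Ψ', ∃ s σ, g = sp s σ) (hsp : ∀ s σ, sp s σ '' Ψ' = Ψ')
    (hd : ∀ i, (2 : ℝ) • e i ∉ Ψ') (hI : IsIrreducible Ψ) (hiso : Iso Ψ Ψ')
    (hf : ∀ α ∈ Ψ, f α ≠ 0) (h₁ : IsReducedSub Φ₁ Ψ) (h₂ : IsReducedSub Φ₂ Ψ)
    (hF : charF (autGroup Ψ) f Φ₁ = charF (autGroup Ψ) f Φ₂) : Conj Ψ Φ₁ Φ₂ := by
  obtain ⟨L, f', hL, hΨ, hc, hf', r₁, r₂, hconj, hev⟩ := exists_transport hI hiso hBC hf h₁ h₂ hF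
  have s₁ : IsReducedSub (L '' Φ₁) (typeBC n) := ⟨r₁.1, r₁.2, r₁.3.trans hBC⟩
  have s₂ : IsReducedSub (L '' Φ₂) (typeBC n) := ⟨r₂.1, r₂.2, r₂.3.trans hBC⟩
  have he := hev (mono Finset.univ) (by
    intro γ hγ v
    obtain ⟨g, hg', h⟩ := exists_autGroup_image hL hΨ hc hspan' hγ
    obtain ⟨s, σ, rfl⟩ := hg g hg'
    rw [← h, mono_sp])
  obtain ⟨s, σ, h⟩ := exists_sp_image_eq s₁ s₂ (blockCount_eq_of_evMap_eq s₁ s₂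
    (fun i hi => hd i (r₁.3 hi)) (fun i hi => hd i (r₂.3 hi)) (fun α hα => hf' α (r₁.3 hα))
    (fun α hα => hf' α (r₂.3 hα)) he)
  exact hconj ⟨_, sp_mem_autGroup (hsp s σ), h⟩

theorem typeD_subset_typeBC : typeD n ⊆ typeBC n := fun _ h => mem_typeBC.2 (Or.inl h)

theorem conj_of_charF_eq_typeB (hI : IsIrreducible Ψ) (hiso : Iso Ψ (typeB n))
    (hf : ∀ α ∈ Ψ, f α ≠ 0) (h₁ : IsReducedSub Φ₁ Ψ) (h₂ : IsReducedSub Φ₂ Ψ)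
    (hF : charF (autGroup Ψ) f Φ₁ = charF (autGroup Ψ) f Φ₂) : Conj Ψ Φ₁ Φ₂ := by
  refine conj_of_charF_eq Set.subset_union_left span_typeB (fun g hg => autGroup_typeB hg)
    sp_image_typeB ?_ hI hiso hf h₁ h₂ hF
  intro i hi
  rcases mem_typeB.1 hi with h | ⟨j, s, h⟩
  · exact double_notMem_typeD h
  · have h1 := congrArg (fun v : E n => |v i|) h
    simp only [PiLp.smul_apply, e_apply_self, units_smul_apply, abs_mul, abs_cast_units,
      e_apply] at h1
    split_ifs at h1 <;> norm_num at h1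

theorem conj_of_charF_eq_typeD (hn : 3 ≤ n) (hn4 : n ≠ 4) (hI : IsIrreducible Ψ)
    (hiso : Iso Ψ (typeD n))
    (hf : ∀ α ∈ Ψ, f α ≠ 0) (h₁ : IsReducedSub Φ₁ Ψ) (h₂ : IsReducedSub Φ₂ Ψ)
    (hF : charF (autGroup Ψ) f Φ₁ = charF (autGroup Ψ) f Φ₂) : Conj Ψ Φ₁ Φ₂ :=
  conj_of_charF_eq typeD_subset_typeBC (span_typeD (by omega))
    (fun g hg => autGroup_typeD hn hn4 hg) sp_image_typeD (fun _ => double_notMem_typeD) hI hiso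
    hf h₁ h₂ hF

end StandardTransport

end RootChar

end

noncomputable section

namespace RootChar

/-! ### The Gaussian specialisation -/

section GaussianEvaluation

open MvPolynomial

variable {n : ℕ}

theorem map_evMap {V M N : Type*} [AddCommGroup M] [Module ℚ M] [AddCommGroup N] [Module ℚ N]
    (φ : M →ₗ[ℚ] N) (m : V → M) (x : AddMonoidAlgebra ℚ V) :
    φ (evMap m x) = evMap (φ ∘ m) x :=
  Finsupp.apply_linearCombination _ _ _ _

/-- The evaluation of the variables at the values of a Gaussian function. -/
def gaussEval (c : ℂ) : Poly →ₐ[ℚ] ℂ := aeval fun r : ℝ => Complex.exp (c * (r : ℂ) ^ 2)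

/-- The product of the exponentials exp(c v_i²) depends only on the norm of v, so it is invariant
under all isometries, not only under signed permutations. -/
theorem gaussEval_mono (c : ℂ) (v : E n) :
    gaussEval c (mono Finset.univ v) = Complex.exp (c * (inner ℝ v v : ℝ)) := by
  rw [mono, map_prod, inner_eq_sum, Complex.ofReal_sum, Finset.mul_sum, Complex.exp_sum]
  refine Finset.prod_congr rfl fun i _ => ?_
  rw [gaussEval, aeval_X, ← Complex.ofReal_pow, sq_abs, sq]

theorem gaussEval_comp_var (c : ℂ) :
    (gaussEval c : Poly →+* ℂ) ∘ var = fun j => Complex.exp c ^ j ^ 2 := by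
  funext j
  rw [Function.comp_apply, var, RingHom.coe_coe, gaussEval, aeval_X, ← Complex.exp_nat_mul,
    mul_comm]
  push_cast
  rfl

/-- The symmetric Toeplitz determinants of the sequence `q ^ j ^ 2` are Vandermonde
determinants. -/
theorem toepA_gauss {K : Type*} [Field K] {q : K} (hq : q ≠ 0) (k : ℕ) :
    toepA (fun j => q ^ j ^ 2) k = (∏ i : Fin k, q ^ (i : ℕ) ^ 2) *
      (Matrix.vandermonde fun i : Fin k => ((q ^ 2)⁻¹) ^ (i : ℕ)).det *
      ∏ i : Fin k, q ^ (i : ℕ) ^ 2 := by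
  rw [toepA, ← Matrix.det_diagonal, ← Matrix.det_mul, ← Matrix.det_mul]
  congr 1
  ext i j
  rw [Matrix.mul_diagonal, Matrix.diagonal_mul, Matrix.vandermonde_apply, Matrix.of_apply,
    ← pow_mul, inv_pow, ← pow_mul, mul_right_comm, ← pow_add, eq_mul_inv_iff_mul_eq₀
    (pow_ne_zero _ hq), ← pow_add]
  -- The identity (i - j)² = i² + j² - 2ij separates the diagonal factors from the Vandermonde
  -- matrix.
  congr 1
  zify
  rw [sq_abs]
  ring

theorem toepA_gauss_ne_zero_iff {K : Type*} [Field K] {q : K} (hq : q ≠ 0) (k : ℕ) :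
    toepA (fun j => q ^ j ^ 2) k ≠ 0 ↔
      Function.Injective fun i : Fin k => ((q ^ 2)⁻¹) ^ (i : ℕ) := by
  rw [toepA_gauss hq, ← Matrix.det_vandermonde_ne_zero_iff]
  have : ∏ i : Fin k, q ^ (i : ℕ) ^ 2 ≠ 0 := Finset.prod_ne_zero_iff.2 fun i _ => pow_ne_zero _ hq
  simp [this]

/-- There is a `q` for which the first vanishing determinant is the one of size `k`. -/
theorem exists_toepA_gauss_eq_zero {k : ℕ} (hk : 2 ≤ k) :
    ∃ q : ℂ, q ≠ 0 ∧ toepA (fun j => q ^ j ^ 2) k = 0 ∧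
      ∀ j < k, toepA (fun j => q ^ j ^ 2) j ≠ 0 := by
  obtain ⟨N, rfl⟩ := Nat.exists_eq_add_of_le' (show 1 ≤ k by omega)
  have hN : N ≠ 0 := by omega
  have hζ := Complex.isPrimitiveRoot_exp N hN
  set ζ := Complex.exp (2 * Real.pi * Complex.I / N)
  -- With q² = ζ a primitive N-th root of unity, N = k - 1, the nodes ζ^(-i) are distinct for i < N
  -- and first repeat at i = N.
  obtain ⟨q, hq⟩ := IsAlgClosed.exists_pow_nat_eq ζ (n := 2) (by norm_num)
  have hq0 : q ≠ 0 := by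
    rintro rfl
    exact hζ.ne_zero hN (by rw [← hq]; norm_num)
  refine ⟨q, hq0, ?_, fun j hj => ?_⟩
  · by_contra h
    rw [← Ne, toepA_gauss_ne_zero_iff hq0, hq] at h
    have h1 := @h 0 (Fin.last N) (by simp [hζ.inv.pow_eq_one])
    exact hN (congrArg Fin.val h1).symm
  · rw [toepA_gauss_ne_zero_iff hq0, hq]
    intro a b hab
    exact Fin.ext (hζ.inv.pow_inj (by omega) (by omega) hab)

/-- The determinants of `toepA_gauss` with an indeterminate `q`. -/
def gaussPoly (k : ℕ) : Polynomial ℂ := toepA (fun j => Polynomial.X ^ j ^ 2) k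

theorem eval_gaussPoly (q : ℂ) (k : ℕ) :
    (gaussPoly k).eval q = toepA (fun j => q ^ j ^ 2) k := by
  have h := map_toepA (Polynomial.evalRingHom q) (fun j => Polynomial.X ^ j ^ 2) k
  rw [Polynomial.coe_evalRingHom] at h
  rw [gaussPoly, h]
  congr 1
  funext j
  simp

theorem gaussPoly_ne_zero (k : ℕ) : gaussPoly k ≠ 0 := by
  intro h
  obtain ⟨q, -, -, h1⟩ := exists_toepA_gauss_eq_zero (k := k + 2) (by omega)
  apply h1 k (by omega)
  rw [← eval_gaussPoly, h, Polynomial.eval_zero]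

/-- A point q at which size n + 1 is the first to vanish isolates the largest factor. Size 1 cannot
be recovered, since `gaussPoly 1` is 1. -/
theorem eq_of_prod_gaussPoly_pow_eq {c c' : ℕ → ℕ} (n : ℕ)
    (h : ∏ k ∈ Finset.Icc 1 n, gaussPoly k ^ c k = ∏ k ∈ Finset.Icc 1 n, gaussPoly k ^ c' k) :
    ∀ k, 2 ≤ k → k ≤ n → c k = c' k := by
  induction n with
  | zero => intro k h1 h2; omega
  | succ n ih =>
    rcases Nat.eq_zero_or_pos n with rfl | hn
    · intro k h1 h2; omega
    obtain ⟨q, -, hq, hq'⟩ := exists_toepA_gauss_eq_zero (k := n + 1) (by omega)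
    have hu : ∀ c : ℕ → ℕ,
        Polynomial.evalRingHom q (∏ k ∈ Finset.Icc 1 n, gaussPoly k ^ c k) ≠ 0 := by
      intro c
      rw [map_prod, Finset.prod_ne_zero_iff]
      intro k hk
      rw [map_pow, Polynomial.coe_evalRingHom, eval_gaussPoly]
      exact pow_ne_zero _ (hq' k (by have := (Finset.mem_Icc.1 hk).2; omega))
    have hφ : Polynomial.evalRingHom q (gaussPoly (n + 1)) = 0 := by
      rw [Polynomial.coe_evalRingHom, eval_gaussPoly, hq]
    rw [Finset.prod_Icc_succ_top (by omega), Finset.prod_Icc_succ_top (by omega),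
      mul_comm, mul_comm (∏ k ∈ Finset.Icc 1 n, gaussPoly k ^ c' k)] at h
    have h1 := eq_of_pow_mul_eq _ (gaussPoly_ne_zero _) hφ (hu c) (hu c') h
    rw [h1] at h
    have h2 := mul_left_cancel₀ (pow_ne_zero _ (gaussPoly_ne_zero _)) h
    intro k hk hkn
    rcases Nat.lt_or_ge n k with h3 | h3
    · obtain rfl : k = n + 1 := by omega
      exact h1
    · exact ih h2 k hk h3

end GaussianEvaluation

/-! ### Simply laced systems -/

section SimplyLaced

variable {V : Type*} [NormedAddCommGroup V] [InnerProductSpace ℝ V] {n : ℕ} {Ψ : Set V}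
  {Ψ' : Set (E n)}

/-- All roots of D_n have squared length 2. -/
theorem inner_eq_cusp {α : E n} (hα : α ∈ typeD n) (v : E n) : inner ℝ α v = cusp v α := by
  obtain ⟨i, j, hij, s, t, rfl⟩ := mem_typeD.1 hα
  rw [cusp_long hij, inner_long]

/-- Automorphisms of a simply laced root system are isometries. -/
theorem inner_autGroup {L : V →ₗ[ℝ] E n} (hspan : Submodule.span ℝ Ψ = ⊤)
    (hΨ : L '' Ψ ⊆ typeD n) (hc : ∀ α ∈ Ψ, ∀ v, cusp (L v) (L α) = cusp v α) {γ : V ≃ₗ[ℝ] V}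
    (hγ : γ ∈ autGroup Ψ) (v : V) : inner ℝ (L (γ v)) (L (γ v)) = inner ℝ (L v) (L v) := by
  have hv : v ∈ Submodule.span ℝ Ψ := by rw [hspan]; trivial
  have h1 : ∀ α ∈ Ψ, ∀ β ∈ Ψ, inner ℝ (L (γ α)) (L (γ β)) = inner ℝ (L α) (L β) := by
    intro α hα β hβ
    rw [inner_eq_cusp (hΨ (Set.mem_image_of_mem L (autGroup_mem hγ hα))),
      inner_eq_cusp (hΨ (Set.mem_image_of_mem L hα)), hc _ (autGroup_mem hγ hα), hc _ hα,
      hγ.2 _ hβ _ hα]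
  have h2 : ∀ α ∈ Ψ, ∀ w ∈ Submodule.span ℝ Ψ,
      inner ℝ (L (γ α)) (L (γ w)) = inner ℝ (L α) (L w) := by
    intro α hα w hw
    induction hw using Submodule.span_induction with
    | mem β hβ => exact h1 α hα β hβ
    | zero => simp
    | add x y _ _ hx hy => simp only [map_add, inner_add_right, hx, hy]
    | smul c x _ hx => simp only [map_smul, real_inner_smul_right, hx]
  have h3 : ∀ w ∈ Submodule.span ℝ Ψ, inner ℝ (L (γ w)) (L (γ v)) = inner ℝ (L w) (L v) := by
    intro w hw
    induction hw using Submodule.span_induction with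
    | mem α hα => exact h2 α hα v hv
    | zero => simp
    | add x y _ _ hx hy => simp only [map_add, inner_add_left, hx, hy]
    | smul c x _ hx => simp only [map_smul, real_inner_smul_left, hx]
  exact h3 v hv

/-- The Gaussian specialisation of the orbit polynomial is an invariant of the averaged character
in simply laced root systems. -/
theorem exists_transport_of_simplyLaced [FiniteDimensional ℝ V] {Φ₁ Φ₂ : Set V} {f : V →ₗ[ℝ] ℝ}
    (hI : IsIrreducible Ψ) (hiso : Iso Ψ Ψ') (hD : Ψ' ⊆ typeD n)
    (hf : ∀ α ∈ Ψ, f α ≠ 0) (h₁ : IsReducedSub Φ₁ Ψ) (h₂ : IsReducedSub Φ₂ Ψ)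
    (hF : charF (autGroup Ψ) f Φ₁ = charF (autGroup Ψ) f Φ₂) :
    ∃ Θ₁ Θ₂ : Set (E n), IsReducedSub Θ₁ Ψ' ∧ IsReducedSub Θ₂ Ψ' ∧
      (Conj Ψ' Θ₁ Θ₂ → Conj Ψ Φ₁ Φ₂) ∧
      ∀ c, ∏ p ∈ blocks Θ₁, gaussEval c (factorPoly p.1 p.2.card) =
        ∏ p ∈ blocks Θ₂, gaussEval c (factorPoly p.1 p.2.card) := by
  have hBC := hD.trans typeD_subset_typeBC
  obtain ⟨L, f', hL, hΨ, hc, hf', r₁, r₂, hconj, hev⟩ := exists_transport hI hiso hBC hf h₁ h₂ hF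
  refine ⟨_, _, r₁, r₂, hconj, fun c => ?_⟩
  have key : ∀ {Θ : Set (E n)}, IsReducedSub Θ Ψ' →
      ∏ p ∈ blocks Θ, gaussEval c (factorPoly p.1 p.2.card) =
        evMap (gaussEval c ∘ mono Finset.univ) (charA f' Θ) := by
    intro Θ hΘ
    have := map_evMap (gaussEval c).toLinearMap (mono Finset.univ) (charA f' Θ)
    rw [evMap_charA_eq_prod_blocks ⟨hΘ.1, hΘ.2, hΘ.3.trans hBC⟩ fun α hα => hf' α (hΘ.3 hα),
      AlgHom.toLinearMap_apply, map_prod] at this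
    exact this
  rw [key r₁, key r₂]
  refine hev _ fun γ hγ v => ?_
  rw [Function.comp_apply, Function.comp_apply, gaussEval_mono, gaussEval_mono,
    inner_autGroup hI.span_eq_top (hΨ ▸ hD) hc hγ]

end SimplyLaced

/-! ### Type A -/

section TypeA

variable {n : ℕ} {Φ Φ' : Set (E n)}

theorem sum_eq_zero_of_mem_typeA {α : E n} (h : α ∈ typeA n) : ∑ i, α i = 0 := by
  obtain ⟨i, j, hij, rfl⟩ := mem_typeA.1 h
  simp [e_apply]

theorem sum_units_smul_e (s : ℤˣ) (i : Fin n) : ∑ j, (s • e i : E n) j = ((s : ℤ) : ℝ) := by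
  simp [e_apply, units_smul_apply]

/-- The blocks of a subsystem of `A_{n-1}` are of type `A`, without signs. -/
theorem IsBlock.of_subset_typeA {τ : Fin 4} {I : Finset (Fin n)} (hΦ : Φ ⊆ typeA n)
    (h : IsBlock Φ τ I) : τ = 0 ∧ meet Φ I = setA I 1 := by
  obtain ⟨⟨i, hi⟩, h3, ε, hε⟩ := h
  -- The coordinate sum of every root vanishes, which rules out types B, C, D and forces equal signs
  -- on a block of type A.
  have hm : ∀ α ∈ std τ I ε, ∑ i, α i = 0 := fun α hα =>
    sum_eq_zero_of_mem_typeA (hΦ (hε ▸ hα : α ∈ meet Φ I).1)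
  fin_cases τ
  · refine ⟨rfl, hε.trans ?_⟩
    have hs : ∀ j ∈ I, ∀ k ∈ I, ε j = ε k := by
      intro j hj k hk
      by_cases hjk : j = k
      · rw [hjk]
      have h1 := hm _ ⟨j, hj, k, hk, hjk, rfl⟩
      simp only [PiLp.sub_apply, Finset.sum_sub_distrib, sum_units_smul_e, sub_eq_zero] at h1
      exact Units.ext (by exact_mod_cast h1)
    ext α
    constructor
    · rintro ⟨j, hj, k, hk, hjk, rfl⟩
      rw [hs k hk j hj]
      rcases Int.units_eq_one_or (ε j) with h | h
      · exact ⟨j, hj, k, hk, hjk, by simp [h]⟩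
      · exact ⟨k, hk, j, hj, Ne.symm hjk, by simp [h]; abel⟩
    · rintro ⟨j, hj, k, hk, hjk, rfl⟩
      rcases Int.units_eq_one_or (ε j) with h | h
      · exact ⟨j, hj, k, hk, hjk, by simp [hs k hk j hj, h]⟩
      · exact ⟨k, hk, j, hj, Ne.symm hjk, by simp [hs k hk j hj, h]; abel⟩
  · have := hm _ (Or.inr ⟨i, hi, 1, rfl⟩)
    rw [sum_units_smul_e] at this
    norm_num at this
  · have := hm _ (Or.inr ⟨i, hi, 1, rfl⟩)
    simp [e_apply] at this
  · obtain ⟨j, hj, k, hk, hjk⟩ := Finset.one_lt_card.1 (h3 rfl)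
    have := hm _ ⟨j, hj, k, hk, hjk, 1, 1, rfl⟩
    simp [e_apply, Finset.sum_add_distrib] at this

theorem blockCount_eq_zero_of_subset_typeA (hΦ : Φ ⊆ typeA n) {τ : Fin 4} (hτ : τ ≠ 0) (k : ℕ) :
    blockCount Φ τ k = 0 := by
  rw [blockCount, Finset.card_eq_zero, Finset.filter_eq_empty_iff]
  rintro p hp ⟨h, -⟩
  exact hτ (h ▸ ((mem_blocks.1 hp).of_subset_typeA hΦ).1)

theorem typeA_subset_typeBC : typeA n ⊆ typeBC n := typeA_subset_typeD.trans typeD_subset_typeBC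

/-- All blocks are of type A, so the Gaussian products are values of products of `gaussPoly`. These
give the numbers of blocks of size at least 2, and the total size n gives the singletons. -/
theorem blockCount_eq_of_prod_gaussEval_eq (h : IsReducedSub Φ (typeA n))
    (h' : IsReducedSub Φ' (typeA n))
    (he : ∀ c, ∏ p ∈ blocks Φ, gaussEval c (factorPoly p.1 p.2.card) =
      ∏ p ∈ blocks Φ', gaussEval c (factorPoly p.1 p.2.card)) (τ : Fin 4) (k : ℕ) :
    blockCount Φ τ k = blockCount Φ' τ k := by
  have hprod : ∀ {Φ : Set (E n)}, IsReducedSub Φ (typeA n) → ∀ c : ℂ,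
      ∏ p ∈ blocks Φ, gaussEval c (factorPoly p.1 p.2.card) =
        (∏ k ∈ Finset.Icc 1 n, gaussPoly k ^ blockCount Φ 0 k).eval (Complex.exp c) := by
    intro Φ h c
    rw [prod_blocks fun τ k => gaussEval c (factorPoly τ k), Polynomial.eval_prod]
    refine Finset.prod_congr rfl fun k _ => ?_
    rw [Finset.prod_eq_single 0, Polynomial.eval_pow, eval_gaussPoly, ← gaussEval_comp_var,
      ← map_toepA]
    · rfl
    · intro τ _ hτ
      rw [blockCount_eq_zero_of_subset_typeA h.3 hτ, pow_zero]
    · simp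
  have hpoly : ∏ k ∈ Finset.Icc 1 n, gaussPoly k ^ blockCount Φ 0 k =
      ∏ k ∈ Finset.Icc 1 n, gaussPoly k ^ blockCount Φ' 0 k := by
    refine Polynomial.eq_of_infinite_eval_eq _ _ ?_
    -- Every nonzero q is some exp(c), so the two polynomials agree at infinitely many points.
    refine (Set.finite_singleton (0 : ℂ)).infinite_compl.mono fun q hq => ?_
    have := he (Complex.log q)
    rw [hprod h, hprod h', Complex.exp_log hq] at this
    exact this
  have h2 := eq_of_prod_gaussPoly_pow_eq n hpoly
  rcases ne_or_eq τ 0 with hτ | rfl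
  · rw [blockCount_eq_zero_of_subset_typeA h.3 hτ, blockCount_eq_zero_of_subset_typeA h'.3 hτ]
  rcases Nat.lt_or_ge n k with hk | hk
  · rw [blockCount_eq_zero_of_lt _ hk, blockCount_eq_zero_of_lt _ hk]
  rcases Nat.lt_or_ge k 2 with hk2 | hk2
  swap
  · exact h2 k hk2 hk
  rcases Nat.eq_zero_or_pos k with rfl | hk0
  · rw [blockCount_zero_right, blockCount_zero_right]
  obtain rfl : k = 1 := by omega
  have hsum : ∀ {Φ : Set (E n)}, IsReducedSub Φ (typeA n) →
      blockCount Φ 0 1 + ∑ k ∈ Finset.Icc 2 n, k * blockCount Φ 0 k = n := by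
    intro Φ h
    have h3 := sum_blockCount ⟨h.1, h.2, h.3.trans typeA_subset_typeBC⟩
    have h4 : ∀ k, ∑ τ, k * blockCount Φ τ k = k * blockCount Φ 0 k := by
      intro k
      rw [Finset.sum_eq_single 0]
      · intro τ _ hτ
        rw [blockCount_eq_zero_of_subset_typeA h.3 hτ, mul_zero]
      · simp
    simp only [h4] at h3
    rw [← Finset.insert_Icc_add_one_left_eq_Icc hk, Finset.sum_insert (by simp), one_mul] at h3
    exact h3
  have h5 : ∑ k ∈ Finset.Icc 2 n, k * blockCount Φ 0 k =
      ∑ k ∈ Finset.Icc 2 n, k * blockCount Φ' 0 k :=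
    Finset.sum_congr rfl fun k hk => by
      rw [h2 k (Finset.mem_Icc.1 hk).1 (Finset.mem_Icc.1 hk).2]
  have h6 := hsum h
  have h7 := hsum h'
  omega

variable {V : Type*} [NormedAddCommGroup V] [InnerProductSpace ℝ V] [FiniteDimensional ℝ V]

/-- All block signs can be taken to be 1, so the conjugating element is a pure permutation. The
Gaussian invariant makes it unnecessary to determine Aut(A_{n-1}). -/
theorem conj_of_charF_eq_typeA {Ψ Φ₁ Φ₂ : Set V} {f : V →ₗ[ℝ] ℝ} (hI : IsIrreducible Ψ)
    (hiso : Iso Ψ (typeA n)) (hf : ∀ α ∈ Ψ, f α ≠ 0) (h₁ : IsReducedSub Φ₁ Ψ)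
    (h₂ : IsReducedSub Φ₂ Ψ) (hF : charF (autGroup Ψ) f Φ₁ = charF (autGroup Ψ) f Φ₂) :
    Conj Ψ Φ₁ Φ₂ := by
  obtain ⟨Θ₁, Θ₂, r₁, r₂, hconj, he⟩ :=
    exists_transport_of_simplyLaced hI hiso typeA_subset_typeD hf h₁ h₂ hF
  have hmeet : ∀ {Θ : Set (E n)}, IsReducedSub Θ (typeA n) →
      ∀ p ∈ blocks Θ, meet Θ p.2 = std p.1 p.2 1 := by
    intro Θ h p hp
    obtain ⟨h1, h2⟩ := (mem_blocks.1 hp).of_subset_typeA h.3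
    rw [h1, h2]
    rfl
  obtain ⟨s, σ, h, hs⟩ := exists_sp_image_eq_of_signs (ε := fun _ => 1) (ε' := fun _ => 1)
    ⟨r₁.1, r₁.2, r₁.3.trans typeA_subset_typeBC⟩ ⟨r₂.1, r₂.2, r₂.3.trans typeA_subset_typeBC⟩
    (hmeet r₁) (hmeet r₂) (blockCount_eq_of_prod_gaussEval_eq r₁ r₂ he)
  obtain rfl := hs (fun _ => rfl) fun _ => rfl
  exact hconj ⟨_, sp_mem_autGroup (sp_image_typeA σ), h⟩

end TypeA

end RootChar

end

noncomputable section

namespace RootChar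

/-! ### Composition of conjugacies and invariance under isometries -/

section Isometries

variable {V : Type*} [NormedAddCommGroup V] [InnerProductSpace ℝ V]

theorem Conj.symm {Ψ Φ₁ Φ₂ : Set V} (h : Conj Ψ Φ₁ Φ₂) : Conj Ψ Φ₂ Φ₁ := by
  obtain ⟨g, hg, rfl⟩ := h
  refine ⟨g⁻¹, inv_mem hg, ?_⟩
  rw [← Set.image_comp, show (g⁻¹ : V ≃ₗ[ℝ] V) ∘ g = id from funext g.symm_apply_apply,
    Set.image_id]

theorem Conj.trans {Ψ Φ₁ Φ₂ Φ₃ : Set V} (h : Conj Ψ Φ₁ Φ₂) (h' : Conj Ψ Φ₂ Φ₃) :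
    Conj Ψ Φ₁ Φ₃ := by
  obtain ⟨g, hg, rfl⟩ := h
  obtain ⟨g', hg', rfl⟩ := h'
  exact ⟨g' * g, mul_mem hg' hg, Set.image_comp g' g Φ₁⟩

theorem inner_refl (η v w : V) : inner ℝ (refl η v) (refl η w) = inner ℝ v w :=
  ((ℝ ∙ η)ᗮ).reflection.inner_map_map v w

theorem cusp_of_inner_eq {g : V ≃ₗ[ℝ] V} (hg : ∀ v w, inner ℝ (g v) (g w) = inner ℝ v w)
    (v w : V) : cusp (g v) (g w) = cusp v w := by
  rw [cusp, cusp, hg, hg]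

variable {n : ℕ} {Φ : Set (E n)}

/-- The Gaussian specialisation of the orbit polynomial is invariant under isometries. -/
theorem prod_gaussEval_image {g : E n ≃ₗ[ℝ] E n}
    (hg : ∀ v w, inner ℝ (g v) (g w) = inner ℝ v w) (h : IsReducedSub Φ (typeBC n))
    (h' : IsReducedSub (g '' Φ) (typeBC n)) (c : ℂ) :
    ∏ p ∈ blocks (g '' Φ), gaussEval c (factorPoly p.1 p.2.card) =
      ∏ p ∈ blocks Φ, gaussEval c (factorPoly p.1 p.2.card) := by
  obtain ⟨f, hf⟩ := exists_regular (n := n)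
  have key : ∀ {Θ : Set (E n)} (f : E n →ₗ[ℝ] ℝ), (∀ α ∈ Θ, f α ≠ 0) →
      IsReducedSub Θ (typeBC n) → ∏ p ∈ blocks Θ, gaussEval c (factorPoly p.1 p.2.card) =
        evMap (gaussEval c ∘ mono Finset.univ) (charA f Θ) := by
    intro Θ f hf hΘ
    have := map_evMap (gaussEval c).toLinearMap (mono Finset.univ) (charA f Θ)
    rw [evMap_charA_eq_prod_blocks hΘ hf, AlgHom.toLinearMap_apply, map_prod] at this
    exact this
  rw [key f (fun α hα => hf α (h'.3 hα)) h',
    key (f ∘ₗ g.toLinearMap) (fun α hα => hf _ (h'.3 (Set.mem_image_of_mem g hα))) h]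
  have h1 := evMap_charA_image (L := g.toLinearMap) (gaussEval c ∘ mono Finset.univ) h.1
    g.injective (fun α _ v => cusp_of_inner_eq hg v α) (f := f ∘ₗ g.toLinearMap) (f' := f)
    fun _ _ => Iff.rfl
  refine h1.trans ?_
  congr 1
  congr 1
  funext v
  change gaussEval c (mono Finset.univ (g v)) = gaussEval c (mono Finset.univ v)
  rw [gaussEval_mono, gaussEval_mono, hg]

end Isometries

/-! ### Blocks of subsystems of D_n -/

section TypeD

variable {n : ℕ} {Φ Φ' : Set (E n)}

theorem IsBlock.of_subset_typeD {τ : Fin 4} {I : Finset (Fin n)} (hΦ : Φ ⊆ typeD n)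
    (h : IsBlock Φ τ I) : τ = 0 ∨ τ = 3 := by
  obtain ⟨⟨i, hi⟩, -, ε, hε⟩ := h
  have hm : ∀ α ∈ std τ I ε, α ∈ typeD n := fun α hα => hΦ (hε ▸ hα : α ∈ meet Φ I).1
  fin_cases τ
  · exact Or.inl rfl
  · exact absurd (hm _ (Or.inr ⟨i, hi, 1, (one_smul _ _).symm⟩)) e_notMem_typeD
  · exact absurd (hm _ (Or.inr ⟨i, hi, 1, (one_smul _ _).symm⟩)) double_notMem_typeD
  · exact Or.inr rfl

theorem blockCount_eq_zero_of_subset_typeD (hΦ : Φ ⊆ typeD n) {τ : Fin 4} (h0 : τ ≠ 0)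
    (h3 : τ ≠ 3) (k : ℕ) : blockCount Φ τ k = 0 := by
  rw [blockCount, Finset.card_eq_zero, Finset.filter_eq_empty_iff]
  rintro p hp ⟨h, -⟩
  rcases (mem_blocks.1 hp).of_subset_typeD hΦ with h1 | h1
  · exact h0 (h ▸ h1)
  · exact h3 (h ▸ h1)

/-- On a block of type A the sign of the product of two coordinates is the same for all roots. Roots
a e_i + b e_j and -a e_i + b e_j thus cannot both lie in it. -/
theorem mul_eq_of_mem_setA {I : Finset (Fin n)} {ε : Fin n → ℤˣ} {α : E n} (h : α ∈ setA I ε)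
    {i j : Fin n} (hij : i ≠ j) (hi : α i ≠ 0) (hj : α j ≠ 0) :
    α i * α j = -(((ε i : ℤ) : ℝ) * ((ε j : ℤ) : ℝ)) := by
  obtain ⟨k, -, l, -, hkl, rfl⟩ := h
  simp only [PiLp.sub_apply, units_smul_apply, e_apply] at hi hj ⊢
  by_cases h1 : i = k
  · subst h1
    by_cases h2 : j = l
    · subst h2
      simp [hij, hij.symm]
    · simp [hij.symm, h2] at hj
  · by_cases h2 : i = l
    · subst h2
      by_cases h3 : j = k
      · subst h3
        simp [hij, hij.symm, mul_comm]
      · simp [hij.symm, h3] at hj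
    · simp [h1, h2] at hi

/-- A subsystem of `D_n` that contains `±a e_i ± b e_j` has a factor of type `D`. -/
theorem exists_blockCount_three_pos (h : IsReducedSub Φ (typeD n)) {i j : Fin n} (hij : i ≠ j)
    {a b : ℤˣ} (h1 : a • e i + b • e j ∈ Φ) (h2 : -(a • e i) + b • e j ∈ Φ) :
    ∃ k, 0 < blockCount Φ 3 k := by
  obtain ⟨⟨τ, I⟩, hp, hi⟩ := exists_mem_blocks ⟨h.1, h.2, h.3.trans typeD_subset_typeBC⟩ i
  have ha := cast_units_mul_self a
  have hb := cast_units_mul_self b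
  rcases (mem_blocks.1 hp).of_subset_typeD h.3 with h0 | h0
  · exfalso
    obtain rfl : τ = 0 := h0
    obtain ⟨-, -, ε, hε⟩ := mem_blocks.1 hp
    have hmem : ∀ α ∈ Φ, α i ≠ 0 → α ∈ setA I ε := by
      intro α hα h3
      have h4 : α ∈ meet Φ I := ⟨hα, i, hi, h3⟩
      rw [hε] at h4
      exact h4
    have ha0 : ((a : ℤ) : ℝ) ≠ 0 := left_ne_zero_of_mul_eq_one ha
    have hb0 : ((b : ℤ) : ℝ) ≠ 0 := left_ne_zero_of_mul_eq_one hb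
    have e1 : (a • e i + b • e j : E n) i = ((a : ℤ) : ℝ) := by
      simp [units_smul_apply, e_apply, hij]
    have e2 : (a • e i + b • e j : E n) j = ((b : ℤ) : ℝ) := by
      simp [units_smul_apply, e_apply, hij.symm]
    have e3 : (-(a • e i) + b • e j : E n) i = -((a : ℤ) : ℝ) := by
      simp [units_smul_apply, e_apply, hij]
    have e4 : (-(a • e i) + b • e j : E n) j = ((b : ℤ) : ℝ) := by
      simp [units_smul_apply, e_apply, hij.symm]
    have h3 := mul_eq_of_mem_setA (hmem _ h1 (by rwa [e1])) hij (by rwa [e1]) (by rwa [e2])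
    have h4 := mul_eq_of_mem_setA (hmem _ h2 (by rw [e3]; exact neg_ne_zero.2 ha0)) hij
      (by rw [e3]; exact neg_ne_zero.2 ha0) (by rwa [e4])
    rw [e1, e2] at h3
    rw [e3, e4, ← h3] at h4
    have := mul_ne_zero ha0 hb0
    apply this
    linarith
  · exact ⟨I.card, Finset.card_pos.2 ⟨(τ, I), Finset.mem_filter.2 ⟨hp, h0, rfl⟩⟩⟩

end TypeD

/-! ### Triality in D_4 -/

section Triality

/-- The reflection in half the sum of the vectors `±e_i` in dimension four preserves `D_4`. -/
theorem refl_mem_typeD_four {h : Fin 4 → ℤˣ} {η : E 4} (hη : ∀ i, η i = ((h i : ℤ) : ℝ))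
    {α : E 4} (hα : α ∈ typeD 4) : refl η α ∈ typeD 4 := by
  obtain ⟨p, q, hpq, s, t, rfl⟩ := mem_typeD.1 hα
  have hu := fun x => cast_units_mul_self (h x)
  have hs := cast_units_mul_self s
  have ht := cast_units_mul_self t
  have h4 : inner ℝ η η = 4 := by
    rw [inner_eq_sum]
    simp [hη, hu]
  have hc : refl η (s • e p + t • e q) = s • e p + t • e q -
      ((((s : ℤ) : ℝ) * ((h p : ℤ) : ℝ) + ((t : ℤ) : ℝ) * ((h q : ℤ) : ℝ)) / 2) • η := by
    rw [refl_apply, cusp, h4, real_inner_comm, inner_long, hη, hη]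
    congr 2
    ring
  rw [hc]
  obtain ⟨u, w, hpu, hpw, hqu, hqw, huw, hall⟩ : ∃ u w, p ≠ u ∧ p ≠ w ∧ q ≠ u ∧ q ≠ w ∧ u ≠ w ∧
      ∀ x, x = p ∨ x = q ∨ x = u ∨ x = w := by
    have : ∀ p q : Fin 4, p ≠ q → ∃ u w, p ≠ u ∧ p ≠ w ∧ q ≠ u ∧ q ≠ w ∧ u ≠ w ∧
        ∀ x, x = p ∨ x = q ∨ x = u ∨ x = w := by
      decide
    exact this p q hpq
  -- Either the root pairs to ±2 with η, and subtracting ±η moves it to the complementary pair of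
  -- indices, or it is orthogonal to η and fixed.
  rcases Int.units_eq_one_or (t * h q * (s * h p)) with h1 | h1
  · have h2 : ((t : ℤ) : ℝ) * ((h q : ℤ) : ℝ) * (((s : ℤ) : ℝ) * ((h p : ℤ) : ℝ)) = 1 := by
      simpa using congrArg (fun u : ℤˣ => ((u : ℤ) : ℝ)) h1
    have h3 : ((t : ℤ) : ℝ) * ((h q : ℤ) : ℝ) = ((s : ℤ) : ℝ) * ((h p : ℤ) : ℝ) := by
      linear_combination ((s : ℤ) : ℝ) * ((h p : ℤ) : ℝ) * h2 -
        ((t : ℤ) : ℝ) * ((h q : ℤ) : ℝ) * (((h p : ℤ) : ℝ) ^ 2 * hs + hu p)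
    refine mem_typeD.2 ⟨u, w, huw, -(s * h p * h u), -(s * h p * h w), ?_⟩
    rw [h3]
    ext x
    simp only [PiLp.sub_apply, PiLp.add_apply, PiLp.smul_apply, units_smul_apply, e_apply, hη,
      smul_eq_mul]
    push_cast
    rcases hall x with rfl | rfl | rfl | rfl
    · simp only [hpq, hpu, hpw, if_true, if_false]
      linear_combination -((s : ℤ) : ℝ) * hu x
    · simp only [hpq.symm, hqu, hqw, if_true, if_false]
      linear_combination -((t : ℤ) : ℝ) * hu x + ((h x : ℤ) : ℝ) * h3
    · simp only [hpu.symm, hqu.symm, huw, if_true, if_false]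
      ring
    · simp only [hpw.symm, hqw.symm, huw.symm, if_true, if_false]
      ring
  · have h2 : ((t : ℤ) : ℝ) * ((h q : ℤ) : ℝ) * (((s : ℤ) : ℝ) * ((h p : ℤ) : ℝ)) = -1 := by
      simpa using congrArg (fun u : ℤˣ => ((u : ℤ) : ℝ)) h1
    have h3 : ((t : ℤ) : ℝ) * ((h q : ℤ) : ℝ) = -(((s : ℤ) : ℝ) * ((h p : ℤ) : ℝ)) := by
      linear_combination ((s : ℤ) : ℝ) * ((h p : ℤ) : ℝ) * h2 -
        ((t : ℤ) : ℝ) * ((h q : ℤ) : ℝ) * (((h p : ℤ) : ℝ) ^ 2 * hs + hu p)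
    rw [h3, add_neg_cancel, zero_div, zero_smul, sub_zero]
    exact hα

theorem refl_mem_autGroup_typeD_four {h : Fin 4 → ℤˣ} {η : E 4}
    (hη : ∀ i, η i = ((h i : ℤ) : ℝ)) : refl η ∈ autGroup (typeD 4) := by
  refine ⟨?_, fun α _ β _ => cusp_of_inner_eq (inner_refl η) α β⟩
  apply Set.Subset.antisymm
  · rintro _ ⟨α, hα, rfl⟩
    exact refl_mem_typeD_four hη hα
  · intro α hα
    refine ⟨refl η α, refl_mem_typeD_four hη hα, ?_⟩
    rw [← LinearEquiv.mul_apply, refl_mul_self, LinearEquiv.coe_one, id]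

variable {Φ : Set (E 4)}

/-- Two roots with disjoint supports are mapped by triality to a pair `±a e_i ± b e_j`. -/
theorem exists_refl_image {i j k l : Fin 4} (hij : i ≠ j) (hik : i ≠ k) (hil : i ≠ l)
    (hjk : j ≠ k) (hjl : j ≠ l) (hkl : k ≠ l) {a b c d : ℤˣ} (h1 : a • e i + b • e j ∈ Φ)
    (h2 : c • e k + d • e l ∈ Φ) (hΦ : IsReducedSub Φ (typeD 4)) :
    ∃ γ ∈ autGroup (typeD 4), (∀ v w, inner ℝ (γ v) (γ w) = inner ℝ v w) ∧
      IsReducedSub (γ '' Φ) (typeD 4) ∧ ∃ k, 0 < blockCount (γ '' Φ) 3 k := by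
  -- With η = a e_i - b e_j + c e_k + d e_l the first root is orthogonal to η and fixed, and the
  -- second becomes (c e_k + d e_l) - η = -a e_i + b e_j.
  let h : Fin 4 → ℤˣ := fun x => if x = i then a else if x = j then -b else if x = k then c else d
  let η : E 4 := WithLp.toLp 2 fun x => ((h x : ℤ) : ℝ)
  have hη : ∀ x, η x = ((h x : ℤ) : ℝ) := fun x => rfl
  have hi : h i = a := by simp [h]
  have hj : h j = -b := by simp [h, hij.symm]
  have hk : h k = c := by simp [h, hik.symm, hjk.symm]
  have hl : h l = d := by simp [h, hil.symm, hjl.symm, hkl.symm]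
  have h4 : inner ℝ η η = 4 := by
    rw [inner_eq_sum]
    simp [hη, cast_units_mul_self]
  have hall : ∀ x, x = i ∨ x = j ∨ x = k ∨ x = l := by
    intro x
    omega
  have hγ := refl_mem_autGroup_typeD_four hη
  have hr : IsReducedSub (refl η '' Φ) (typeD 4) :=
    hΦ.image (L := (refl η).toLinearMap) (refl η).injective hγ.1 fun α _ v =>
      cusp_of_inner_eq (inner_refl η) v α
  refine ⟨refl η, hγ, inner_refl η, hr, ?_⟩
  refine exists_blockCount_three_pos hr hij (a := a) (b := b) ⟨_, h1, ?_⟩ ⟨_, h2, ?_⟩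
  · rw [refl_apply, cusp, real_inner_comm, inner_long, hη, hη, hi, hj]
    push_cast
    rw [mul_neg, cast_units_mul_self, cast_units_mul_self]
    simp
  · rw [refl_apply, cusp, real_inner_comm, inner_long, hη, hη, hk, hl, cast_units_mul_self,
      cast_units_mul_self, h4]
    ext x
    simp only [PiLp.sub_apply, PiLp.add_apply, PiLp.smul_apply, PiLp.neg_apply, units_smul_apply,
      e_apply, hη, smul_eq_mul]
    rcases hall x with rfl | rfl | rfl | rfl
    · simp [hij, hik, hil, hi]
      norm_num
    · simp [hij.symm, hjk, hjl, hj]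
      norm_num
    · simp [hik.symm, hjk.symm, hkl, hk]
      norm_num
    · simp [hil.symm, hjl.symm, hkl.symm, hl]
      norm_num

/-- Up to triality, a subsystem of `D_4` has a factor of type `D`, or neither a factor `A_3` nor
two factors `A_1`. -/
theorem exists_triality_image (h : IsReducedSub Φ (typeD 4)) :
    ∃ γ ∈ autGroup (typeD 4), (∀ v w, inner ℝ (γ v) (γ w) = inner ℝ v w) ∧
      IsReducedSub (γ '' Φ) (typeD 4) ∧ ((∃ k, 0 < blockCount (γ '' Φ) 3 k) ∨
        blockCount (γ '' Φ) 0 4 = 0 ∧ blockCount (γ '' Φ) 0 2 ≤ 1) := by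
  by_cases hc : blockCount Φ 0 4 = 0 ∧ blockCount Φ 0 2 ≤ 1
  · have h1 : ((1 : E 4 ≃ₗ[ℝ] E 4) : E 4 → E 4) '' Φ = Φ := Set.image_id Φ
    refine ⟨1, one_mem _, fun _ _ => rfl, ?_⟩
    rw [h1]
    exact ⟨h, Or.inr hc⟩
  -- A factor A_3, or two factors A_1, contains two roots with disjoint supports, to which
  -- `exists_refl_image` applies.
  suffices ∃ i j k l : Fin 4, i ≠ j ∧ i ≠ k ∧ i ≠ l ∧ j ≠ k ∧ j ≠ l ∧ k ≠ l ∧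
      ∃ a b c d : ℤˣ, a • e i + b • e j ∈ Φ ∧ c • e k + d • e l ∈ Φ by
    obtain ⟨i, j, k, l, hij, hik, hil, hjk, hjl, hkl, a, b, c, d, h1, h2⟩ := this
    obtain ⟨γ, h3, h4, h5, h6⟩ := exists_refl_image hij hik hil hjk hjl hkl h1 h2 h
    exact ⟨γ, h3, h4, h5, Or.inl h6⟩
  have hA : ∀ {I : Finset (Fin 4)}, (0, I) ∈ blocks Φ → ∀ i ∈ I, ∀ j ∈ I, i ≠ j →
      ∃ a b : ℤˣ, a • e i + b • e j ∈ Φ := by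
    intro I hI i hi j hj hij
    obtain ⟨-, -, ε, hε⟩ := mem_blocks.1 hI
    have h1 : ε i • e i - ε j • e j ∈ meet Φ I := by
      rw [hε]
      exact ⟨i, hi, j, hj, hij, rfl⟩
    exact ⟨ε i, -ε j, by rw [Units.neg_smul, ← sub_eq_add_neg]; exact h1.1⟩
  by_cases h4 : blockCount Φ 0 4 = 0
  · have h2 : 1 < blockCount Φ 0 2 := by
      by_contra h2
      exact hc ⟨h4, by omega⟩
    obtain ⟨⟨τ, I⟩, hI, ⟨τ', J⟩, hJ, hne⟩ := Finset.one_lt_card.1 h2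
    obtain ⟨hI, hτ, hI2⟩ := Finset.mem_filter.1 hI
    obtain ⟨hJ, hτ', hJ2⟩ := Finset.mem_filter.1 hJ
    obtain rfl : τ = 0 := hτ
    obtain rfl : τ' = 0 := hτ'
    have hdisj : ∀ x ∈ I, ∀ y ∈ J, x ≠ y := by
      rintro x hx _ hy rfl
      exact hne (blocks_eq_of_mem hI hJ hx hy)
    obtain ⟨i, hi, j, hj, hij⟩ := Finset.one_lt_card.1 (show 1 < I.card from hI2 ▸ one_lt_two)
    obtain ⟨k, hk, l, hl, hkl⟩ := Finset.one_lt_card.1 (show 1 < J.card from hJ2 ▸ one_lt_two)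
    obtain ⟨a, b, h1⟩ := hA hI i hi j hj hij
    obtain ⟨c, d, h2⟩ := hA hJ k hk l hl hkl
    exact ⟨i, j, k, l, hij, hdisj _ hi _ hk, hdisj _ hi _ hl, hdisj _ hj _ hk, hdisj _ hj _ hl,
      hkl, a, b, c, d, h1, h2⟩
  · obtain ⟨⟨τ, I⟩, hI⟩ := Finset.card_pos.1 (Nat.pos_of_ne_zero h4)
    obtain ⟨hI, hτ, hI4⟩ := Finset.mem_filter.1 hI
    obtain rfl : τ = 0 := hτ
    obtain rfl : I = Finset.univ := (Finset.card_eq_iff_eq_univ I).1 hI4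
    obtain ⟨a, b, h1⟩ := hA hI 0 (Finset.mem_univ _) 1 (Finset.mem_univ _) (by decide)
    obtain ⟨c, d, h2⟩ := hA hI 2 (Finset.mem_univ _) 3 (Finset.mem_univ _) (by decide)
    exact ⟨0, 1, 2, 3, by decide, by decide, by decide, by decide, by decide, by decide, a, b, c,
      d, h1, h2⟩

end Triality

/-! ### Type D_4 -/

section TypeDFour

theorem gaussEval_factorPoly_zero {c q : ℂ} (hq : Complex.exp c = q) (k : ℕ) :
    gaussEval c (factorPoly 0 k) = toepA (fun j => q ^ j ^ 2) k := by
  rw [← hq, ← gaussEval_comp_var, ← map_toepA]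
  rfl

theorem gaussEval_factorPoly_three {c q : ℂ} (hq : Complex.exp c = q) (k : ℕ) :
    gaussEval c (factorPoly 3 k) = (1 / 2) * toepD (fun j => q ^ j ^ 2) k := by
  rw [← hq, ← gaussEval_comp_var, ← map_toepD, factorPoly, map_smul, Algebra.smul_def]
  simp

/-- The values at `q = 1/2` of the factors that occur in `D_4`. -/
theorem gaussEval_factorPoly_half {c : ℂ} (hq : Complex.exp c = 1 / 2) :
    gaussEval c (factorPoly 0 1) = 1 ∧ gaussEval c (factorPoly 0 2) = 3 / 4 ∧
      gaussEval c (factorPoly 0 3) = 135 / 256 ∧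
      gaussEval c (factorPoly 3 2) = 9 / 16 ∧
      gaussEval c (factorPoly 3 3) = 382725 / 1048576 ∧
      gaussEval c (factorPoly 3 4) = 17831844100310625 / 72057594037927936 := by
  simp only [gaussEval_factorPoly_zero hq, gaussEval_factorPoly_three hq]
  refine ⟨?_, ?_, ?_, ?_, ?_, ?_⟩ <;>
  · simp [toepA, toepD, Matrix.det_succ_row_zero, Fin.sum_univ_succ, Fin.succAbove]
    try norm_num

theorem sum_blockCount_four {Φ : Set (E 4)} (h : IsReducedSub Φ (typeD 4)) :
    blockCount Φ 0 1 + 2 * blockCount Φ 0 2 + 3 * blockCount Φ 0 3 + 4 * blockCount Φ 0 4 +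
      2 * blockCount Φ 3 2 + 3 * blockCount Φ 3 3 + 4 * blockCount Φ 3 4 = 4 := by
  have h1 := sum_blockCount ⟨h.1, h.2, h.3.trans typeD_subset_typeBC⟩
  have hB := blockCount_eq_zero_of_subset_typeD h.3 (τ := 1) (by decide) (by decide)
  have hC := blockCount_eq_zero_of_subset_typeD h.3 (τ := 2) (by decide) (by decide)
  have hD : blockCount Φ 3 1 = 0 := blockCount_three_one
  simp only [Fin.sum_univ_four, hB, hC] at h1
  simp [Finset.sum_Icc_succ_top, hD] at h1
  omega

/-- The possible numbers of factors `A_1`, `A_2`, `D_2`, `D_3`, `D_4` of a subsystem of `D_4`, up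
to triality. -/
def factorCounts : List (ℕ × ℕ × ℕ × ℕ × ℕ) :=
  [(0, 0, 0, 0, 0), (1, 0, 0, 0, 0), (0, 1, 0, 0, 0), (0, 0, 1, 0, 0), (1, 0, 1, 0, 0),
    (0, 0, 2, 0, 0), (0, 0, 0, 1, 0), (0, 0, 0, 0, 1)]

/-- The product of the values of the factors at `q = 1/2`. -/
def factorValue : ℕ × ℕ × ℕ × ℕ × ℕ → ℂ := fun (a, b, c, d, e) =>
  (3 / 4) ^ a * (135 / 256) ^ b * (9 / 16) ^ c * (382725 / 1048576) ^ d *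
    (17831844100310625 / 72057594037927936) ^ e

theorem prod_gaussEval_four {Φ : Set (E 4)} (h : IsReducedSub Φ (typeD 4)) {c : ℂ}
    (hq : Complex.exp c = 1 / 2) (h4 : blockCount Φ 0 4 = 0) :
    ∏ p ∈ blocks Φ, gaussEval c (factorPoly p.1 p.2.card) =
      factorValue (blockCount Φ 0 2, blockCount Φ 0 3, blockCount Φ 3 2, blockCount Φ 3 3,
        blockCount Φ 3 4) := by
  have hB := blockCount_eq_zero_of_subset_typeD h.3 (τ := 1) (by decide) (by decide)
  have hC := blockCount_eq_zero_of_subset_typeD h.3 (τ := 2) (by decide) (by decide)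
  have hD : blockCount Φ 3 1 = 0 := blockCount_three_one
  obtain ⟨v1, v2, v3, w2, w3, w4⟩ := gaussEval_factorPoly_half hq
  rw [prod_blocks fun τ k => gaussEval c (factorPoly τ k)]
  simp only [Fin.prod_univ_four, hB, hC]
  simp only [Nat.reduceLeDiff, Finset.prod_Icc_succ_top, Finset.Icc_self, Finset.prod_singleton,
    hD, h4, v1, v2, v3, w2, w3, w4, one_pow, pow_zero, mul_one, one_mul, factorValue]
  ring

/-- The total size 4 leaves few possibilities. The normalisation by triality removes A_3 and 2A_1,
whose Gaussian values coincide with those of D_3 and D_2. -/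
theorem blockCount_four_cases {Φ : Set (E 4)} (h : IsReducedSub Φ (typeD 4))
    (hn : (∃ k, 0 < blockCount Φ 3 k) ∨ blockCount Φ 0 4 = 0 ∧ blockCount Φ 0 2 ≤ 1) :
    blockCount Φ 0 4 = 0 ∧
      (blockCount Φ 0 2, blockCount Φ 0 3, blockCount Φ 3 2, blockCount Φ 3 3,
        blockCount Φ 3 4) ∈ factorCounts := by
  have hs := sum_blockCount_four h
  have hn' : 0 < blockCount Φ 3 2 + blockCount Φ 3 3 + blockCount Φ 3 4 ∨
      blockCount Φ 0 4 = 0 ∧ blockCount Φ 0 2 ≤ 1 := by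
    refine hn.imp_left ?_
    rintro ⟨k, hk⟩
    have h5 : k ≤ 4 := by
      by_contra h5
      exact hk.ne' (blockCount_eq_zero_of_lt 3 (by omega))
    interval_cases k
    · exact absurd (blockCount_zero_right 3) hk.ne'
    · exact absurd blockCount_three_one hk.ne'
    all_goals omega
  simp only [factorCounts, List.mem_cons, Prod.mk.injEq, List.not_mem_nil, or_false]
  generalize blockCount Φ 0 1 = x1 at *
  generalize blockCount Φ 0 2 = x2 at *
  generalize blockCount Φ 0 3 = x3 at *
  generalize blockCount Φ 0 4 = x4 at *
  generalize blockCount Φ 3 2 = y2 at *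
  generalize blockCount Φ 3 3 = y3 at *
  generalize blockCount Φ 3 4 = y4 at *
  clear hn
  have : x4 = 0 := by omega
  have : y4 ≤ 1 := by omega
  have : y3 ≤ 1 := by omega
  have : y2 ≤ 2 := by omega
  have : x3 ≤ 1 := by omega
  refine ⟨by omega, ?_⟩
  interval_cases y4 <;> interval_cases y3 <;> interval_cases y2 <;> interval_cases x3 <;>
    omega

theorem blockCount_eq_of_prod_gaussEval_eq_four {Φ Φ' : Set (E 4)} (h : IsReducedSub Φ (typeD 4))
    (h' : IsReducedSub Φ' (typeD 4))
    (hn : (∃ k, 0 < blockCount Φ 3 k) ∨ blockCount Φ 0 4 = 0 ∧ blockCount Φ 0 2 ≤ 1)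
    (hn' : (∃ k, 0 < blockCount Φ' 3 k) ∨ blockCount Φ' 0 4 = 0 ∧ blockCount Φ' 0 2 ≤ 1)
    (he : ∀ c, ∏ p ∈ blocks Φ, gaussEval c (factorPoly p.1 p.2.card) =
      ∏ p ∈ blocks Φ', gaussEval c (factorPoly p.1 p.2.card)) (τ : Fin 4) (k : ℕ) :
    blockCount Φ τ k = blockCount Φ' τ k := by
  obtain ⟨h4, hc⟩ := blockCount_four_cases h hn
  obtain ⟨h4', hc'⟩ := blockCount_four_cases h' hn'
  have hq : Complex.exp (Complex.log (1 / 2)) = 1 / 2 := Complex.exp_log (by norm_num)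
  have hv := he (Complex.log (1 / 2))
  rw [prod_gaussEval_four h hq h4, prod_gaussEval_four h' hq h4'] at hv
  -- The eight rational values at q = 1/2 are pairwise distinct.
  have key : ∀ x ∈ factorCounts, ∀ x' ∈ factorCounts, factorValue x = factorValue x' → x = x' := by
    intro x hx x' hx' hxx'
    simp only [factorCounts, List.mem_cons, List.not_mem_nil, or_false] at hx hx'
    rcases hx with rfl | rfl | rfl | rfl | rfl | rfl | rfl | rfl <;>
      rcases hx' with rfl | rfl | rfl | rfl | rfl | rfl | rfl | rfl <;>
        first
        | rfl
        | exfalso; norm_num [factorValue] at hxx'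
  have hk := key _ hc _ hc' hv
  simp only [Prod.mk.injEq] at hk
  obtain ⟨e2, e3, d2, d3, d4⟩ := hk
  have hs := sum_blockCount_four h
  have hs' := sum_blockCount_four h'
  rcases Nat.lt_or_ge 4 k with hk | hk
  · rw [blockCount_eq_zero_of_lt τ hk, blockCount_eq_zero_of_lt τ hk]
  by_cases h0 : τ = 0
  · subst h0
    interval_cases k
    · rw [blockCount_zero_right, blockCount_zero_right]
    all_goals omega
  by_cases h3 : τ = 3
  · subst h3
    interval_cases k
    · rw [blockCount_zero_right, blockCount_zero_right]
    · rw [blockCount_three_one, blockCount_three_one]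
    all_goals omega
  rw [blockCount_eq_zero_of_subset_typeD h.3 h0 h3, blockCount_eq_zero_of_subset_typeD h'.3 h0 h3]

/-- The character determines the conjugacy class in `D_4`. -/
theorem conj_of_charF_eq_typeD_four {V : Type*} [NormedAddCommGroup V] [InnerProductSpace ℝ V]
    [FiniteDimensional ℝ V] {Ψ Φ₁ Φ₂ : Set V} {f : V →ₗ[ℝ] ℝ} (hI : IsIrreducible Ψ)
    (hiso : Iso Ψ (typeD 4)) (hf : ∀ α ∈ Ψ, f α ≠ 0) (h₁ : IsReducedSub Φ₁ Ψ)
    (h₂ : IsReducedSub Φ₂ Ψ) (hF : charF (autGroup Ψ) f Φ₁ = charF (autGroup Ψ) f Φ₂) :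
    Conj Ψ Φ₁ Φ₂ := by
  obtain ⟨Θ₁, Θ₂, r₁, r₂, hconj, he⟩ :=
    exists_transport_of_simplyLaced hI hiso subset_rfl hf h₁ h₂ hF
  have hBC : ∀ {Θ : Set (E 4)}, IsReducedSub Θ (typeD 4) → IsReducedSub Θ (typeBC 4) :=
    fun h => ⟨h.1, h.2, h.3.trans typeD_subset_typeBC⟩
  obtain ⟨γ₁, hγ₁, i₁, s₁, hn₁⟩ := exists_triality_image r₁
  obtain ⟨γ₂, hγ₂, i₂, s₂, hn₂⟩ := exists_triality_image r₂
  obtain ⟨s, σ, h⟩ := exists_sp_image_eq (hBC s₁) (hBC s₂)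
    (blockCount_eq_of_prod_gaussEval_eq_four s₁ s₂ hn₁ hn₂ fun c => by
      rw [prod_gaussEval_image i₁ (hBC r₁) (hBC s₁), prod_gaussEval_image i₂ (hBC r₂) (hBC s₂),
        he])
  have c₁ : Conj (typeD 4) Θ₁ (γ₁ '' Θ₁) := ⟨γ₁, hγ₁, rfl⟩
  have c₂ : Conj (typeD 4) Θ₂ (γ₂ '' Θ₂) := ⟨γ₂, hγ₂, rfl⟩
  have c₃ : Conj (typeD 4) (γ₁ '' Θ₁) (γ₂ '' Θ₂) := ⟨_, sp_mem_autGroup (sp_image_typeD s σ), h⟩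
  exact hconj ((c₁.trans c₃).trans c₂.symm)

end TypeDFour

end RootChar

end

/-! ### The theorem -/

theorem theoremT :
    (∀ (V : Type*) [NormedAddCommGroup V] [InnerProductSpace ℝ V] [FiniteDimensional ℝ V]
      (Ψ : Set V), RootChar.IsIrreducible Ψ → RootChar.IsClassical Ψ →
      ∀ f : V →ₗ[ℝ] ℝ, (∀ α ∈ Ψ, f α ≠ 0) →
      (∃ Φ₁ Φ₂ : Set V, RootChar.IsReducedSub Φ₁ Ψ ∧ RootChar.IsReducedSub Φ₂ Ψ ∧
        ¬ RootChar.Conj Ψ Φ₁ Φ₂ ∧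
        RootChar.charF (RootChar.autGroup Ψ) f Φ₁ = RootChar.charF (RootChar.autGroup Ψ) f Φ₂) →
      ∃ n : ℕ, 1 ≤ n ∧
        (RootChar.Iso Ψ (RootChar.typeC n) ∨ RootChar.Iso Ψ (RootChar.typeBC n))) ∧
    (∀ (n : ℕ), 1 ≤ n → ∀ Ψ : Set (EuclideanSpace ℝ (Fin n)),
      Ψ = RootChar.typeC n ∨ Ψ = RootChar.typeBC n →
      ∀ f : EuclideanSpace ℝ (Fin n) →ₗ[ℝ] ℝ, (∀ α ∈ Ψ, f α ≠ 0) →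
      ∀ Φ₁ Φ₂ : Set (EuclideanSpace ℝ (Fin n)),
      RootChar.IsReducedSub Φ₁ Ψ → RootChar.IsReducedSub Φ₂ Ψ →
      (RootChar.charF (RootChar.autGroup Ψ) f Φ₁ = RootChar.charF (RootChar.autGroup Ψ) f Φ₂ ↔
        ∀ m : ℕ, 1 ≤ m → m ≤ n →
          (RootChar.countB m Φ₁ : ℤ) - RootChar.countB m Φ₂ = 0 ∧
          (RootChar.countA (2 * m) Φ₁ : ℤ) - RootChar.countA (2 * m) Φ₂ = 0 ∧
          (RootChar.countA (2 * m + 1) Φ₁ : ℤ) - RootChar.countA (2 * m + 1) Φ₂ =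
            (RootChar.countC m Φ₂ : ℤ) - RootChar.countC m Φ₁ ∧
          (RootChar.countC m Φ₂ : ℤ) - RootChar.countC m Φ₁ =
            (RootChar.countD (m + 1) Φ₂ : ℤ) - RootChar.countD (m + 1) Φ₁)) := by
  refine ⟨?_, fun n _ Ψ hΨ f hf Φ₁ Φ₂ h₁ h₂ => RootChar.charF_eq_iff_counts hΨ hf h₁ h₂⟩
  rintro V _ _ _ Ψ hI ⟨n, hn⟩ f hf ⟨Φ₁, Φ₂, h₁, h₂, hne, hF⟩
  rcases hn with ⟨-, hiso⟩ | ⟨-, hiso⟩ | ⟨hn, hiso⟩ | ⟨hn, hiso⟩ | ⟨hn, hiso⟩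
  · exact absurd (RootChar.conj_of_charF_eq_typeA hI hiso hf h₁ h₂ hF) hne
  · exact absurd (RootChar.conj_of_charF_eq_typeB hI hiso hf h₁ h₂ hF) hne
  · exact ⟨n, hn, Or.inl hiso⟩
  · exact ⟨n, hn, Or.inr hiso⟩
  -- Triality gives D_4 automorphisms that are not signed permutations, so it is treated apart.
  · rcases eq_or_ne n 4 with rfl | hn4
    · exact absurd (RootChar.conj_of_charF_eq_typeD_four hI hiso hf h₁ h₂ hF) hne
    · exact absurd (RootChar.conj_of_charF_eq_typeD hn hn4 hI hiso hf h₁ h₂ hF) hne
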